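/- Notation: $e(x)=e^{2\pi i x}$; $\mathbb H_n$ is the Siegel upper half space of genus $n$; $\mathrm{Mp}_{2n}(\mathbb Z)$ is the group of pairs $(\gamma,\omega)$ with $\gamma=\left(\begin{smallmatrix}a&b\\c&d\end{smallmatrix}\right)\in\mathrm{Sp}_{2n}(\mathbb Z)$ and $\omega$ a holomorphic function on $\mathbb H_n$ with $\omega(\tau)^2=\det(c\tau+d)$; $\Gamma(M)\subset \mathrm{Mp}_{2n}(\mathbb Z)$ is the subgroup given by $\gamma\equiv 1 \pmod M$. Let $g\ge 2$ and $k\in\frac12\mathbb Z$. A Jacobi form of genus $g-1$, weight $k$ and index $m\in\mathbb Z_{\ge 0}$ is a holomorphic function $\phi$ on $\mathbb H_{g-1}\times\mathbb C^{g-1}$ such that $$\phi\big(\gamma\tau_1,{}^t(c\tau_1+d)^{-1}z\big)=\omega(\tau_1)^{2k}\,e\big(m\,{}^tz(c\tau_1+d)^{-1}cz\big)\,\phi(\tau_1,z)\quad\text{for all }(\gamma,\omega)\in\mathrm{Mp}_{2(g-1)}(\mathbb Z),$$ $$\phi(\tau_1,z+\tau_1\alpha+\beta)=e\big(-m({}^t\alpha\tau_1\alpha+2\,{}^t\alpha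 z)\big)\,\phi(\tau_1,z)\quad\text{for all }\alpha,\beta\in\mathbb Z^{g-1},$$ and which has a Fourier expansion $\phi(\tau_1,z)=\sum_{n,r}c(\phi;n,r)\,e(\mathrm{tr}(n\tau_1)+{}^trz)$, with $n$ running through the half-integral symmetric matrices and $r$ through $\mathbb Z^{g-1}$, where $c(\phi;n,r)=0$ unless $\left(\begin{smallmatrix}n&r/2\\{}^tr/2&m\end{smallmatrix}\right)\ge 0$. A symmetric formal Fourier–Jacobi series of genus $g$, cogenus $1$ and weight $k$ is a formal series $f=\sum_{m\ge 0}\phi_m(\tau_1,z)\,q_2^m$ in which $\phi_m$ is a Jacobi form of genus $g-1$, weight $k$ and index $m$, and whose coefficients $c(f;t)=c(\phi_m;n,r)$, $t=\left(\begin{smallmatrix}n&r/2\\{}^tr/2&m\end{smallmatrix}\right)$, satisfy $c(f;{}^tu\,t\,u)=s^{2k}\,c(f;t)$ for all positive semidefinite half-integral $t$, all $u\in\mathrm{GL}_g(\mathbb Z)$ and each $s\in\mathbb C$ with $s^2=\det u$ (that is, $c(f;{}^tu\,t\,u)=\det(u)^kc(f;t)$ if $k\in\mathbb Z$). It is called cuspidal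 if $\phi_0=0$. A holomorphic function $h$ on $\mathbb H_{g-1}$ is a Siegel cusp form of weight $k$ and genus $g-1$ for $\Gamma(M)$ if $h(\gamma\tau_1)=\omega(\tau_1)^{2k}h(\tau_1)$ for all $(\gamma,\omega)\in\Gamma(M)$, and if for every $(\gamma,\omega)\in\mathrm{Mp}_{2(g-1)}(\mathbb Z)$ the function $\omega(\tau_1)^{-2k}h(\gamma\tau_1)$ has a Fourier expansion $\sum_{n>0}c(n)\,e(\mathrm{tr}(n\tau_1)/M)$ over positive definite half-integral symmetric matrices $n$. Put $\|h\|_\infty=\sup_{\tau_1\in\mathbb H_{g-1}}|h(\tau_1)|\det(\operatorname{Im}\tau_1)^{k/2}\in[0,\infty]$. **Proposition.** Let $f=\sum_m\phi_m q_2^m$ be a cuspidal symmetric formal Fourier–Jacobi series of genus $g\ge2$, cogenus $1$ and weight $k$, and let $N$ be a positive integer. For $\lambda,\mu\in\frac1N\mathbb Z^{g-1}$ and $m\ge 0$ put $$\eta_m(\tau_1)=e(m\,{}^t\lambda\tau_1\lambda)\,\phi_m(\tau_1,\tau_1\lambda+\mu).$$ Then every $\eta_m$ is a Siegel cusp form of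 weight $k$ and genus $g-1$ for $\Gamma(N^2)$. Moreover, there is a constant $C>0$, depending only on $f$ (hence on $g$ and $k$) and $N$, such that for all $\lambda,\mu\in\frac1N\mathbb Z^{g-1}$ and all $m>0$ $$\|\eta_m\|_\infty\le C\,m^{k+\frac{g-1}{2}}.$$ -/

import Mathlib

open scoped Matrix ENNReal

noncomputable section

namespace FormalFJ

/-- `e(x) = exp(2πi x)`. -/
def e (x : ℂ) : ℂ := Complex.exp (2 * Real.pi * Complex.I * x)

/-- The Siegel upper half space of genus `n`: symmetric complex matrices with positive definite
imaginary part. Complex differentiability on this set (`DifferentiableOn ℂ`) only tests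
increments inside the space of symmetric matrices, in which the set is open, so it is
holomorphy on the Siegel upper half space. -/
def siegelUpperHalfSpace (n : ℕ) : Set (Matrix (Fin n) (Fin n) ℂ) :=
  {τ | τ.IsSymm ∧ (τ.map Complex.im).PosDef}

/-- `c τ + d` for `γ = (a b; c d)`. -/
def denom {n : ℕ} (γ : Matrix (Fin n ⊕ Fin n) (Fin n ⊕ Fin n) ℤ)
    (τ : Matrix (Fin n) (Fin n) ℂ) : Matrix (Fin n) (Fin n) ℂ :=
  γ.toBlocks₂₁.map (fun x : ℤ => (x : ℂ)) * τ + γ.toBlocks₂₂.map (fun x : ℤ => (x : ℂ))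

/-- `γ τ = (a τ + b) (c τ + d)⁻¹` for `γ = (a b; c d)`. -/
def moebius {n : ℕ} (γ : Matrix (Fin n ⊕ Fin n) (Fin n ⊕ Fin n) ℤ)
    (τ : Matrix (Fin n) (Fin n) ℂ) : Matrix (Fin n) (Fin n) ℂ :=
  (γ.toBlocks₁₁.map (fun x : ℤ => (x : ℂ)) * τ + γ.toBlocks₁₂.map (fun x : ℤ => (x : ℂ))) *
    (denom γ τ)⁻¹

/-- Elements `(γ, ω)` of the metaplectic group `Mp_{2n}(ℤ)`: an integral symplectic matrix `γ`
with a holomorphic square root `ω` of `τ ↦ det (c τ + d)` on the Siegel upper half space. -/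
structure Mp (n : ℕ) where
  γ : Matrix (Fin n ⊕ Fin n) (Fin n ⊕ Fin n) ℤ
  mem : γ ∈ Matrix.symplecticGroup (Fin n) ℤ
  ω : Matrix (Fin n) (Fin n) ℂ → ℂ
  holo : DifferentiableOn ℂ ω (siegelUpperHalfSpace n)
  sq : ∀ τ ∈ siegelUpperHalfSpace n, ω τ ^ 2 = (denom γ τ).det

/-- The principal congruence subgroup `Γ(M)` of `Mp_{2n}(ℤ)` (all `(γ, ω)` with `γ ≡ 1 mod M`). -/
def principalCongruence (n M : ℕ) : Set (Mp n) :=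
  {g | g.γ.map (fun x : ℤ => (x : ZMod M)) = 1}

/-- The slash action of weight `k = κ / 2`: `(F |_k (γ, ω)) (τ) = ω(τ)^{-2k} F(γ τ)`. -/
def slash {n : ℕ} (κ : ℤ) (F : Matrix (Fin n) (Fin n) ℂ → ℂ) (g : Mp n)
    (τ : Matrix (Fin n) (Fin n) ℂ) : ℂ :=
  g.ω τ ^ (-κ) * F (moebius g.γ τ)

/-- Half-integral symmetric matrices: `t i i ∈ ℤ` and `2 t i j ∈ ℤ`. -/
def HalfIntegral {ι : Type} (t : Matrix ι ι ℚ) : Prop :=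
  t.IsSymm ∧ (∀ i, ∃ a : ℤ, t i i = a) ∧ ∀ i j, ∃ a : ℤ, 2 * t i j = a

/-- The type of half-integral symmetric `n × n` matrices. -/
abbrev HalfInt (n : ℕ) : Type := {t : Matrix (Fin n) (Fin n) ℚ // HalfIntegral t}

/-- `tr (t τ)` for a rational matrix `t`. -/
def traceMul {n : ℕ} (t : Matrix (Fin n) (Fin n) ℚ) (τ : Matrix (Fin n) (Fin n) ℂ) : ℂ :=
  (t.map (fun x : ℚ => (x : ℂ)) * τ).trace

/-- `F` is a Siegel cusp form of genus `n` and weight `k = κ / 2` for `Γ(M)`: it is holomorphic,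
invariant under the weight `k` action of `Γ(M)`, and at every cusp (i.e. for every `F |_k g` with
`g ∈ Mp_{2n}(ℤ)`) it has a Fourier expansion supported on positive definite matrices. -/
structure IsSiegelCuspForm (n : ℕ) (κ : ℤ) (M : ℕ) (F : Matrix (Fin n) (Fin n) ℂ → ℂ) :
    Prop where
  holo : DifferentiableOn ℂ F (siegelUpperHalfSpace n)
  invariant : ∀ g ∈ principalCongruence n M, ∀ τ ∈ siegelUpperHalfSpace n,
    slash κ F g τ = F τ
  cuspidal : ∀ g : Mp n, ∃ c : HalfInt n → ℂ,
    (∀ t, c t ≠ 0 → (t.1.map (fun x : ℚ => (x : ℝ))).PosDef) ∧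
    ∀ τ ∈ siegelUpperHalfSpace n,
      HasSum (fun t : HalfInt n => c t * e (traceMul t.1 τ / M)) (slash κ F g τ)

/-- `‖F‖_∞ = sup_τ |F(τ)| det(Im τ)^{k/2}` with `k = κ / 2`, as an element of `[0, ∞]`. -/
def heckeNorm {n : ℕ} (κ : ℤ) (F : Matrix (Fin n) (Fin n) ℂ → ℂ) : ℝ≥0∞ :=
  ⨆ τ ∈ siegelUpperHalfSpace n,
    ENNReal.ofReal (‖F τ‖ * (τ.map Complex.im).det ^ ((κ : ℝ) / 4))

/-- The matrix `(T, r/2; rᵀ/2, m)` of size `n + 1`. -/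
def blockMatrix {n : ℕ} (T : Matrix (Fin n) (Fin n) ℚ) (r : Fin n → ℤ) (m : ℕ) :
    Matrix (Fin n ⊕ Unit) (Fin n ⊕ Unit) ℚ :=
  Matrix.fromBlocks T (Matrix.of fun i _ => (r i : ℚ) / 2) (Matrix.of fun _ j => (r j : ℚ) / 2)
    (Matrix.of fun _ _ => (m : ℚ))

/-- `φ(τ, z) = ∑_{T, r} c(T, r) e(tr(T τ) + rᵀ z)`, where `T` runs over half-integral matrices and
`r` over `ℤⁿ`, with `c(T, r) = 0` unless `(T, r/2; rᵀ/2, m)` is positive semidefinite. -/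
def HasJacobiFourierExpansion {n : ℕ} (m : ℕ)
    (φ : Matrix (Fin n) (Fin n) ℂ → (Fin n → ℂ) → ℂ)
    (c : Matrix (Fin n) (Fin n) ℚ → (Fin n → ℤ) → ℂ) : Prop :=
  (∀ (T : HalfInt n) (r : Fin n → ℤ), c T.1 r ≠ 0 →
    ((blockMatrix T.1 r m).map (fun x : ℚ => (x : ℝ))).PosSemidef) ∧
  ∀ τ ∈ siegelUpperHalfSpace n, ∀ z : Fin n → ℂ,
    HasSum (fun p : HalfInt n × (Fin n → ℤ) =>
      c p.1.1 p.2 * e (traceMul p.1.1 τ + (fun i => (p.2 i : ℂ)) ⬝ᵥ z)) (φ τ z)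

/-- Jacobi forms of genus `n`, weight `k = κ / 2` and index `m` (for the full Jacobi group). -/
structure IsJacobiForm (n : ℕ) (κ : ℤ) (m : ℕ)
    (φ : Matrix (Fin n) (Fin n) ℂ → (Fin n → ℂ) → ℂ) : Prop where
  holo : DifferentiableOn ℂ (fun p : Matrix (Fin n) (Fin n) ℂ × (Fin n → ℂ) => φ p.1 p.2)
    (siegelUpperHalfSpace n ×ˢ Set.univ)
  modular : ∀ g : Mp n, ∀ τ ∈ siegelUpperHalfSpace n, ∀ z : Fin n → ℂ,
    φ (moebius g.γ τ) (((denom g.γ τ)⁻¹)ᵀ *ᵥ z) =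
      g.ω τ ^ κ *
        e (m * (z ⬝ᵥ (((denom g.γ τ)⁻¹ * g.γ.toBlocks₂₁.map (fun x : ℤ => (x : ℂ))) *ᵥ z))) *
        φ τ z
  elliptic : ∀ a b : Fin n → ℤ, ∀ τ ∈ siegelUpperHalfSpace n, ∀ z : Fin n → ℂ,
    φ τ (z + τ *ᵥ (fun i => (a i : ℂ)) + fun i => (b i : ℂ)) =
      e (-m * ((fun i => (a i : ℂ)) ⬝ᵥ (τ *ᵥ fun i => (a i : ℂ)) +
        2 * ((fun i => (a i : ℂ)) ⬝ᵥ z))) * φ τ z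
  fourier : ∃ c, HasJacobiFourierExpansion m φ c

/-- `f = ∑_{m ≥ 0} φ_m(τ₁, z) q₂^m` is a symmetric formal Fourier-Jacobi series of genus
`g = n + 1`, cogenus `1` and weight `k = κ / 2`: every `φ_m` is a Jacobi form of weight `k` and
index `m`, and the Fourier coefficients `c(f; t)`, `t = (T, r/2; rᵀ/2, m)`, satisfy
`c(f; uᵀ t u) = det(u)^k c(f; t)` for `u ∈ GL_g(ℤ)`. Here `det(u)^k` is read on the metaplectic
cover as `s^{2k}` for every square root `s` of `det u`; for integral `k` it is the usual power. -/
structure IsSymmetricFormalFJ (n : ℕ) (κ : ℤ)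
    (φ : ℕ → Matrix (Fin n) (Fin n) ℂ → (Fin n → ℂ) → ℂ) : Prop where
  jacobi : ∀ m, IsJacobiForm n κ m (φ m)
  symmetric : ∃ c : Matrix (Fin n ⊕ Unit) (Fin n ⊕ Unit) ℚ → ℂ,
    (∀ m, HasJacobiFourierExpansion m (φ m) (fun T r => c (blockMatrix T r m))) ∧
    ∀ (u : GL (Fin n ⊕ Unit) ℤ) (t : Matrix (Fin n ⊕ Unit) (Fin n ⊕ Unit) ℚ),
      HalfIntegral t → (t.map (fun x : ℚ => (x : ℝ))).PosSemidef →
      ∀ s : ℂ, s ^ 2 = (u.val.det : ℂ) →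
        c ((u.val.map (fun x : ℤ => (x : ℚ)))ᵀ * t * u.val.map (fun x : ℤ => (x : ℚ))) =
          s ^ κ * c t

/-- A formal Fourier-Jacobi series is cuspidal if `φ_0 = 0`. -/
def IsCuspidal {n : ℕ} (φ : ℕ → Matrix (Fin n) (Fin n) ℂ → (Fin n → ℂ) → ℂ) : Prop :=
  ∀ τ ∈ siegelUpperHalfSpace n, ∀ z, φ 0 τ z = 0

/-- `v ∈ (1/N) ℤⁿ`. -/
def InTorsionLattice {n : ℕ} (N : ℕ) (v : Fin n → ℚ) : Prop :=
  ∀ i, ∃ a : ℤ, (N : ℚ) * v i = a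

/-- `η_m(τ₁) = e(m λᵀ τ₁ λ) φ_m(τ₁, τ₁ λ + μ)`. -/
def torsionSpecialization {n : ℕ} (φ : ℕ → Matrix (Fin n) (Fin n) ℂ → (Fin n → ℂ) → ℂ)
    (lam mu : Fin n → ℚ) (m : ℕ) (τ : Matrix (Fin n) (Fin n) ℂ) : ℂ :=
  e (m * ((fun i => (lam i : ℂ)) ⬝ᵥ (τ *ᵥ fun i => (lam i : ℂ)))) *
    φ m τ (τ *ᵥ (fun i => (lam i : ℂ)) + fun i => (mu i : ℂ))

end FormalFJ

end

/-!
For fixed `m`, absolute convergence on a Siegel set and reduction theory bound all specializations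
of `φ_m` at real points, so the coefficients `c(n, r)` of `φ_m` are bounded by a constant times a
power of the discriminant `det (n - r ᵗr / 4m)`. A pair `(n, r)` contributing to the exponent `t`
of `η_m` gives a matrix which the `GL_g(ℤ)`-symmetry moves to one with last entry at most `t₀₀`, so
only the finitely many `φ_{m'}` with `m' ≤ t₀₀` matter, and there are at most `O(m^{(g-1)/2})` such
pairs: the coefficient of `η_m` at `t` is at most `K_t m^{k/2 + (g-1)/2}`. On the Siegel set, all
but finitely many exponents `t`, independently of `m`, contribute at most half of any bound `B` for
the `η_m`; hence `B` improves to `B / 2 + C m^{k/2 + (g-1)/2}`, and iterating removes `B`. In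
negative weight all coefficients vanish.
-/

namespace FormalFJ

section IntegralMatrices

variable {ι κ l : Type*} {R : Type*}

/-- The matrix over `R` underlying an integral matrix, written as in `denom` and `moebius`. -/
abbrev castMat (R : Type*) [Ring R] (A : Matrix ι κ ℤ) : Matrix ι κ R :=
  A.map (fun x : ℤ => (x : R))

/-- The vector over `R` underlying an integral vector. -/
abbrev castVec (R : Type*) [Ring R] (v : ι → ℤ) : ι → R := fun i => (v i : R)

theorem castMat_mul [Ring R] [Fintype κ] (A : Matrix ι κ ℤ) (B : Matrix κ l ℤ) :
    castMat R (A * B) = castMat R A * castMat R B :=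
  Matrix.map_mul (f := Int.castRingHom R)

theorem castMat_one [Ring R] [DecidableEq ι] : castMat R (1 : Matrix ι ι ℤ) = 1 :=
  Matrix.map_one _ Int.cast_zero Int.cast_one

theorem castMat_mulVec_castVec [Ring R] [Fintype κ] (A : Matrix ι κ ℤ) (v : κ → ℤ) :
    castMat R A *ᵥ castVec R v = castVec R (A *ᵥ v) := by
  ext i
  simp [castVec, Matrix.mulVec, dotProduct]

theorem castVec_single [Ring R] [DecidableEq ι] (i : ι) :
    castVec R (Pi.single i 1 : ι → ℤ) = Pi.single i 1 := by
  ext j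
  by_cases h : j = i <;> simp [castVec, h]

theorem norm_castVec [Fintype ι] (v : ι → ℤ) : ‖castVec ℝ v‖ = ‖v‖ := by
  refine congrArg NNReal.toReal (Finset.sup_congr rfl fun i _ => ?_)
  exact NNReal.eq (Int.norm_cast_real (v i))

theorem one_le_norm_castVec [Fintype ι] {v : ι → ℤ} (hv : v ≠ 0) : 1 ≤ ‖castVec ℝ v‖ := by
  obtain ⟨i, hi⟩ := Function.ne_iff.mp hv
  have h_abs : (1 : ℝ) ≤ ‖v i‖ := by
    rw [Int.norm_eq_abs]
    exact_mod_cast Int.one_le_abs hi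
  exact h_abs.trans ((norm_le_pi_norm v i).trans_eq (norm_castVec v).symm)

theorem one_le_intCast_sq {d : ℤ} (hd : d ≠ 0) : (1 : ℝ) ≤ (d : ℝ) ^ 2 := by
  exact_mod_cast one_le_sq_iff_one_le_abs _ |>.2 (Int.one_le_abs hd)

variable [Fintype ι] [DecidableEq ι]

theorem mulVec_ne_zero_of_GL (u : GL ι ℤ) {v : ι → ℤ} (hv : v ≠ 0) : u.val *ᵥ v ≠ 0 := by
  rw [← Matrix.mulVec_zero u.val]
  exact (Matrix.mulVec_injective_of_isUnit u.isUnit).ne hv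

theorem isUnit_castMat [Ring R] (u : GL ι ℤ) : IsUnit (castMat R u.val) :=
  ⟨⟨castMat R u.val, castMat R u⁻¹.val, by rw [← castMat_mul, Units.mul_inv, castMat_one],
    by rw [← castMat_mul, Units.inv_mul, castMat_one]⟩, rfl⟩

theorem det_castMat_sq (u : GL ι ℤ) : (castMat ℝ u.val).det ^ 2 = 1 := by
  have h_unit : u.val.det ^ 2 = 1 := Int.isUnit_sq (u.val.isUnit_iff_isUnit_det.1 u.isUnit)
  have h_cast : (castMat ℝ u.val).det = (u.val.det : ℝ) :=
    ((Int.castRingHom ℝ).map_det u.val).symm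
  rw [h_cast]
  exact_mod_cast h_unit

/-- The matrix `ᵗu y u` of the quadratic form of `y` in the basis formed by the columns of `u`. -/
abbrev baseChange [CommRing R] (u : GL ι ℤ) (y : Matrix ι ι R) : Matrix ι ι R :=
  (castMat R u.val)ᵀ * y * castMat R u.val

theorem baseChange_mul [CommRing R] (u v : GL ι ℤ) (y : Matrix ι ι R) :
    baseChange (u * v) y = baseChange v (baseChange u y) := by
  simp only [baseChange, Units.val_mul, castMat_mul, Matrix.transpose_mul, Matrix.mul_assoc]

theorem posDef_baseChange {y : Matrix ι ι ℝ} (hy : y.PosDef) (u : GL ι ℤ) :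
    (baseChange u y).PosDef := by
  simpa only [Matrix.conjTranspose_eq_transpose_of_trivial] using
    hy.conjTranspose_mul_mul_same (Matrix.mulVec_injective_iff_isUnit.2 (isUnit_castMat u))

theorem det_baseChange (u : GL ι ℤ) (y : Matrix ι ι ℝ) : (baseChange u y).det = y.det := by
  rw [Matrix.det_mul, Matrix.det_mul, Matrix.det_transpose]
  linear_combination y.det * det_castMat_sq u

theorem exists_GL_col_smul_eq (v : ι → ℤ) (i₀ : ι) :
    ∃ (u : GL ι ℤ) (d : ℤ), v = d • u.val.col i₀ := by
  rcases eq_or_ne v 0 with rfl | hv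
  · exact ⟨1, 0, (zero_smul _ _).symm⟩
  obtain ⟨k, snf⟩ := Submodule.smithNormalForm (Pi.basisFun ℤ ι) (Submodule.span ℤ {v})
  obtain rfl : k = 1 := by
    have h_finrank : Module.finrank ℤ (Submodule.span ℤ {v}) = 1 := by
      rw [← Set.range_const (ι := Unit) (c := v),
        finrank_span_eq_card (linearIndependent_unique_iff.2 hv), Fintype.card_unit]
    simpa [h_finrank] using (Module.finrank_eq_card_basis snf.bN).symm
  have h_repr : v = (snf.bN.repr ⟨v, Submodule.mem_span_singleton_self v⟩ 0 * snf.a 0) •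
      snf.bM (snf.f 0) := by
    simpa only [Fin.sum_univ_one, Submodule.coe_smul, snf.snf, mul_smul] using
      (congrArg Subtype.val (snf.bN.sum_repr ⟨v, Submodule.mem_span_singleton_self v⟩)).symm
  let b := snf.bM.reindex (Equiv.swap (snf.f 0) i₀)
  refine ⟨⟨(Pi.basisFun ℤ ι).toMatrix b, b.toMatrix (Pi.basisFun ℤ ι),
    Module.Basis.toMatrix_mul_toMatrix_flip _ _, Module.Basis.toMatrix_mul_toMatrix_flip _ _⟩,
    _, h_repr.trans (congrArg _ (funext fun j => ?_))⟩
  simp [b, Module.Basis.toMatrix_apply]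

end IntegralMatrices

section QuadraticForm

variable {ι κ : Type*} [Fintype ι] [Fintype κ]

/-- The quadratic form `x ↦ ᵗx y x`, denoted `y[x]` in Siegel's notation. -/
def quadForm (y : Matrix ι ι ℝ) (x : ι → ℝ) : ℝ := x ⬝ᵥ (y *ᵥ x)

theorem quadForm_smul (y : Matrix ι ι ℝ) (a : ℝ) (x : ι → ℝ) :
    quadForm y (a • x) = a ^ 2 * quadForm y x := by
  simp only [quadForm, Matrix.mulVec_smul, smul_dotProduct, dotProduct_smul, smul_eq_mul]
  ring

theorem quadForm_zero (y : Matrix ι ι ℝ) : quadForm y 0 = 0 := zero_dotProduct _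

theorem quadForm_pos {y : Matrix ι ι ℝ} (hy : y.PosDef) {x : ι → ℝ} (hx : x ≠ 0) :
    0 < quadForm y x := by
  simpa only [star_trivial, quadForm] using hy.dotProduct_mulVec_pos hx

theorem quadForm_nonneg {y : Matrix ι ι ℝ} (hy : y.PosSemidef) (x : ι → ℝ) :
    0 ≤ quadForm y x := by
  simpa only [star_trivial, quadForm] using hy.dotProduct_mulVec_nonneg x

theorem quadForm_single [DecidableEq ι] (y : Matrix ι ι ℝ) (i : ι) :
    quadForm y (Pi.single i 1) = y i i := by
  simp [quadForm]

theorem quadForm_transpose_mul_mul (y : Matrix ι ι ℝ) (u : Matrix ι κ ℝ) (x : κ → ℝ) :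
    quadForm (uᵀ * y * u) x = quadForm y (u *ᵥ x) := by
  rw [quadForm, quadForm, ← Matrix.mulVec_mulVec, ← Matrix.mulVec_mulVec, Matrix.dotProduct_mulVec,
    Matrix.vecMul_transpose]

theorem quadForm_baseChange_castVec [DecidableEq ι] (u : GL ι ℤ) (y : Matrix ι ι ℝ) (v : ι → ℤ) :
    quadForm (baseChange u y) (castVec ℝ v) = quadForm y (castVec ℝ (u.val *ᵥ v)) := by
  rw [quadForm_transpose_mul_mul, castMat_mulVec_castVec]

theorem continuous_quadForm (y : Matrix ι ι ℝ) : Continuous (quadForm y) := by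
  unfold quadForm dotProduct Matrix.mulVec dotProduct
  fun_prop

omit [Fintype ι] in
theorem isSymm_of_posDef {y : Matrix ι ι ℝ} (hy : y.PosDef) : y.IsSymm := by
  simpa only [Matrix.conjTranspose_eq_transpose_of_trivial, Matrix.IsSymm] using hy.isHermitian.eq

theorem exists_mul_norm_sq_le_quadForm {y : Matrix ι ι ℝ} (hy : y.PosDef) :
    ∃ a > 0, ∀ x : ι → ℝ, a * ‖x‖ ^ 2 ≤ quadForm y x := by
  rcases isEmpty_or_nonempty ι with h | h
  · exact ⟨1, one_pos, fun x => by simp [quadForm, Subsingleton.elim x 0]⟩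
  obtain ⟨x₀, hx₀, hmin⟩ := (isCompact_sphere (0 : ι → ℝ) 1).exists_isMinOn
    (NormedSpace.sphere_nonempty.2 zero_le_one) (continuous_quadForm y).continuousOn
  have hx₀_ne : x₀ ≠ 0 := ne_zero_of_mem_unit_sphere ⟨x₀, hx₀⟩
  refine ⟨quadForm y x₀, quadForm_pos hy hx₀_ne, fun x => ?_⟩
  rcases eq_or_ne x 0 with rfl | hx
  · simp [quadForm_zero]
  have h_le : quadForm y x₀ ≤ quadForm y (‖x‖⁻¹ • x) :=
    hmin (by simp [norm_smul, hx])
  rwa [quadForm_smul, inv_pow, inv_mul_eq_div, le_div_iff₀ (by positivity)] at h_le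

theorem exists_minimal_integral_vector [Nonempty ι] {y : Matrix ι ι ℝ} (hy : y.PosDef) :
    ∃ v : ι → ℤ, v ≠ 0 ∧ ∀ w : ι → ℤ, w ≠ 0 →
      quadForm y (castVec ℝ v) ≤ quadForm y (castVec ℝ w) := by
  obtain ⟨a, ha, h_norm⟩ := exists_mul_norm_sq_le_quadForm hy
  obtain ⟨w₀, hw₀⟩ := exists_ne (0 : ι → ℤ)
  have h_bounded : Bornology.IsBounded
      {v : ι → ℤ | quadForm y (castVec ℝ v) ≤ quadForm y (castVec ℝ w₀)} := by
    refine (Metric.isBounded_closedBall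
      (x := 0) (r := √(quadForm y (castVec ℝ w₀) / a))).subset fun v hv => ?_
    rw [mem_closedBall_zero_iff, ← norm_castVec]
    exact Real.le_sqrt_of_sq_le ((le_div_iff₀' ha).2 ((h_norm _).trans hv))
  have h_finite : {v : ι → ℤ | v ≠ 0 ∧
      quadForm y (castVec ℝ v) ≤ quadForm y (castVec ℝ w₀)}.Finite :=
    (h_bounded.isCompact_closure.finite_of_discrete.subset subset_closure).subset fun v hv => hv.2
  obtain ⟨v, ⟨hv, hv_le⟩, hmin⟩ := Set.exists_min_image _
    (fun v => quadForm y (castVec ℝ v)) h_finite ⟨w₀, hw₀, le_rfl⟩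
  refine ⟨v, hv, fun w hw => ?_⟩
  rcases le_total (quadForm y (castVec ℝ w)) (quadForm y (castVec ℝ w₀)) with h | h
  · exact hmin w ⟨hw, h⟩
  · exact hv_le.trans h

end QuadraticForm

section Reduction

variable {n : ℕ}

/-- `y` is bounded below, as a quadratic form, by `c` times its diagonal part. -/
def DominatesDiag {ι : Type*} [Fintype ι] (c : ℝ) (y : Matrix ι ι ℝ) : Prop :=
  ∀ x : ι → ℝ, c * ∑ i, y i i * x i ^ 2 ≤ quadForm y x

theorem baseChange_apply_self_le_of_eq_smul_col {ι : Type*} [Fintype ι] [DecidableEq ι]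
    {y : Matrix ι ι ℝ} (hy : y.PosDef) {u : GL ι ℤ} {v : ι → ℤ} (hv : v ≠ 0) {d : ℤ} {i : ι}
    (h_col : v = d • u.val.col i) : (baseChange u y) i i ≤ quadForm y (castVec ℝ v) := by
  have hd : d ≠ 0 := by
    rintro rfl
    exact hv (h_col.trans (zero_smul _ _))
  have h_v : castVec ℝ v = (d : ℝ) • castVec ℝ (u.val *ᵥ Pi.single i 1) := by
    ext j
    simp [castVec, h_col]
  rw [h_v, quadForm_smul, ← quadForm_baseChange_castVec, castVec_single, quadForm_single]
  exact le_mul_of_one_le_left (posDef_baseChange hy u).diag_pos.le (one_le_intCast_sq hd)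

theorem exists_baseChange_corner_minimal {y : Matrix (Fin (n + 1)) (Fin (n + 1)) ℝ}
    (hy : y.PosDef) :
    ∃ u : GL (Fin (n + 1)) ℤ, ∀ w : Fin (n + 1) → ℤ, w ≠ 0 →
      (baseChange u y) 0 0 ≤ quadForm (baseChange u y) (castVec ℝ w) := by
  obtain ⟨v, hv, hmin⟩ := exists_minimal_integral_vector hy
  obtain ⟨u, d, h_col⟩ := exists_GL_col_smul_eq v 0
  refine ⟨u, fun w hw => ?_⟩
  calc (baseChange u y) 0 0 ≤ quadForm y (castVec ℝ v) :=
        baseChange_apply_self_le_of_eq_smul_col hy hv h_col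
    _ ≤ quadForm y (castVec ℝ (u.val *ᵥ w)) := hmin _ (mulVec_ne_zero_of_GL u hw)
    _ = quadForm (baseChange u y) (castVec ℝ w) := (quadForm_baseChange_castVec u y w).symm

/-- Splitting off a square from the quadratic form of `y`: the first variable only enters through
`x₀ + ∑ bⱼ xⱼ`, and `s` is the form in the remaining variables. -/
def HasSquareCompletion (y : Matrix (Fin (n + 1)) (Fin (n + 1)) ℝ) (b : Fin n → ℝ)
    (s : Matrix (Fin n) (Fin n) ℝ) : Prop :=
  ∀ x : Fin (n + 1) → ℝ,
    quadForm y x = y 0 0 * (x 0 + b ⬝ᵥ Fin.tail x) ^ 2 + quadForm s (Fin.tail x)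

variable {y : Matrix (Fin (n + 1)) (Fin (n + 1)) ℝ} {b : Fin n → ℝ} {s : Matrix (Fin n) (Fin n) ℝ}

theorem hasSquareCompletion_schur (hy : y.IsSymm) (h₀ : y 0 0 ≠ 0) :
    HasSquareCompletion y (fun i => y 0 i.succ / y 0 0)
      (Matrix.of fun i j : Fin n => y i.succ j.succ - y 0 i.succ * y 0 j.succ / y 0 0) := by
  intro x
  have h_lin : (fun i : Fin n => y 0 i.succ / y 0 0) ⬝ᵥ Fin.tail x =
      (∑ i : Fin n, y 0 i.succ * x i.succ) / y 0 0 := by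
    simp only [dotProduct, Fin.tail, Finset.sum_div, div_mul_eq_mul_div]
  have h_schur : quadForm (Matrix.of fun i j : Fin n =>
        y i.succ j.succ - y 0 i.succ * y 0 j.succ / y 0 0) (Fin.tail x) =
      ∑ i : Fin n, x i.succ * ∑ j : Fin n, y i.succ j.succ * x j.succ -
        (∑ i : Fin n, y 0 i.succ * x i.succ) ^ 2 / y 0 0 := by
    simp only [quadForm, dotProduct, Matrix.mulVec, Matrix.of_apply, Fin.tail, sub_mul,
      Finset.sum_sub_distrib, mul_sub, sq, Finset.sum_div, Finset.mul_sum]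
    refine congrArg _ (Finset.sum_congr rfl fun i _ => ?_)
    rw [Finset.sum_mul, Finset.sum_div]
    exact Finset.sum_congr rfl fun j _ => by ring
  have h_cross : ∑ i : Fin n, x i.succ * (y 0 i.succ * x 0) =
      x 0 * ∑ i : Fin n, y 0 i.succ * x i.succ := by
    rw [Finset.mul_sum]
    exact Finset.sum_congr rfl fun i _ => by ring
  rw [h_lin, h_schur]
  simp only [quadForm, dotProduct, Matrix.mulVec, Fin.sum_univ_succ, hy.apply 0, mul_add,
    Finset.sum_add_distrib, h_cross]
  field_simp
  ring

theorem HasSquareCompletion.pos (h : HasSquareCompletion y b s) (hy : y.PosDef)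
    {x : Fin n → ℝ} (hx : x ≠ 0) : 0 < quadForm s x := by
  have h_ne : (Fin.cons (-(b ⬝ᵥ x)) x : Fin (n + 1) → ℝ) ≠ 0 := fun h_zero =>
    hx (funext fun i => congrFun h_zero i.succ)
  simpa [h _] using quadForm_pos hy h_ne

theorem exists_posDef_hasSquareCompletion (hy : y.PosDef) :
    ∃ b s, s.PosDef ∧ HasSquareCompletion y b s := by
  have h_symm := isSymm_of_posDef hy
  have h_completion := hasSquareCompletion_schur h_symm hy.diag_pos.ne'
  refine ⟨_, _, .of_dotProduct_mulVec_pos ?_ fun x hx => h_completion.pos hy hx, h_completion⟩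
  ext i j
  simp [h_symm.apply i.succ j.succ, mul_comm]

theorem HasSquareCompletion.apply_succ_succ (h : HasSquareCompletion y b s) (j : Fin n) :
    y j.succ j.succ = y 0 0 * b j ^ 2 + s j j := by
  have h_tail : Fin.tail (Pi.single j.succ 1 : Fin (n + 1) → ℝ) = Pi.single j 1 := by
    ext i
    simp [Fin.tail, Pi.single_apply]
  simpa [h_tail, quadForm_single] using h (Pi.single j.succ 1)

/-- The block matrix `(1, k; 0, u)`. -/
def shear (k : Fin n → ℤ) (u : Matrix (Fin n) (Fin n) ℤ) : Matrix (Fin (n + 1)) (Fin (n + 1)) ℤ :=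
  Matrix.of (Fin.cons (Fin.cons 1 k) fun i => Fin.cons 0 (u i))

theorem det_shear (k : Fin n → ℤ) (u : Matrix (Fin n) (Fin n) ℤ) : (shear k u).det = u.det := by
  rw [Matrix.det_succ_column_zero, Fin.sum_univ_succ]
  simp [shear]
  rfl

/-- The block matrix `(1, k; 0, u)` as an element of `GL_{n+1}(ℤ)`. -/
noncomputable def shearGL (k : Fin n → ℤ) (u : GL (Fin n) ℤ) : GL (Fin (n + 1)) ℤ :=
  Matrix.nonsingInvUnit (shear k u.val)
    (det_shear k u.val ▸ (Matrix.isUnit_iff_isUnit_det _).1 u.isUnit)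

theorem shearGL_mulVec (k : Fin n → ℤ) (u : GL (Fin n) ℤ) (x : Fin (n + 1) → ℝ) :
    castMat ℝ (shearGL k u).val *ᵥ x =
      Fin.cons (x 0 + castVec ℝ k ⬝ᵥ Fin.tail x) (castMat ℝ u.val *ᵥ Fin.tail x) := by
  have h_val : (shearGL k u).val = shear k u.val := rfl
  ext i
  rw [h_val]
  cases i using Fin.cases <;>
  simp [shear, Fin.tail, Matrix.mulVec, dotProduct, Fin.sum_univ_succ, castVec]

theorem baseChange_shearGL_corner (k : Fin n → ℤ) (u : GL (Fin n) ℤ) :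
    (baseChange (shearGL k u) y) 0 0 = y 0 0 := by
  have h_fixed : castMat ℝ (shearGL k u).val *ᵥ Pi.single 0 1 = Pi.single 0 1 := by
    have h_tail : Fin.tail (Pi.single 0 1 : Fin (n + 1) → ℝ) = 0 := rfl
    rw [shearGL_mulVec, h_tail, dotProduct_zero, Matrix.mulVec_zero, add_zero, Pi.single_eq_same]
    ext i
    cases i using Fin.cases <;> simp
  rw [← quadForm_single (baseChange _ y), quadForm_transpose_mul_mul, h_fixed, quadForm_single]

theorem HasSquareCompletion.baseChange_shearGL (h : HasSquareCompletion y b s)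
    (k : Fin n → ℤ) (u : GL (Fin n) ℤ) :
    HasSquareCompletion (baseChange (shearGL k u) y) (b ᵥ* castMat ℝ u.val + castVec ℝ k)
      (baseChange u s) := by
  intro x
  rw [baseChange_shearGL_corner, quadForm_transpose_mul_mul, quadForm_transpose_mul_mul, h,
    shearGL_mulVec, Fin.cons_zero, Fin.tail_cons, add_dotProduct, ← Matrix.dotProduct_mulVec]
  ring

theorem mul_dotProduct_sq_le {ι : Type*} [Fintype ι] {a : ℝ} {b d : ι → ℝ} (ha : 0 ≤ a)
    (hb : ∀ i, b i ^ 2 ≤ 1 / 4) (hd : ∀ i, a ≤ d i) (x : ι → ℝ) :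
    a * (b ⬝ᵥ x) ^ 2 ≤ Fintype.card ι / 4 * ∑ i, d i * x i ^ 2 := by
  have h_cauchy : (b ⬝ᵥ x) ^ 2 ≤ Fintype.card ι * ∑ i, (b i * x i) ^ 2 :=
    sq_sum_le_card_mul_sum_sq
  have h_term : ∀ i, a * (b i * x i) ^ 2 ≤ 1 / 4 * (d i * x i ^ 2) := fun i => by
    nlinarith [mul_le_mul (hd i) (hb i) (sq_nonneg _) (ha.trans (hd i)), sq_nonneg (x i)]
  calc a * (b ⬝ᵥ x) ^ 2 ≤ a * (Fintype.card ι * ∑ i, (b i * x i) ^ 2) := by gcongr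
    _ = Fintype.card ι * ∑ i, a * (b i * x i) ^ 2 := by rw [← Finset.mul_sum]; ring
    _ ≤ Fintype.card ι * ∑ i, 1 / 4 * (d i * x i ^ 2) :=
      mul_le_mul_of_nonneg_left (Finset.sum_le_sum fun i _ => h_term i) (Nat.cast_nonneg _)
    _ = Fintype.card ι / 4 * ∑ i, d i * x i ^ 2 := by rw [← Finset.mul_sum]; ring

theorem HasSquareCompletion.dominatesDiag (h : HasSquareCompletion y b s) (h₀ : 0 ≤ y 0 0)
    (hb : ∀ j, |b j| ≤ 1 / 2) (hmin : ∀ j : Fin n, y 0 0 ≤ y j.succ j.succ) {c : ℝ} (hc : 0 ≤ c)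
    (hs : DominatesDiag c s) : DominatesDiag (min (1 / 2) (3 / 4 * c / (n / 2 + 1))) y := by
  intro x
  have hb_sq : ∀ j, b j ^ 2 ≤ 1 / 4 := fun j =>
    (sq_le_sq' (abs_le.1 (hb j)).1 (abs_le.1 (hb j)).2).trans_eq (by norm_num)
  set p := b ⬝ᵥ Fin.tail x
  set d := ∑ j : Fin n, y j.succ j.succ * Fin.tail x j ^ 2 with hd
  have hd_nonneg : 0 ≤ d := Finset.sum_nonneg fun j _ =>
    mul_nonneg (h₀.trans (hmin j)) (sq_nonneg _)
  have h_schur : 3 / 4 * c * d ≤ quadForm s (Fin.tail x) := by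
    refine le_trans ?_ (hs (Fin.tail x))
    rw [mul_comm (3 / 4 : ℝ) c, mul_assoc, hd, Finset.mul_sum]
    refine mul_le_mul_of_nonneg_left (Finset.sum_le_sum fun j _ => ?_) hc
    rw [← mul_assoc]
    refine mul_le_mul_of_nonneg_right ?_ (sq_nonneg _)
    nlinarith [h.apply_succ_succ j, hb_sq j, hmin j]
  have h_shear : y 0 0 * p ^ 2 ≤ n / 4 * d := by
    simpa only [Fintype.card_fin] using mul_dotProduct_sq_le h₀ hb_sq hmin (Fin.tail x)
  have h_first : y 0 0 * x 0 ^ 2 ≤ 2 * (y 0 0 * (x 0 + p) ^ 2) + n / 2 * d := by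
    nlinarith [mul_nonneg h₀ (sq_nonneg (x 0 + 2 * p))]
  set m := min (1 / 2 : ℝ) (3 / 4 * c / (n / 2 + 1))
  have hm_nonneg : 0 ≤ m := by positivity
  have hm_half : m ≤ 1 / 2 := min_le_left _ _
  have hm_schur : m * (n / 2 + 1) ≤ 3 / 4 * c :=
    (le_div_iff₀ (by positivity)).1 (min_le_right _ _)
  have h_square : 0 ≤ y 0 0 * (x 0 + p) ^ 2 := mul_nonneg h₀ (sq_nonneg _)
  have h_diag : ∑ i, y i i * x i ^ 2 = y 0 0 * x 0 ^ 2 + d := Fin.sum_univ_succ _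
  rw [h x, h_diag]
  nlinarith [mul_le_mul_of_nonneg_left h_first hm_nonneg,
    mul_le_mul_of_nonneg_right hm_half h_square, mul_le_mul_of_nonneg_right hm_schur hd_nonneg]

theorem exists_baseChange_dominatesDiag (n : ℕ) :
    ∃ c > 0, ∀ y : Matrix (Fin n) (Fin n) ℝ, y.PosDef →
      ∃ u : GL (Fin n) ℤ, DominatesDiag c (baseChange u y) := by
  induction n with
  | zero => exact ⟨1, one_pos, fun y _ => ⟨1, fun x => by simp [quadForm]⟩⟩
  | succ n ih =>
    obtain ⟨c, hc, ih⟩ := ih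
    refine ⟨min (1 / 2) (3 / 4 * c / (n / 2 + 1)), by positivity, fun y hy => ?_⟩
    obtain ⟨u₁, hmin⟩ := exists_baseChange_corner_minimal hy
    have hy₁ := posDef_baseChange hy u₁
    obtain ⟨b, s, hs, h_completion⟩ := exists_posDef_hasSquareCompletion hy₁
    obtain ⟨u₂, hu₂⟩ := ih s hs
    set k : Fin n → ℤ := fun j => -round ((b ᵥ* castMat ℝ u₂.val) j) with hk
    refine ⟨u₁ * shearGL k u₂, ?_⟩
    rw [baseChange_mul]
    refine (h_completion.baseChange_shearGL k u₂).dominatesDiag ?_ (fun j => ?_) (fun j => ?_)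
      hc.le hu₂
    · exact (posDef_baseChange hy₁ _).diag_pos.le
    · simpa [castVec, hk, sub_eq_add_neg] using abs_sub_round ((b ᵥ* castMat ℝ u₂.val) j)
    · rw [baseChange_shearGL_corner, ← quadForm_single (baseChange _ (baseChange _ _)),
        ← castVec_single, quadForm_baseChange_castVec]
      exact hmin _ (mulVec_ne_zero_of_GL _ (Pi.single_ne_zero_iff.2 one_ne_zero))

end Reduction

section ComplexPosDef

open scoped ComplexOrder

variable {ι : Type*} [Fintype ι]

/-- The complex matrix with the same real entries. -/
abbrev complexMat {κ l : Type*} (y : Matrix κ l ℝ) : Matrix κ l ℂ := y.map Complex.ofReal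

theorem dotProduct_mulVec_comm_of_isSymm {R : Type*} [CommSemiring R] {y : Matrix ι ι R}
    (hy : y.IsSymm) (v w : ι → R) : v ⬝ᵥ (y *ᵥ w) = w ⬝ᵥ (y *ᵥ v) := by
  rw [Matrix.dotProduct_mulVec, ← Matrix.mulVec_transpose, hy.eq, dotProduct_comm]

theorem star_dotProduct_complexMat_mulVec {y : Matrix ι ι ℝ} (hy : y.IsSymm) (v : ι → ℂ) :
    star v ⬝ᵥ (complexMat y *ᵥ v) =
      ((quadForm y (fun i => (v i).re) + quadForm y (fun i => (v i).im) : ℝ) : ℂ) := by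
  have h_comm := dotProduct_mulVec_comm_of_isSymm hy (fun i => (v i).re) (fun i => (v i).im)
  simp only [dotProduct, Matrix.mulVec] at h_comm
  apply Complex.ext <;>
  simp only [dotProduct, Matrix.mulVec, Matrix.map_apply, quadForm, Complex.ofReal_re,
    Complex.re_sum, Complex.mul_re, Pi.star_apply, Complex.im_sum, Complex.mul_im,
    Complex.ofReal_im, zero_mul, sub_zero, add_zero, RCLike.star_def, Complex.conj_re,
    Complex.conj_im, neg_mul, sub_neg_eq_add, Finset.sum_add_distrib, Finset.sum_neg_distrib,
    h_comm, add_neg_cancel]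

omit [Fintype ι] in
theorem posDef_complexMat_iff [Finite ι] {y : Matrix ι ι ℝ} :
    (complexMat y).PosDef ↔ y.PosDef := by
  cases nonempty_fintype ι
  refine ⟨fun h => ?_, fun h => ?_⟩
  · have h_symm : y.IsSymm := by
      ext i j
      simpa using congrArg Complex.re (h.isHermitian.apply i j)
    refine .of_dotProduct_mulVec_pos h_symm fun x hx => ?_
    have h_ne : (fun i => (x i : ℂ)) ≠ 0 := fun h_zero =>
      hx (funext fun i => Complex.ofReal_eq_zero.1 (congrFun h_zero i))
    have h_pos := h.dotProduct_mulVec_pos h_ne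
    rw [star_dotProduct_complexMat_mulVec h_symm, Complex.zero_lt_real] at h_pos
    simpa [← Pi.zero_def, quadForm_zero, quadForm] using h_pos
  · have h_symm := isSymm_of_posDef h
    refine .of_dotProduct_mulVec_pos ?_ fun v hv => ?_
    · ext i j
      simp [h_symm.apply i j]
    rw [star_dotProduct_complexMat_mulVec h_symm, Complex.zero_lt_real]
    have h_re := quadForm_nonneg h.posSemidef fun i => (v i).re
    have h_im := quadForm_nonneg h.posSemidef fun i => (v i).im
    by_cases hv_re : (fun i => (v i).re) = 0
    · have hv_im : (fun i => (v i).im) ≠ 0 := fun h_zero =>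
        hv (funext fun i => Complex.ext (congrFun hv_re i) (congrFun h_zero i))
      exact add_pos_of_nonneg_of_pos h_re (quadForm_pos h hv_im)
    · exact add_pos_of_pos_of_nonneg (quadForm_pos h hv_re) h_im

theorem det_complexMat [DecidableEq ι] (y : Matrix ι ι ℝ) : (complexMat y).det = (y.det : ℂ) :=
  (Complex.ofRealHom.map_det y).symm

theorem sub_conjTranspose_of_isSymm {κ : Type*} {τ : Matrix κ κ ℂ} (hτ : τ.IsSymm) :
    τ - τᴴ = (2 * Complex.I) • complexMat (τ.map Complex.im) := by
  ext i j
  rw [Matrix.sub_apply, Matrix.conjTranspose_apply, hτ.apply i j]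
  apply Complex.ext <;> simp
  ring

end ComplexPosDef

section Moebius

open scoped ComplexOrder

variable {n : ℕ} {γ : Matrix (Fin n ⊕ Fin n) (Fin n ⊕ Fin n) ℤ} {τ : Matrix (Fin n) (Fin n) ℂ}

theorem symplectic_relations (R : Type*) [CommRing R]
    (hγ : γ ∈ Matrix.symplecticGroup (Fin n) ℤ) :
    (castMat R γ.toBlocks₁₁)ᵀ * castMat R γ.toBlocks₂₁ =
        (castMat R γ.toBlocks₂₁)ᵀ * castMat R γ.toBlocks₁₁ ∧
      (castMat R γ.toBlocks₁₂)ᵀ * castMat R γ.toBlocks₂₂ =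
        (castMat R γ.toBlocks₂₂)ᵀ * castMat R γ.toBlocks₁₂ ∧
      (castMat R γ.toBlocks₁₁)ᵀ * castMat R γ.toBlocks₂₂ -
        (castMat R γ.toBlocks₂₁)ᵀ * castMat R γ.toBlocks₁₂ = 1 ∧
      (castMat R γ.toBlocks₂₂)ᵀ * castMat R γ.toBlocks₁₁ -
        (castMat R γ.toBlocks₁₂)ᵀ * castMat R γ.toBlocks₂₁ = 1 := by
  rw [← Matrix.fromBlocks_toBlocks γ, SymplecticGroup.fromBlocks_mem_iff] at hγ
  obtain ⟨h₁, h₂, h₃⟩ := hγ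
  have h_det : (castMat R γ.toBlocks₁₁)ᵀ * castMat R γ.toBlocks₂₂ -
      (castMat R γ.toBlocks₂₁)ᵀ * castMat R γ.toBlocks₁₂ = 1 := by
    simp only [← Matrix.transpose_map, ← castMat_mul]
    rw [← Matrix.map_sub _ Int.cast_sub, h₃]
    exact castMat_one
  refine ⟨?_, ?_, h_det, ?_⟩
  · simp only [← Matrix.transpose_map, ← castMat_mul, h₁]
  · simp only [← Matrix.transpose_map, ← castMat_mul, h₂]
  · simpa only [Matrix.transpose_sub, Matrix.transpose_mul, Matrix.transpose_transpose,
      Matrix.transpose_one] using congrArg Matrix.transpose h_det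

section RowAction

variable {R : Type*} [CommRing R]

/-- The first component of the row vector `(p, q) γ`. -/
def actFst (γ : Matrix (Fin n ⊕ Fin n) (Fin n ⊕ Fin n) ℤ) (p q : Fin n → R) : Fin n → R :=
  fun i => (Sum.elim p q ᵥ* castMat R γ) (Sum.inl i)

/-- The second component of the row vector `(p, q) γ`. -/
def actSnd (γ : Matrix (Fin n ⊕ Fin n) (Fin n ⊕ Fin n) ℤ) (p q : Fin n → R) : Fin n → R :=
  fun i => (Sum.elim p q ᵥ* castMat R γ) (Sum.inr i)

theorem actFst_eq (γ : Matrix (Fin n ⊕ Fin n) (Fin n ⊕ Fin n) ℤ) (p q : Fin n → R) :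
    actFst γ p q = (castMat R γ.toBlocks₁₁)ᵀ *ᵥ p + (castMat R γ.toBlocks₂₁)ᵀ *ᵥ q := by
  ext i
  simp [actFst, Matrix.vecMul, Matrix.mulVec, dotProduct, mul_comm, Matrix.toBlocks₁₁,
    Matrix.toBlocks₂₁]

theorem actSnd_eq (γ : Matrix (Fin n ⊕ Fin n) (Fin n ⊕ Fin n) ℤ) (p q : Fin n → R) :
    actSnd γ p q = (castMat R γ.toBlocks₁₂)ᵀ *ᵥ p + (castMat R γ.toBlocks₂₂)ᵀ *ᵥ q := by
  ext i
  simp [actSnd, Matrix.vecMul, Matrix.mulVec, dotProduct, mul_comm, Matrix.toBlocks₁₂,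
    Matrix.toBlocks₂₂]

theorem map_actFst {S : Type*} [CommRing S] (f : R →+* S)
    (γ : Matrix (Fin n ⊕ Fin n) (Fin n ⊕ Fin n) ℤ) (p q : Fin n → R) :
    f ∘ actFst γ p q = actFst γ (f ∘ p) (f ∘ q) := by
  ext i
  simp [actFst, Matrix.vecMul, dotProduct]

theorem map_actSnd {S : Type*} [CommRing S] (f : R →+* S)
    (γ : Matrix (Fin n ⊕ Fin n) (Fin n ⊕ Fin n) ℤ) (p q : Fin n → R) :
    f ∘ actSnd γ p q = actSnd γ (f ∘ p) (f ∘ q) := by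
  ext i
  simp [actSnd, Matrix.vecMul, dotProduct]

theorem exists_act_eq (hγ : γ ∈ Matrix.symplecticGroup (Fin n) ℤ) {A : AddSubgroup R}
    {p q : Fin n → R} (hp : ∀ i, p i ∈ A) (hq : ∀ i, q i ∈ A) :
    ∃ p₀ q₀ : Fin n → R, (∀ i, p₀ i ∈ A) ∧ (∀ i, q₀ i ∈ A) ∧
      actFst γ p₀ q₀ = p ∧ actSnd γ p₀ q₀ = q := by
  set v : Fin n ⊕ Fin n → R := Sum.elim p q ᵥ* castMat R γ⁻¹ with hv
  have h_mem : ∀ j, v j ∈ A := fun j => by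
    simp only [hv, Matrix.vecMul, dotProduct]
    refine A.sum_mem fun i _ => ?_
    change Sum.elim p q i * ((γ⁻¹ i j : ℤ) : R) ∈ A
    rw [mul_comm, ← zsmul_eq_mul]
    exact A.zsmul_mem (by cases i <;> simp [hp, hq]) _
  have h_act : v ᵥ* castMat R γ = Sum.elim p q := by
    rw [hv, Matrix.vecMul_vecMul, ← castMat_mul,
      Matrix.nonsing_inv_mul _ (SymplecticGroup.symplectic_det hγ), castMat_one,
      Matrix.vecMul_one]
  refine ⟨v ∘ Sum.inl, v ∘ Sum.inr, fun i => h_mem _, fun i => h_mem _, ?_, ?_⟩ <;>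
  ext i <;>
  simp only [actFst, actSnd, Sum.elim_comp_inl_inr, h_act, Sum.elim_inl, Sum.elim_inr]

theorem eq_zero_of_act_eq_zero (hγ : γ ∈ Matrix.symplecticGroup (Fin n) ℤ) {p q : Fin n → ℤ}
    (h_fst : actFst γ p q = 0) (h_snd : actSnd γ p q = 0) : p = 0 ∧ q = 0 := by
  have h_unit : IsUnit (castMat ℤ γ) := by
    simpa [castMat] using
      (Matrix.isUnit_iff_isUnit_det _).2 (SymplecticGroup.symplectic_det hγ)
  have h_zero : Sum.elim p q ᵥ* castMat ℤ γ = 0 ᵥ* castMat ℤ γ := by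
    rw [Matrix.zero_vecMul]
    ext (i | i)
    · exact congrFun h_fst i
    · exact congrFun h_snd i
  have h_elim := Matrix.vecMul_injective_of_isUnit h_unit h_zero
  rwa [← Sum.elim_zero_zero, Sum.elim_eq_iff] at h_elim

end RowAction

/-- `a τ + b` for `γ = (a b; c d)`. -/
def numer (γ : Matrix (Fin n ⊕ Fin n) (Fin n ⊕ Fin n) ℤ) (τ : Matrix (Fin n) (Fin n) ℂ) :
    Matrix (Fin n) (Fin n) ℂ :=
  castMat ℂ γ.toBlocks₁₁ * τ + castMat ℂ γ.toBlocks₁₂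

theorem moebius_eq_numer_mul_denom_inv (γ : Matrix (Fin n ⊕ Fin n) (Fin n ⊕ Fin n) ℤ)
    (τ : Matrix (Fin n) (Fin n) ℂ) : moebius γ τ = numer γ τ * (denom γ τ)⁻¹ := rfl

theorem denom_transpose_mul_numer (hγ : γ ∈ Matrix.symplecticGroup (Fin n) ℤ) (hτ : τ.IsSymm) :
    (denom γ τ)ᵀ * numer γ τ = (numer γ τ)ᵀ * denom γ τ := by
  obtain ⟨h₁, h₂, h₃, h₄⟩ := symplectic_relations ℂ hγ
  rw [denom, numer]
  simp only [Matrix.transpose_add, Matrix.transpose_mul, hτ.eq]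
  set a := castMat ℂ γ.toBlocks₁₁
  set b := castMat ℂ γ.toBlocks₁₂
  set c := castMat ℂ γ.toBlocks₂₁
  set d := castMat ℂ γ.toBlocks₂₂
  have h_expand : (τ * cᵀ + dᵀ) * (a * τ + b) - (τ * aᵀ + bᵀ) * (c * τ + d) =
      τ * (cᵀ * a - aᵀ * c) * τ - τ * (aᵀ * d - cᵀ * b) + (dᵀ * a - bᵀ * c) * τ +
        (dᵀ * b - bᵀ * d) := by noncomm_ring
  rw [← sub_eq_zero, h_expand, h₁, h₂, h₃, h₄]
  simp

theorem denom_conjTranspose_mul_numer_sub (hγ : γ ∈ Matrix.symplecticGroup (Fin n) ℤ)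
    (τ : Matrix (Fin n) (Fin n) ℂ) :
    (denom γ τ)ᴴ * numer γ τ - (numer γ τ)ᴴ * denom γ τ = τ - τᴴ := by
  obtain ⟨h₁, h₂, h₃, h₄⟩ := symplectic_relations ℂ hγ
  have h_conj : ∀ A : Matrix (Fin n) (Fin n) ℤ, (castMat ℂ A)ᴴ = (castMat ℂ A)ᵀ := fun A => by
    ext i j
    simp
  rw [denom, numer]
  simp only [Matrix.conjTranspose_add, Matrix.conjTranspose_mul, h_conj]
  set a := castMat ℂ γ.toBlocks₁₁
  set b := castMat ℂ γ.toBlocks₁₂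
  set c := castMat ℂ γ.toBlocks₂₁
  set d := castMat ℂ γ.toBlocks₂₂
  have h_expand : (τᴴ * cᵀ + dᵀ) * (a * τ + b) - (τᴴ * aᵀ + bᵀ) * (c * τ + d) =
      τᴴ * (cᵀ * a - aᵀ * c) * τ - τᴴ * (aᵀ * d - cᵀ * b) + (dᵀ * a - bᵀ * c) * τ +
        (dᵀ * b - bᵀ * d) := by noncomm_ring
  rw [h_expand, h₁, h₂, h₃, h₄]
  simp only [sub_self, mul_zero, zero_mul, mul_one, one_mul, zero_sub, add_zero]
  abel

theorem isUnit_det_denom (hγ : γ ∈ Matrix.symplecticGroup (Fin n) ℤ)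
    (hτ : τ ∈ siegelUpperHalfSpace n) : IsUnit (denom γ τ).det := by
  refine isUnit_iff_ne_zero.2 fun h_det => ?_
  obtain ⟨v, hv, hv_denom⟩ := Matrix.exists_mulVec_eq_zero_iff.2 h_det
  have h_zero : star v ⬝ᵥ ((τ - τᴴ) *ᵥ v) = 0 := by
    rw [← denom_conjTranspose_mul_numer_sub hγ, Matrix.sub_mulVec, ← Matrix.mulVec_mulVec,
      ← Matrix.mulVec_mulVec, hv_denom, Matrix.mulVec_zero, sub_zero, Matrix.dotProduct_mulVec,
      ← Matrix.star_mulVec, hv_denom, star_zero, zero_dotProduct]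
  rw [sub_conjTranspose_of_isSymm hτ.1, Matrix.smul_mulVec, dotProduct_smul, smul_eq_mul] at h_zero
  exact mul_ne_zero (mul_ne_zero two_ne_zero Complex.I_ne_zero)
    ((posDef_complexMat_iff.2 hτ.2).dotProduct_mulVec_pos hv).ne' h_zero

theorem moebius_mul_denom (hγ : γ ∈ Matrix.symplecticGroup (Fin n) ℤ)
    (hτ : τ ∈ siegelUpperHalfSpace n) : moebius γ τ * denom γ τ = numer γ τ := by
  rw [moebius_eq_numer_mul_denom_inv, Matrix.mul_assoc,
    Matrix.nonsing_inv_mul _ (isUnit_det_denom hγ hτ), mul_one]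

theorem moebius_isSymm (hγ : γ ∈ Matrix.symplecticGroup (Fin n) ℤ)
    (hτ : τ ∈ siegelUpperHalfSpace n) : (moebius γ τ).IsSymm := by
  have h_unit := isUnit_det_denom hγ hτ
  have h_comm := denom_transpose_mul_numer hγ hτ.1
  rw [Matrix.IsSymm, moebius_eq_numer_mul_denom_inv, Matrix.transpose_mul,
    Matrix.transpose_nonsing_inv]
  calc (denom γ τ)ᵀ⁻¹ * (numer γ τ)ᵀ
      = (denom γ τ)ᵀ⁻¹ * ((numer γ τ)ᵀ * denom γ τ) * (denom γ τ)⁻¹ := by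
        rw [Matrix.mul_assoc, Matrix.mul_assoc, Matrix.mul_nonsing_inv _ h_unit, mul_one]
    _ = numer γ τ * (denom γ τ)⁻¹ := by
        rw [← h_comm, Matrix.nonsing_inv_mul_cancel_left _ _ (Matrix.isUnit_det_transpose _ h_unit)]

theorem denom_transpose_mul_moebius (hγ : γ ∈ Matrix.symplecticGroup (Fin n) ℤ)
    (hτ : τ ∈ siegelUpperHalfSpace n) : (denom γ τ)ᵀ * moebius γ τ = (numer γ τ)ᵀ := by
  rw [← moebius_mul_denom hγ hτ, Matrix.transpose_mul, (moebius_isSymm hγ hτ).eq]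

theorem conjTranspose_denom_mul_im_moebius_mul_denom (hγ : γ ∈ Matrix.symplecticGroup (Fin n) ℤ)
    (hτ : τ ∈ siegelUpperHalfSpace n) :
    (denom γ τ)ᴴ * complexMat ((moebius γ τ).map Complex.im) * denom γ τ =
      complexMat (τ.map Complex.im) := by
  have h_sub := denom_conjTranspose_mul_numer_sub hγ τ
  rw [sub_conjTranspose_of_isSymm hτ.1, ← moebius_mul_denom hγ hτ,
    Matrix.conjTranspose_mul] at h_sub
  have h_factor : (denom γ τ)ᴴ * (moebius γ τ * denom γ τ) -
      (denom γ τ)ᴴ * (moebius γ τ)ᴴ * denom γ τ =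
      (denom γ τ)ᴴ * (moebius γ τ - (moebius γ τ)ᴴ) * denom γ τ := by noncomm_ring
  rw [h_factor, sub_conjTranspose_of_isSymm (moebius_isSymm hγ hτ), Matrix.mul_smul,
    Matrix.smul_mul] at h_sub
  exact smul_right_injective _ (mul_ne_zero two_ne_zero Complex.I_ne_zero) h_sub

theorem moebius_mem (hγ : γ ∈ Matrix.symplecticGroup (Fin n) ℤ)
    (hτ : τ ∈ siegelUpperHalfSpace n) : moebius γ τ ∈ siegelUpperHalfSpace n := by
  refine ⟨moebius_isSymm hγ hτ, posDef_complexMat_iff.1 ?_⟩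
  have h_unit : IsUnit (denom γ τ) :=
    (Matrix.isUnit_iff_isUnit_det _).2 (isUnit_det_denom hγ hτ)
  rw [← Matrix.IsUnit.posDef_star_left_conjugate_iff h_unit, Matrix.star_eq_conjTranspose,
    conjTranspose_denom_mul_im_moebius_mul_denom hγ hτ]
  exact posDef_complexMat_iff.2 hτ.2

theorem norm_det_denom_sq_mul_det_im_moebius (hγ : γ ∈ Matrix.symplecticGroup (Fin n) ℤ)
    (hτ : τ ∈ siegelUpperHalfSpace n) :
    ‖(denom γ τ).det‖ ^ 2 * ((moebius γ τ).map Complex.im).det = (τ.map Complex.im).det := by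
  have h_det := congrArg Matrix.det (conjTranspose_denom_mul_im_moebius_mul_denom hγ hτ)
  rw [Matrix.det_mul, Matrix.det_mul, Matrix.det_conjTranspose, det_complexMat, det_complexMat,
    RCLike.star_def, mul_right_comm, Complex.conj_mul'] at h_det
  exact_mod_cast h_det

theorem denom_transpose_mulVec (hγ : γ ∈ Matrix.symplecticGroup (Fin n) ℤ)
    (hτ : τ ∈ siegelUpperHalfSpace n) (p q : Fin n → ℂ) :
    (denom γ τ)ᵀ *ᵥ (moebius γ τ *ᵥ p + q) = τ *ᵥ actFst γ p q + actSnd γ p q := by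
  rw [actFst_eq, actSnd_eq, Matrix.mulVec_add, Matrix.mulVec_mulVec,
    denom_transpose_mul_moebius hγ hτ, numer, denom]
  simp only [Matrix.transpose_add, Matrix.transpose_mul, hτ.1.eq, Matrix.add_mulVec,
    Matrix.mulVec_add, Matrix.mulVec_mulVec]
  abel

end Moebius

section Generators

variable {n : ℕ}

theorem exists_mp_translation {b : Matrix (Fin n) (Fin n) ℤ} (hb : b.IsSymm) :
    ∃ g : Mp n, ∀ τ, moebius g.γ τ = τ + castMat ℂ b := by
  have h_denom : ∀ τ, denom (Matrix.fromBlocks 1 b 0 1) τ = 1 := fun τ => by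
    simp [denom]
  refine ⟨⟨Matrix.fromBlocks 1 b 0 1, ?_, fun _ => 1, differentiableOn_const _, fun τ _ => ?_⟩,
    fun τ => ?_⟩
  · rw [SymplecticGroup.fromBlocks_mem_iff]
    simp [hb.eq]
  · rw [h_denom, one_pow, Matrix.det_one]
  · rw [moebius_eq_numer_mul_denom_inv, h_denom, numer]
    simp [castMat]

theorem exists_mp_baseChange (u : GL (Fin n) ℤ) :
    ∃ g : Mp n, ∀ τ, moebius g.γ τ = baseChange u τ := by
  have h_denom : ∀ τ, denom (Matrix.fromBlocks u.valᵀ 0 0 u⁻¹.val) τ = castMat ℂ u⁻¹.val :=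
    fun τ => by simp [denom, castMat]
  have h_inv : castMat ℂ u⁻¹.val * castMat ℂ u.val = 1 := by
    rw [← castMat_mul, Units.inv_mul, castMat_one]
  obtain ⟨s, hs⟩ := IsAlgClosed.exists_pow_nat_eq (castMat ℂ u⁻¹.val).det two_pos
  refine ⟨⟨Matrix.fromBlocks u.valᵀ 0 0 u⁻¹.val, ?_, fun _ => s, differentiableOn_const _,
    fun τ _ => ?_⟩, fun τ => ?_⟩
  · rw [SymplecticGroup.fromBlocks_mem_iff]
    simp
  · rw [h_denom, hs]
  · rw [moebius_eq_numer_mul_denom_inv, h_denom, numer, Matrix.inv_eq_right_inv h_inv]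
    simp [castMat, Matrix.transpose_map]

/-- The symplectic matrix inverting the `i`-th coordinate and fixing the others. -/
def partialInversion (i : Fin n) : Matrix (Fin n ⊕ Fin n) (Fin n ⊕ Fin n) ℤ :=
  Matrix.fromBlocks (1 - Matrix.single i i 1) (-Matrix.single i i 1) (Matrix.single i i 1)
    (1 - Matrix.single i i 1)

theorem partialInversion_mem (i : Fin n) :
    partialInversion i ∈ Matrix.symplecticGroup (Fin n) ℤ := by
  have h_idem : Matrix.single i i (1 : ℤ) * Matrix.single i i 1 = Matrix.single i i 1 := by simp
  rw [partialInversion, SymplecticGroup.fromBlocks_mem_iff]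
  simp only [Matrix.transpose_sub, Matrix.transpose_one, Matrix.transpose_neg,
    Matrix.transpose_single]
  refine ⟨?_, ?_, ?_⟩ <;> noncomm_ring
  rw [h_idem]
  abel

theorem det_denom_partialInversion (i : Fin n) (τ : Matrix (Fin n) (Fin n) ℂ) :
    (denom (partialInversion i) τ).det = τ i i := by
  have h_rank_one : denom (partialInversion i) τ =
      1 + Matrix.replicateCol Unit (Pi.single i 1 : Fin n → ℂ) *
        Matrix.replicateRow Unit (τ i - Pi.single i 1) := by
    ext a b
    obtain rfl | ha := eq_or_ne i a
    · obtain rfl | hb := eq_or_ne i b <;>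
      simp [denom, partialInversion, Matrix.mul_apply, Matrix.single_apply, *]
    · simp [denom, partialInversion, Matrix.mul_apply, Matrix.one_apply, ha]
  rw [h_rank_one, Matrix.det_one_add_replicateCol_mul_replicateRow]
  simp

theorem exists_mp_partialInversion (i : Fin n) : ∃ g : Mp n, g.γ = partialInversion i := by
  refine ⟨⟨partialInversion i, partialInversion_mem i, fun τ => τ i i ^ (1 / 2 : ℂ), ?_,
    fun τ _ => ?_⟩, rfl⟩
  · have h_diff : ∀ s : Set (Fin n → Fin n → ℂ), (∀ τ ∈ s, 0 < (τ i i).im) →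
        DifferentiableOn ℂ (fun τ : Fin n → Fin n → ℂ => τ i i ^ (1 / 2 : ℂ)) s :=
      fun s hs τ hτ => .cpow (by fun_prop) (differentiableWithinAt_const _) (.inr (hs τ hτ).ne')
    exact h_diff _ fun τ hτ => hτ.2.diag_pos
  · rw [det_denom_partialInversion, ← Complex.cpow_nat_mul]
    simp

end Generators

section InverseForm

variable {ι : Type*} [Fintype ι] [DecidableEq ι]

theorem quadForm_inv_mulVec {y : Matrix ι ι ℝ} (hy : y.PosDef) (p : ι → ℝ) :
    quadForm y⁻¹ (y *ᵥ p) = quadForm y p := by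
  rw [quadForm, Matrix.mulVec_mulVec,
    Matrix.nonsing_inv_mul _ ((Matrix.isUnit_iff_isUnit_det _).1 hy.isUnit), Matrix.one_mulVec,
    quadForm, dotProduct_comm]

theorem complexMat_inv {y : Matrix ι ι ℝ} (hy : IsUnit y.det) :
    (complexMat y)⁻¹ = complexMat y⁻¹ := by
  refine Matrix.inv_eq_left_inv ?_
  have h_mul : complexMat y⁻¹ * complexMat y = complexMat (y⁻¹ * y) :=
    (Matrix.map_mul (f := Complex.ofRealHom)).symm
  rw [h_mul, Matrix.nonsing_inv_mul _ hy]
  exact Matrix.map_one _ Complex.ofReal_zero Complex.ofReal_one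

theorem inv_apply_self_le {y : Matrix ι ι ℝ} (hy : y.PosDef) {a : ℝ} (ha : 0 < a)
    (h : ∀ x, a * ‖x‖ ^ 2 ≤ quadForm y x) (i : ι) : y⁻¹ i i ≤ 1 / a := by
  have h_unit := (Matrix.isUnit_iff_isUnit_det _).1 hy.isUnit
  have h_form : quadForm y (y⁻¹ *ᵥ Pi.single i 1) = y⁻¹ i i := by
    rw [quadForm, Matrix.mulVec_mulVec, Matrix.mul_nonsing_inv _ h_unit, Matrix.one_mulVec]
    simp
  have h_norm : y⁻¹ i i ≤ ‖y⁻¹ *ᵥ Pi.single i 1‖ := by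
    simpa [Real.norm_of_nonneg hy.inv.diag_pos.le] using norm_le_pi_norm (y⁻¹ *ᵥ Pi.single i 1) i
  have h_pos : 0 < y⁻¹ i i := hy.inv.diag_pos
  have h_sq : a * y⁻¹ i i * y⁻¹ i i ≤ 1 * y⁻¹ i i := by
    calc a * y⁻¹ i i * y⁻¹ i i = a * y⁻¹ i i ^ 2 := by ring
      _ ≤ a * ‖y⁻¹ *ᵥ Pi.single i 1‖ ^ 2 := by gcongr
      _ ≤ 1 * y⁻¹ i i := by rw [one_mul, ← h_form]; exact h _
  rw [le_div_iff₀' ha]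
  exact le_of_mul_le_mul_right h_sq h_pos

omit [Fintype ι] [DecidableEq ι] in
theorem abs_apply_le_of_posSemidef [Finite ι] {y : Matrix ι ι ℝ} (hy : y.PosSemidef) (i j : ι) :
    |y i j| ≤ (y i i + y j j) / 2 := by
  classical
  cases nonempty_fintype ι
  have h_symm : y j i = y i j := by simpa using hy.isHermitian.apply i j
  have h_add := quadForm_nonneg hy (Pi.single i 1 + Pi.single j 1)
  have h_sub := quadForm_nonneg hy (Pi.single i 1 - Pi.single j 1)
  simp only [quadForm, Matrix.mulVec_add, Matrix.mulVec_sub, add_dotProduct, sub_dotProduct,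
    dotProduct_add, dotProduct_sub, Matrix.mulVec_single_one, single_one_dotProduct,
    Matrix.col_apply, h_symm] at h_add h_sub
  exact abs_le.2 ⟨by linarith, by linarith⟩

theorem det_ge_of_mul_norm_sq_le_quadForm {y : Matrix ι ι ℝ} (hy : y.PosDef) {a : ℝ} (ha : 0 < a)
    (h : ∀ x, a * ‖x‖ ^ 2 ≤ quadForm y x) :
    a ^ Fintype.card ι / (Fintype.card ι).factorial ≤ y.det := by
  have h_entry : ∀ i j, AbsoluteValue.abs (y⁻¹ i j) ≤ 1 / a := fun i j => by
    have h_diag := add_le_add (inv_apply_self_le hy ha h i) (inv_apply_self_le hy ha h j)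
    exact (abs_apply_le_of_posSemidef hy.inv.posSemidef i j).trans (by linarith)
  have h_det := Matrix.det_le h_entry
  rw [Matrix.det_nonsing_inv, Ring.inverse_eq_inv', AbsoluteValue.abs_apply, abs_inv,
    abs_of_pos hy.det_pos, nsmul_eq_mul, one_div, inv_pow, ← div_eq_mul_inv] at h_det
  have h_inv := inv_anti₀ (inv_pos.2 hy.det_pos) h_det
  rwa [inv_inv, inv_div] at h_inv

end InverseForm

section SiegelForm

variable {n : ℕ} {τ : Matrix (Fin n) (Fin n) ℂ}

/-- The complex vector with the same real entries. -/
abbrev complexVec {ι : Type*} (v : ι → ℝ) : ι → ℂ := fun i => (v i : ℂ)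

/-- The real quadratic form `(p, q) ↦ ᵗξ̄ y⁻¹ ξ` with `ξ = τ p + q`, attached to `τ = x + i y`;
here it is expanded as `y⁻¹[x p + q] + y[p]`. Modular transformations permute its values on
integral vectors. -/
noncomputable def siegelForm (τ : Matrix (Fin n) (Fin n) ℂ) (p q : Fin n → ℝ) : ℝ :=
  quadForm (τ.map Complex.im)⁻¹ (τ.map Complex.re *ᵥ p + q) + quadForm (τ.map Complex.im) p

theorem ofReal_siegelForm (hτ : τ ∈ siegelUpperHalfSpace n) (p q : Fin n → ℝ) :
    (siegelForm τ p q : ℂ) = star (τ *ᵥ complexVec p + complexVec q) ⬝ᵥ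
      ((complexMat (τ.map Complex.im))⁻¹ *ᵥ (τ *ᵥ complexVec p + complexVec q)) := by
  rw [complexMat_inv ((Matrix.isUnit_iff_isUnit_det _).1 hτ.2.isUnit),
    star_dotProduct_complexMat_mulVec (isSymm_of_posDef hτ.2.inv), siegelForm,
    ← quadForm_inv_mulVec hτ.2 p]
  congr 3 <;> ext i <;> simp [Matrix.mulVec, dotProduct]

theorem star_mulVec_dotProduct_inv_mulVec {P Y : Matrix (Fin n) (Fin n) ℂ} (hP : IsUnit P.det)
    (ξ : Fin n → ℂ) : star (P *ᵥ ξ) ⬝ᵥ ((P * Y * Pᴴ)⁻¹ *ᵥ (P *ᵥ ξ)) = star ξ ⬝ᵥ (Y⁻¹ *ᵥ ξ) := by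
  have hP_star : IsUnit Pᴴ.det := by
    rw [Matrix.det_conjTranspose]
    exact hP.star
  rw [Matrix.star_mulVec, ← Matrix.dotProduct_mulVec, Matrix.mulVec_mulVec, Matrix.mulVec_mulVec,
    Matrix.mul_inv_rev, Matrix.mul_inv_rev, Matrix.mul_assoc, Matrix.mul_assoc, Matrix.mul_assoc,
    Matrix.nonsing_inv_mul _ hP, mul_one, Matrix.mul_nonsing_inv_cancel_left _ _ hP_star]

theorem siegelForm_moebius {γ : Matrix (Fin n ⊕ Fin n) (Fin n ⊕ Fin n) ℤ}
    (hγ : γ ∈ Matrix.symplecticGroup (Fin n) ℤ) (hτ : τ ∈ siegelUpperHalfSpace n)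
    (p q : Fin n → ℤ) :
    siegelForm (moebius γ τ) (castVec ℝ p) (castVec ℝ q) =
      siegelForm τ (castVec ℝ (actFst γ p q)) (castVec ℝ (actSnd γ p q)) := by
  have h_complex : ∀ v : Fin n → ℤ, complexVec (castVec ℝ v) = castVec ℂ v := fun v =>
    funext fun i => Complex.ofReal_intCast _
  have h_vec : τ *ᵥ castVec ℂ (actFst γ p q) + castVec ℂ (actSnd γ p q) =
      (denom γ τ)ᵀ *ᵥ (moebius γ τ *ᵥ castVec ℂ p + castVec ℂ q) := by
    rw [denom_transpose_mulVec hγ hτ]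
    exact congrArg₂ (τ *ᵥ · + ·) (map_actFst (Int.castRingHom ℂ) γ p q)
      (map_actSnd (Int.castRingHom ℂ) γ p q)
  have h_im : (denom γ τ)ᵀ * complexMat ((moebius γ τ).map Complex.im) * (denom γ τ)ᵀᴴ =
      complexMat (τ.map Complex.im) := by
    have h_transpose := congrArg Matrix.transpose
      (conjTranspose_denom_mul_im_moebius_mul_denom hγ hτ)
    have h_symm : ∀ {σ : Matrix (Fin n) (Fin n) ℂ}, σ ∈ siegelUpperHalfSpace n →
        (complexMat (σ.map Complex.im))ᵀ = complexMat (σ.map Complex.im) := fun hσ => by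
      rw [← Matrix.transpose_map, (isSymm_of_posDef hσ.2).eq]
    rw [Matrix.transpose_mul, Matrix.transpose_mul, h_symm hτ, h_symm (moebius_mem hγ hτ),
      ← Matrix.mul_assoc] at h_transpose
    exact h_transpose
  apply Complex.ofReal_injective
  rw [ofReal_siegelForm hτ, ofReal_siegelForm (moebius_mem hγ hτ)]
  simp only [h_complex]
  rw [h_vec, ← h_im, star_mulVec_dotProduct_inv_mulVec]
  exact Matrix.isUnit_det_transpose _ (isUnit_det_denom hγ hτ)

/-- The values of `siegelForm τ` on nonzero integral vectors are at least `ε`. -/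
def SiegelFormAtLeast (ε : ℝ) (τ : Matrix (Fin n) (Fin n) ℂ) : Prop :=
  ∀ p q : Fin n → ℤ, ¬ (p = 0 ∧ q = 0) → ε ≤ siegelForm τ (castVec ℝ p) (castVec ℝ q)

theorem SiegelFormAtLeast.moebius {ε : ℝ} {γ : Matrix (Fin n ⊕ Fin n) (Fin n ⊕ Fin n) ℤ}
    (h : SiegelFormAtLeast ε τ) (hγ : γ ∈ Matrix.symplecticGroup (Fin n) ℤ)
    (hτ : τ ∈ siegelUpperHalfSpace n) : SiegelFormAtLeast ε (moebius γ τ) := by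
  intro p q hpq
  rw [siegelForm_moebius hγ hτ]
  exact h _ _ fun h_zero => hpq (eq_zero_of_act_eq_zero hγ h_zero.1 h_zero.2)

theorem siegelForm_zero_left (q : Fin n → ℝ) :
    siegelForm τ 0 q = quadForm (τ.map Complex.im)⁻¹ q := by
  rw [siegelForm, Matrix.mulVec_zero, zero_add, quadForm_zero, add_zero]

theorem exists_siegelFormAtLeast (hτ : τ ∈ siegelUpperHalfSpace n) :
    ∃ ε > 0, SiegelFormAtLeast ε τ := by
  obtain ⟨a, ha, h_im⟩ := exists_mul_norm_sq_le_quadForm hτ.2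
  obtain ⟨b, hb, h_inv⟩ := exists_mul_norm_sq_le_quadForm hτ.2.inv
  have h_norm : ∀ {v : Fin n → ℤ}, v ≠ 0 → 1 ≤ ‖castVec ℝ v‖ ^ 2 := fun hv =>
    one_le_pow₀ (one_le_norm_castVec hv)
  refine ⟨min a b, lt_min ha hb, fun p q hpq => ?_⟩
  obtain rfl | hp := eq_or_ne p 0
  · have h_zero : castVec ℝ (0 : Fin n → ℤ) = 0 := funext fun _ => Int.cast_zero
    rw [h_zero, siegelForm_zero_left]
    calc min a b ≤ b * ‖castVec ℝ q‖ ^ 2 :=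
          (min_le_right _ _).trans (le_mul_of_one_le_right hb.le (h_norm fun hq => hpq ⟨rfl, hq⟩))
      _ ≤ _ := h_inv _
  · calc min a b ≤ a * ‖castVec ℝ p‖ ^ 2 :=
          (min_le_left _ _).trans (le_mul_of_one_le_right ha.le (h_norm hp))
      _ ≤ quadForm (τ.map Complex.im) (castVec ℝ p) := h_im _
      _ ≤ _ := le_add_of_nonneg_left (quadForm_nonneg hτ.2.inv.posSemidef _)

end SiegelForm

section SiegelReduction

variable {n : ℕ} {τ : Matrix (Fin n) (Fin n) ℂ}

/-- A Siegel set: `Im τ` dominates `c` times its diagonal part, whose entries are at least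
`1 / 2`. The real part is unrestricted. -/
def siegelSet (n : ℕ) (c : ℝ) : Set (Matrix (Fin n) (Fin n) ℂ) :=
  {τ ∈ siegelUpperHalfSpace n | DominatesDiag c (τ.map Complex.im) ∧ ∀ i, 1 / 2 ≤ (τ i i).im}

theorem DominatesDiag.mul_norm_sq_le {ι : Type*} [Fintype ι] {c b : ℝ} {y : Matrix ι ι ℝ}
    (h : DominatesDiag c y) (hc : 0 ≤ c) (hb : 0 ≤ b) (h_diag : ∀ i, b ≤ y i i) (x : ι → ℝ) :
    c * b * ‖x‖ ^ 2 ≤ quadForm y x := by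
  have h_norm : ‖x‖ ≤ √(∑ i, x i ^ 2) :=
    (pi_norm_le_iff_of_nonneg (Real.sqrt_nonneg _)).2 fun i => Real.abs_le_sqrt
      (Finset.single_le_sum (f := fun i => x i ^ 2) (fun _ _ => sq_nonneg _) (Finset.mem_univ i))
  calc c * b * ‖x‖ ^ 2 ≤ c * b * ∑ i, x i ^ 2 := by
        gcongr
        exact (Real.le_sqrt (norm_nonneg x) (by positivity)).1 h_norm
    _ = c * ∑ i, b * x i ^ 2 := by rw [mul_assoc, Finset.mul_sum]
    _ ≤ c * ∑ i, y i i * x i ^ 2 := by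
        gcongr with i
        exact h_diag i
    _ ≤ quadForm y x := h x

/-- Hermite's inequality, applied to the inverse of the imaginary part. -/
theorem exists_det_im_le_of_siegelFormAtLeast (n : ℕ) {ε : ℝ} (hε : 0 < ε) :
    ∃ D, ∀ τ ∈ siegelUpperHalfSpace n, SiegelFormAtLeast ε τ → (τ.map Complex.im).det ≤ D := by
  obtain ⟨c, hc, h_reduce⟩ := exists_baseChange_dominatesDiag n
  refine ⟨((c * ε) ^ n / n.factorial)⁻¹, fun τ hτ h_min => ?_⟩
  obtain ⟨u, hu⟩ := h_reduce _ hτ.2.inv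
  have h_diag : ∀ i, ε ≤ (baseChange u (τ.map Complex.im)⁻¹) i i := fun i => by
    have h_ne : u.val *ᵥ Pi.single i 1 ≠ 0 := mulVec_ne_zero_of_GL u (by simp)
    have h_value := h_min 0 _ fun h => h_ne h.2
    have h_zero : castVec ℝ (0 : Fin n → ℤ) = 0 := funext fun _ => Int.cast_zero
    rwa [h_zero, siegelForm_zero_left, ← quadForm_baseChange_castVec, castVec_single,
      quadForm_single] at h_value
  have h_det := det_ge_of_mul_norm_sq_le_quadForm (posDef_baseChange hτ.2.inv u)
    (mul_pos hc hε) (hu.mul_norm_sq_le hc.le hε.le h_diag)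
  rw [det_baseChange, Matrix.det_nonsing_inv, Ring.inverse_eq_inv', Fintype.card_fin] at h_det
  exact (le_inv_comm₀ (by positivity) hτ.2.det_pos).1 h_det

theorem map_im_baseChange (u : GL (Fin n) ℤ) (τ : Matrix (Fin n) (Fin n) ℂ) :
    (baseChange u τ).map Complex.im = baseChange u (τ.map Complex.im) := by
  ext i j
  simp [Matrix.mul_apply]

theorem exists_det_im_le_det_im_moebius_mul (hτ : τ ∈ siegelUpperHalfSpace n) (i : Fin n) :
    ∃ g₁ g₂ : Mp n, (τ.map Complex.im).det ≤
      ((moebius g₂.γ (moebius g₁.γ τ)).map Complex.im).det * (1 / 4 + (τ i i).im ^ 2) := by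
  obtain ⟨g₁, hg₁⟩ := exists_mp_translation (b := Matrix.single i i (-round (τ i i).re))
    (Matrix.transpose_single _ _ _)
  obtain ⟨g₂, hg₂⟩ := exists_mp_partialInversion i
  have hτ₁ := moebius_mem g₁.mem hτ
  have h_im : (moebius g₁.γ τ).map Complex.im = τ.map Complex.im := by
    rw [hg₁]
    ext a b
    simp
  have h_norm : ‖moebius g₁.γ τ i i‖ ^ 2 ≤ 1 / 4 + (τ i i).im ^ 2 := by
    have h_entry : moebius g₁.γ τ i i = τ i i - round (τ i i).re := by
      rw [hg₁]
      simp [sub_eq_add_neg]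
    have h_re := abs_le.1 (abs_sub_round (τ i i).re)
    rw [h_entry, ← Complex.normSq_eq_norm_sq, Complex.normSq_apply]
    simp only [Complex.sub_re, Complex.intCast_re, Complex.sub_im, Complex.intCast_im, sub_zero]
    nlinarith
  refine ⟨g₁, g₂, ?_⟩
  have h_det := norm_det_denom_sq_mul_det_im_moebius g₂.mem hτ₁
  rw [hg₂, det_denom_partialInversion, h_im, ← hg₂] at h_det
  rw [← h_det, mul_comm]
  gcongr
  exact (moebius_mem g₂.mem hτ₁).2.det_pos.le

theorem exists_moebius_two_mul_det_im_le (hτ : τ ∈ siegelUpperHalfSpace n) {v : Fin n → ℤ}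
    (hv : v ≠ 0) (h_small : quadForm (τ.map Complex.im) (castVec ℝ v) < 1 / 2) :
    ∃ g₁ g₂ g₃ : Mp n, 2 * (τ.map Complex.im).det ≤
      ((moebius g₃.γ (moebius g₂.γ (moebius g₁.γ τ))).map Complex.im).det := by
  obtain ⟨i, -⟩ := Function.ne_iff.mp hv
  obtain ⟨u, d, h_col⟩ := exists_GL_col_smul_eq v i
  obtain ⟨g₁, hg₁⟩ := exists_mp_baseChange u
  have hτ₁ := moebius_mem g₁.mem hτ
  have h_im : (moebius g₁.γ τ).map Complex.im = baseChange u (τ.map Complex.im) := by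
    rw [hg₁, map_im_baseChange]
  have h_entry_pos : 0 < (moebius g₁.γ τ i i).im := hτ₁.2.diag_pos
  have h_entry : (moebius g₁.γ τ i i).im < 1 / 2 := by
    have h_le := baseChange_apply_self_le_of_eq_smul_col hτ.2 hv h_col
    rw [← h_im] at h_le
    exact h_le.trans_lt h_small
  obtain ⟨g₂, g₃, h_det⟩ := exists_det_im_le_det_im_moebius_mul hτ₁ i
  refine ⟨g₁, g₂, g₃, ?_⟩
  rw [h_im, det_baseChange] at h_det
  have h_pos := (moebius_mem g₃.mem (moebius_mem g₂.mem hτ₁)).2.det_pos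
  have h_sq : 1 / 4 + (moebius g₁.γ τ i i).im ^ 2 ≤ 1 / 2 := by nlinarith
  linarith [mul_le_mul_of_nonneg_left h_sq h_pos.le]

theorem exists_mp_moebius_mem_siegelSet (n : ℕ) :
    ∃ c > 0, ∀ τ ∈ siegelUpperHalfSpace n,
      (∀ v : Fin n → ℤ, v ≠ 0 → 1 / 2 ≤ quadForm (τ.map Complex.im) (castVec ℝ v)) →
        ∃ g : Mp n, moebius g.γ τ ∈ siegelSet n c := by
  obtain ⟨c, hc, h_reduce⟩ := exists_baseChange_dominatesDiag n
  refine ⟨c, hc, fun τ hτ h_min => ?_⟩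
  obtain ⟨u, hu⟩ := h_reduce _ hτ.2
  obtain ⟨g, hg⟩ := exists_mp_baseChange u
  have h_im : (moebius g.γ τ).map Complex.im = baseChange u (τ.map Complex.im) := by
    rw [hg, map_im_baseChange]
  refine ⟨g, moebius_mem g.mem hτ, by rwa [h_im], fun i => ?_⟩
  rw [← Matrix.map_apply (f := Complex.im), h_im, ← quadForm_single (baseChange _ _),
    ← castVec_single, quadForm_baseChange_castVec]
  exact h_min _ (mulVec_ne_zero_of_GL u (by simp))

theorem moebius_induction {P : Matrix (Fin n) (Fin n) ℂ → Prop}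
    (h_pull : ∀ g : Mp n, ∀ τ ∈ siegelUpperHalfSpace n, P (moebius g.γ τ) → P τ)
    (h_minimal : ∀ τ ∈ siegelUpperHalfSpace n,
      (∀ v : Fin n → ℤ, v ≠ 0 → 1 / 2 ≤ quadForm (τ.map Complex.im) (castVec ℝ v)) → P τ)
    (hτ : τ ∈ siegelUpperHalfSpace n) : P τ := by
  obtain ⟨ε, hε, h_atLeast⟩ := exists_siegelFormAtLeast hτ
  obtain ⟨D, hD⟩ := exists_det_im_le_of_siegelFormAtLeast n hε
  -- Lower bounds on `siegelForm` bound `det (Im τ)` on the orbit, so doubling it must terminate.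
  have h_orbit : ∀ K : ℕ, ∀ τ ∈ siegelUpperHalfSpace n, SiegelFormAtLeast ε τ →
      D < 2 ^ K * (τ.map Complex.im).det → P τ := by
    intro K
    induction K with
    | zero =>
      intro τ hτ h_atLeast hK
      rw [pow_zero, one_mul] at hK
      exact absurd (hD τ hτ h_atLeast) (not_le.2 hK)
    | succ K ih =>
      intro τ hτ h_atLeast hK
      refine (em _).elim (h_minimal τ hτ) fun h_not_min => ?_
      push Not at h_not_min
      obtain ⟨v, hv, h_small⟩ := h_not_min
      obtain ⟨g₁, g₂, g₃, h_det⟩ := exists_moebius_two_mul_det_im_le hτ hv h_small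
      have hτ₁ := moebius_mem g₁.mem hτ
      have hτ₂ := moebius_mem g₂.mem hτ₁
      have hτ₃ := moebius_mem g₃.mem hτ₂
      refine h_pull g₁ _ hτ (h_pull g₂ _ hτ₁ (h_pull g₃ _ hτ₂ (ih _ hτ₃ ?_ ?_)))
      · exact ((h_atLeast.moebius g₁.mem hτ).moebius g₂.mem hτ₁).moebius g₃.mem hτ₂
      · calc D < 2 ^ K * (2 * (τ.map Complex.im).det) := by rwa [← mul_assoc, ← pow_succ]
          _ ≤ _ := by gcongr
  obtain ⟨K, hK⟩ := pow_unbounded_of_one_lt (D / (τ.map Complex.im).det) (one_lt_two (α := ℝ))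
  exact h_orbit K τ hτ h_atLeast ((div_lt_iff₀ hτ.2.det_pos).1 hK)

theorem exists_siegelSet_induction (n : ℕ) : ∃ c > 0, ∀ P : Matrix (Fin n) (Fin n) ℂ → Prop,
    (∀ g : Mp n, ∀ τ ∈ siegelUpperHalfSpace n, P (moebius g.γ τ) → P τ) →
      (∀ τ ∈ siegelSet n c, P τ) → ∀ τ ∈ siegelUpperHalfSpace n, P τ := by
  obtain ⟨c, hc, h_reduce⟩ := exists_mp_moebius_mem_siegelSet n
  refine ⟨c, hc, fun P h_pull h_siegel τ hτ => moebius_induction h_pull (fun τ hτ h_min => ?_) hτ⟩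
  obtain ⟨g, hg⟩ := h_reduce τ hτ h_min
  exact h_pull g τ hτ (h_siegel _ hg)

end SiegelReduction

section Exponential

theorem e_add (x y : ℂ) : e (x + y) = e x * e y := by
  rw [e, e, e, mul_add, Complex.exp_add]

theorem e_zero : e 0 = 1 := by
  rw [e, mul_zero, Complex.exp_zero]

theorem e_intCast (k : ℤ) : e k = 1 := by
  rw [e, mul_comm]
  exact Complex.exp_int_mul_two_pi_mul_I k

theorem norm_e (x : ℂ) : ‖e x‖ = Real.exp (-(2 * Real.pi * x.im)) := by
  simp [e, Complex.norm_exp]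

theorem norm_e_ofReal (x : ℝ) : ‖e x‖ = 1 := by
  rw [norm_e, Complex.ofReal_im, mul_zero, neg_zero, Real.exp_zero]

end Exponential

section Specialization

variable {n : ℕ} {κ : ℤ} {m : ℕ} {φ : Matrix (Fin n) (Fin n) ℂ → (Fin n → ℂ) → ℂ}
  {γ : Matrix (Fin n ⊕ Fin n) (Fin n ⊕ Fin n) ℤ} {τ : Matrix (Fin n) (Fin n) ℂ}

/-- The function `e(m ᵗl τ l) φ(τ, τ l + u)`: the torsion specialization of one Jacobi form, for
arbitrary complex parameters. -/
noncomputable def specialization (m : ℕ) (φ : Matrix (Fin n) (Fin n) ℂ → (Fin n → ℂ) → ℂ)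
    (l u : Fin n → ℂ) (τ : Matrix (Fin n) (Fin n) ℂ) : ℂ :=
  e (m * (l ⬝ᵥ (τ *ᵥ l))) * φ τ (τ *ᵥ l + u)

theorem sub_moebius_mul_mul_denom_transpose (hγ : γ ∈ Matrix.symplecticGroup (Fin n) ℤ)
    (hτ : τ ∈ siegelUpperHalfSpace n) :
    (castMat ℂ γ.toBlocks₁₁ - moebius γ τ * castMat ℂ γ.toBlocks₂₁) * (denom γ τ)ᵀ = 1 := by
  obtain ⟨h₁, -, -, h₄⟩ := symplectic_relations ℂ hγ
  rw [mul_eq_one_comm, Matrix.mul_sub, ← Matrix.mul_assoc, denom_transpose_mul_moebius hγ hτ,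
    numer, denom, Matrix.transpose_add, Matrix.transpose_add, Matrix.transpose_mul,
    Matrix.transpose_mul, hτ.1.eq, Matrix.add_mul, Matrix.add_mul, Matrix.mul_assoc τ,
    Matrix.mul_assoc τ, h₁, add_sub_add_left_eq_sub, h₄]

theorem specialization_phase (hγ : γ ∈ Matrix.symplecticGroup (Fin n) ℤ)
    (hτ : τ ∈ siegelUpperHalfSpace n) (l u : Fin n → ℂ) :
    l ⬝ᵥ (moebius γ τ *ᵥ l) + (τ *ᵥ actFst γ l u + actSnd γ l u) ⬝ᵥ
        (((denom γ τ)⁻¹ * castMat ℂ γ.toBlocks₂₁) *ᵥ (τ *ᵥ actFst γ l u + actSnd γ l u)) =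
      actFst γ l u ⬝ᵥ actSnd γ l u - l ⬝ᵥ u + actFst γ l u ⬝ᵥ (τ *ᵥ actFst γ l u) := by
  have h_z := denom_transpose_mulVec hγ hτ l u
  set z := τ *ᵥ actFst γ l u + actSnd γ l u
  set w := moebius γ τ *ᵥ l + u with hw
  have h_quad : z ⬝ᵥ (((denom γ τ)⁻¹ * castMat ℂ γ.toBlocks₂₁) *ᵥ z) =
      ((castMat ℂ γ.toBlocks₂₁)ᵀ *ᵥ w) ⬝ᵥ z := by
    nth_rewrite 1 [← h_z]
    rw [Matrix.mulVec_transpose, ← Matrix.dotProduct_mulVec, Matrix.mulVec_mulVec,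
      ← Matrix.mul_assoc, Matrix.mul_nonsing_inv _ (isUnit_det_denom hγ hτ), Matrix.one_mul,
      Matrix.dotProduct_mulVec, Matrix.mulVec_transpose]
  have h_diff : actFst γ l u - (castMat ℂ γ.toBlocks₂₁)ᵀ *ᵥ w =
      (castMat ℂ γ.toBlocks₁₁ - moebius γ τ * castMat ℂ γ.toBlocks₂₁)ᵀ *ᵥ l := by
    rw [actFst_eq, hw, Matrix.mulVec_add, Matrix.transpose_sub, Matrix.transpose_mul,
      (moebius_isSymm hγ hτ).eq, Matrix.sub_mulVec, Matrix.mulVec_mulVec]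
    abel
  have h_cross : actFst γ l u ⬝ᵥ z - ((castMat ℂ γ.toBlocks₂₁)ᵀ *ᵥ w) ⬝ᵥ z = l ⬝ᵥ w := by
    rw [← sub_dotProduct, h_diff, Matrix.mulVec_transpose, ← Matrix.dotProduct_mulVec, ← h_z,
      Matrix.mulVec_mulVec, sub_moebius_mul_mul_denom_transpose hγ hτ, Matrix.one_mulVec]
  have h_fst_z : actFst γ l u ⬝ᵥ z =
      actFst γ l u ⬝ᵥ (τ *ᵥ actFst γ l u) + actFst γ l u ⬝ᵥ actSnd γ l u := dotProduct_add _ _ _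
  have h_l_w : l ⬝ᵥ w = l ⬝ᵥ (moebius γ τ *ᵥ l) + l ⬝ᵥ u := dotProduct_add _ _ _
  rw [h_quad]
  linear_combination h_fst_z - h_l_w - h_cross

theorem specialization_moebius (hφ : IsJacobiForm n κ m φ) (g : Mp n)
    (hτ : τ ∈ siegelUpperHalfSpace n) (l u : Fin n → ℂ) :
    specialization m φ l u (moebius g.γ τ) =
      g.ω τ ^ κ * e (m * (actFst g.γ l u ⬝ᵥ actSnd g.γ l u - l ⬝ᵥ u)) *
        specialization m φ (actFst g.γ l u) (actSnd g.γ l u) τ := by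
  set z := τ *ᵥ actFst g.γ l u + actSnd g.γ l u with hz
  have h_w : ((denom g.γ τ)⁻¹)ᵀ *ᵥ z = moebius g.γ τ *ᵥ l + u := by
    rw [hz, ← denom_transpose_mulVec g.mem hτ l u, Matrix.mulVec_mulVec,
      ← Matrix.transpose_mul, Matrix.mul_nonsing_inv _ (isUnit_det_denom g.mem hτ),
      Matrix.transpose_one, Matrix.one_mulVec]
  have h_modular := hφ.modular g τ hτ z
  rw [h_w] at h_modular
  have h_phase : e (m * (l ⬝ᵥ (moebius g.γ τ *ᵥ l))) *
      e (m * (z ⬝ᵥ (((denom g.γ τ)⁻¹ * castMat ℂ g.γ.toBlocks₂₁) *ᵥ z))) =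
      e (m * (actFst g.γ l u ⬝ᵥ actSnd g.γ l u - l ⬝ᵥ u)) *
        e (m * (actFst g.γ l u ⬝ᵥ (τ *ᵥ actFst g.γ l u))) := by
    rw [← e_add, ← e_add, ← mul_add, ← mul_add, specialization_phase g.mem hτ]
  rw [specialization, specialization, h_modular]
  linear_combination g.ω τ ^ κ * φ τ z * h_phase

theorem specialization_add_intCast (hφ : IsJacobiForm n κ m φ) (hτ : τ ∈ siegelUpperHalfSpace n)
    (l u : Fin n → ℂ) (a b : Fin n → ℤ) :
    specialization m φ (l + castVec ℂ a) (u + castVec ℂ b) τ =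
      e (-(2 * m * (castVec ℂ a ⬝ᵥ u))) * specialization m φ l u τ := by
  have h_arg : τ *ᵥ (l + castVec ℂ a) + (u + castVec ℂ b) =
      τ *ᵥ l + u + τ *ᵥ castVec ℂ a + castVec ℂ b := by
    rw [Matrix.mulVec_add]; abel
  rw [specialization, specialization, h_arg, hφ.elliptic a b τ hτ (τ *ᵥ l + u), ← mul_assoc,
    ← mul_assoc, ← e_add, ← e_add]
  congr 2
  simp only [Matrix.mulVec_add, add_dotProduct, dotProduct_add,
    dotProduct_mulVec_comm_of_isSymm hτ.1 l]
  ring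

theorem omega_ne_zero (g : Mp n) (hτ : τ ∈ siegelUpperHalfSpace n) : g.ω τ ≠ 0 := by
  rw [← pow_ne_zero_iff two_ne_zero, g.sq τ hτ]
  exact (isUnit_det_denom g.mem hτ).ne_zero

theorem norm_omega_zpow_mul_det_im_moebius_rpow (g : Mp n) (hτ : τ ∈ siegelUpperHalfSpace n)
    (κ : ℤ) :
    ‖g.ω τ‖ ^ κ * ((moebius g.γ τ).map Complex.im).det ^ ((κ : ℝ) / 4) =
      (τ.map Complex.im).det ^ ((κ : ℝ) / 4) := by
  have h_omega : 0 < ‖g.ω τ‖ := norm_pos_iff.2 (omega_ne_zero g hτ)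
  have h_pow : ((‖g.ω τ‖ ^ 2) ^ 2) ^ ((κ : ℝ) / 4) = ‖g.ω τ‖ ^ κ := by
    rw [← pow_mul, ← Real.rpow_natCast, ← Real.rpow_mul h_omega.le, ← Real.rpow_intCast]
    congr 1
    push_cast
    ring
  rw [← norm_det_denom_sq_mul_det_im_moebius g.mem hτ, ← g.sq τ hτ, norm_pow,
    Real.mul_rpow (by positivity) (moebius_mem g.mem hτ).2.det_pos.le, h_pow]

/-- All specializations of `φ` at real parameters with entries in `A`, weighted as in the Hecke
norm, are bounded by `B` at `τ`. The group `A` is `ℝ` or the `N`-torsion group. -/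
def BoundedAt (κ : ℤ) (m : ℕ) (φ : Matrix (Fin n) (Fin n) ℂ → (Fin n → ℂ) → ℂ)
    (A : AddSubgroup ℝ) (B : ℝ) (τ : Matrix (Fin n) (Fin n) ℂ) : Prop :=
  ∀ l u : Fin n → ℝ, (∀ i, l i ∈ A) → (∀ i, u i ∈ A) →
    ‖specialization m φ (complexVec l) (complexVec u) τ‖ *
      (τ.map Complex.im).det ^ ((κ : ℝ) / 4) ≤ B

theorem complexVec_dotProduct {ι : Type*} [Fintype ι] (v w : ι → ℝ) :
    complexVec v ⬝ᵥ complexVec w = ((v ⬝ᵥ w : ℝ) : ℂ) := by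
  simp [dotProduct]

theorem BoundedAt.of_moebius (hφ : IsJacobiForm n κ m φ) {A : AddSubgroup ℝ} {B : ℝ} (g : Mp n)
    (hτ : τ ∈ siegelUpperHalfSpace n) (h : BoundedAt κ m φ A B (moebius g.γ τ)) :
    BoundedAt κ m φ A B τ := by
  intro l u hl hu
  obtain ⟨l₀, u₀, hl₀, hu₀, rfl, rfl⟩ := exists_act_eq g.mem hl hu
  have h_fst : complexVec (actFst g.γ l₀ u₀) = actFst g.γ (complexVec l₀) (complexVec u₀) :=
    map_actFst Complex.ofRealHom g.γ l₀ u₀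
  have h_snd : complexVec (actSnd g.γ l₀ u₀) = actSnd g.γ (complexVec l₀) (complexVec u₀) :=
    map_actSnd Complex.ofRealHom g.γ l₀ u₀
  have h_bound := h l₀ u₀ hl₀ hu₀
  have h_phase : ‖e (m * (complexVec (actFst g.γ l₀ u₀) ⬝ᵥ complexVec (actSnd g.γ l₀ u₀) -
      complexVec l₀ ⬝ᵥ complexVec u₀))‖ = 1 := by
    rw [complexVec_dotProduct, complexVec_dotProduct]
    exact_mod_cast norm_e_ofReal _
  rw [specialization_moebius hφ g hτ, ← h_fst, ← h_snd, norm_mul, norm_mul, h_phase, mul_one,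
    norm_zpow, mul_comm (‖g.ω τ‖ ^ κ), mul_assoc,
    norm_omega_zpow_mul_det_im_moebius_rpow g hτ] at h_bound
  exact h_bound

end Specialization

section TorusFourierSeries

open UnitAddTorus

variable {α J : Type*} [Fintype J] {ℓ : α → J → ℤ} {a : α → ℂ}

theorem norm_coeff_le_of_hasSum_mFourier (hℓ : Function.Injective ℓ) {F : C(UnitAddTorus J, ℂ)}
    (hF : HasSum (fun i => a i • mFourier (ℓ i)) F) (i : α) : ‖a i‖ ≤ ‖F‖ := by
  let _ : MeasureTheory.MeasureSpace UnitAddCircle := ⟨AddCircle.haarAddCircle⟩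
  have _ : MeasureTheory.IsProbabilityMeasure
      (MeasureTheory.volume : MeasureTheory.Measure UnitAddCircle) :=
    inferInstanceAs (MeasureTheory.IsProbabilityMeasure AddCircle.haarAddCircle)
  classical
  have h_orth := orthonormal_mFourier (d := J)
  have h_sum := hF.mapL (ContinuousMap.toLp (E := ℂ) 2 MeasureTheory.volume ℂ)
  have h_coeff : inner ℂ (mFourierLp 2 (ℓ i)) (ContinuousMap.toLp 2 _ ℂ F) = a i := by
    refine (h_sum.mapL (innerSL ℂ (mFourierLp 2 (ℓ i)))).unique ?_
    convert! hasSum_ite_eq i (a i) using 2 with j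
    rw [map_smul, map_smul, innerSL_apply_apply, smul_eq_mul]
    change a j * inner ℂ (mFourierLp 2 (ℓ i)) (mFourierLp 2 (ℓ j)) = _
    rw [orthonormal_iff_ite.1 h_orth]
    by_cases hij : j = i
    · simp [hij]
    · simp [hij, hℓ.ne (Ne.symm hij)]
  calc ‖a i‖ ≤ ‖mFourierLp 2 (ℓ i)‖ * ‖ContinuousMap.toLp 2 MeasureTheory.volume ℂ F‖ := by
        rw [← h_coeff]
        exact norm_inner_le_norm _ _
    _ ≤ 1 * (1 * ‖F‖) := by
        rw [h_orth.1]
        gcongr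
        refine ContinuousLinearMap.le_of_opNorm_le _ ((ContinuousMap.toLp_norm_le _).trans ?_) F
        simp [MeasureTheory.measureUnivNNReal]
    _ = ‖F‖ := by rw [one_mul, one_mul]

theorem mFourier_coe (k : J → ℤ) (θ : J → ℝ) :
    mFourier k (fun j => (θ j : UnitAddCircle)) = e (castVec ℂ k ⬝ᵥ complexVec θ) := by
  simp only [mFourier, ContinuousMap.coe_mk, fourier_coe_apply, ← Complex.exp_sum, e, dotProduct,
    Finset.mul_sum]
  congr 2 with j
  push_cast
  ring

theorem norm_coeff_le_of_hasSum (hℓ : Function.Injective ℓ) (s : α → ℝ) {f : (J → ℝ) → ℂ} {B : ℝ}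
    (hf : ∀ θ, HasSum
      (fun i => a i * e (castVec ℂ (ℓ i) ⬝ᵥ complexVec θ + Complex.I * s i)) (f θ))
    (hB : ∀ θ, ‖f θ‖ ≤ B) (i : α) : ‖a i‖ ≤ B * Real.exp (2 * Real.pi * s i) := by
  set b : α → ℂ := fun i => a i * e (Complex.I * s i) with hb
  have hf' : ∀ θ, HasSum (fun i => b i * e (castVec ℂ (ℓ i) ⬝ᵥ complexVec θ)) (f θ) := fun θ => by
    simpa only [hb, e_add, mul_assoc, mul_left_comm, mul_comm] using hf θ
  have h_summable : Summable fun i => b i • mFourier (ℓ i) := by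
    have h_zero : complexVec (0 : J → ℝ) = 0 := funext fun _ => Complex.ofReal_zero
    have h_norm := (hf' 0).summable.norm
    simp only [h_zero, dotProduct_zero, e_zero, mul_one] at h_norm
    exact Summable.of_norm (by simpa only [norm_smul, mFourier_norm, mul_one] using h_norm)
  obtain ⟨F, hF⟩ := h_summable
  have h_value : ∀ θ : J → ℝ, F (fun j => (θ j : UnitAddCircle)) = f θ := fun θ => by
    refine ((ContinuousMap.evalCLM ℂ fun j => (θ j : UnitAddCircle)).hasSum hF).unique ?_
    simpa only [ContinuousMap.evalCLM_apply, ContinuousMap.smul_apply, smul_eq_mul, mFourier_coe]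
      using hf' θ
  have h_norm : ‖F‖ ≤ B := by
    refine (ContinuousMap.norm_le _ ((norm_nonneg _).trans (hB 0))).2 fun x => ?_
    choose θ hθ using fun j => QuotientAddGroup.mk_surjective (x j)
    obtain rfl : (fun j => (θ j : UnitAddCircle)) = x := funext hθ
    rw [h_value]
    exact hB θ
  have h_le := (norm_coeff_le_of_hasSum_mFourier hℓ hF i).trans h_norm
  rwa [hb, norm_mul, norm_e, Complex.I_mul_im, Complex.ofReal_re, Real.exp_neg, ← div_eq_mul_inv,
    div_le_iff₀ (Real.exp_pos _)] at h_le

end TorusFourierSeries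

section FourierCoefficients

variable {n : ℕ}

/-- The real matrix with the same rational entries. -/
abbrev realMat {ι : Type*} (t : Matrix ι ι ℚ) : Matrix ι ι ℝ := t.map fun x : ℚ => (x : ℝ)

theorem traceMul_eq (t : Matrix (Fin n) (Fin n) ℚ) (τ : Matrix (Fin n) (Fin n) ℂ) :
    traceMul t τ = (complexMat (realMat t) * τ).trace := by
  simp [traceMul, Matrix.trace, Matrix.mul_apply]

theorem im_trace_complexMat_mul (s : Matrix (Fin n) (Fin n) ℝ) (τ : Matrix (Fin n) (Fin n) ℂ) :
    (complexMat s * τ).trace.im = (s * τ.map Complex.im).trace := by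
  simp [Matrix.trace, Matrix.mul_apply]

theorem trace_complexMat_mul_add_I_smul (s x y : Matrix (Fin n) (Fin n) ℝ) :
    (complexMat s * (complexMat x + Complex.I • complexMat y)).trace =
      (s * x).trace + Complex.I * (s * y).trace := by
  rw [Matrix.mul_add, Matrix.mul_smul, Matrix.trace_add, Matrix.trace_smul, smul_eq_mul]
  simp [Matrix.trace, Matrix.mul_apply]

theorem map_im_complexMat_add_I_smul (x y : Matrix (Fin n) (Fin n) ℝ) :
    (complexMat x + Complex.I • complexMat y).map Complex.im = y := by
  ext i j
  simp

theorem complexMat_add_I_smul_mem {x y : Matrix (Fin n) (Fin n) ℝ} (hx : x.IsSymm)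
    (hy : y.PosDef) : complexMat x + Complex.I • complexMat y ∈ siegelUpperHalfSpace n := by
  refine ⟨?_, by rwa [map_im_complexMat_add_I_smul]⟩
  rw [Matrix.IsSymm, Matrix.transpose_add, Matrix.transpose_smul, ← Matrix.transpose_map,
    ← Matrix.transpose_map, hx.eq, (isSymm_of_posDef hy).eq]

/-- The integers `2 t i j` attached to a half-integral matrix `t`: its frequencies as the exponent
of a Fourier series. -/
def doubledEntry (t : HalfInt n) (p : Fin n × Fin n) : ℤ := (2 * t.1 p.1 p.2).num

theorem doubledEntry_cast (t : HalfInt n) (p : Fin n × Fin n) :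
    (doubledEntry t p : ℝ) = 2 * realMat t.1 p.1 p.2 := by
  obtain ⟨a, ha⟩ := t.2.2.2 p.1 p.2
  have h_num : (doubledEntry t p : ℚ) = 2 * t.1 p.1 p.2 := by
    rw [doubledEntry, ha, Rat.num_intCast]
  change (doubledEntry t p : ℝ) = 2 * ((t.1 p.1 p.2 : ℚ) : ℝ)
  exact_mod_cast congrArg (Rat.cast : ℚ → ℝ) h_num

theorem doubledEntry_injective : Function.Injective (doubledEntry (n := n)) := by
  intro s t hst
  ext i j
  have h_cast := doubledEntry_cast s (i, j)
  rw [hst, doubledEntry_cast t (i, j)] at h_cast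
  simpa using h_cast.symm

theorem trace_mul_add_transpose (t : HalfInt n) (θ : Fin n × Fin n → ℝ) :
    (realMat t.1 * (Matrix.of (Function.curry θ) + (Matrix.of (Function.curry θ))ᵀ)).trace =
      (fun p => (doubledEntry t p : ℝ)) ⬝ᵥ θ := by
  have h_transpose : (realMat t.1)ᵀ = realMat t.1 := by rw [← Matrix.transpose_map, t.2.1.eq]
  have h_trace : (realMat t.1 * Matrix.of (Function.curry θ)).trace =
      (realMat t.1 * (Matrix.of (Function.curry θ))ᵀ).trace := by
    rw [← Matrix.trace_transpose, Matrix.transpose_mul, Matrix.trace_mul_comm, h_transpose]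
  rw [Matrix.mul_add, Matrix.trace_add, h_trace, ← two_mul]
  simp only [doubledEntry_cast, dotProduct, Fintype.sum_prod_type, Matrix.trace, Matrix.diag_apply,
    Matrix.mul_apply, Matrix.transpose_apply, Matrix.of_apply, Function.curry_apply,
    Finset.mul_sum, mul_assoc]

theorem norm_coeff_le_of_hasSum_traceMul {M : ℕ} (hM : 0 < M) {c : HalfInt n → ℂ}
    {h : Matrix (Fin n) (Fin n) ℂ → ℂ}
    (hc : ∀ τ ∈ siegelUpperHalfSpace n,
      HasSum (fun t : HalfInt n => c t * e (traceMul t.1 τ / M)) (h τ))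
    {y : Matrix (Fin n) (Fin n) ℝ} (hy : y.PosDef) {B : ℝ}
    (hB : ∀ τ ∈ siegelUpperHalfSpace n, τ.map Complex.im = y → ‖h τ‖ ≤ B) (t : HalfInt n) :
    ‖c t‖ ≤ B * Real.exp (2 * Real.pi * ((realMat t.1 * y).trace / M)) := by
  set x : (Fin n × Fin n → ℝ) → Matrix (Fin n) (Fin n) ℝ := fun θ =>
    Matrix.of (Function.curry θ) + (Matrix.of (Function.curry θ))ᵀ
  have h_mem : ∀ θ, complexMat ((M : ℝ) • x θ) + Complex.I • complexMat y ∈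
      siegelUpperHalfSpace n := fun θ =>
    complexMat_add_I_smul_mem ((Matrix.isSymm_add_transpose_self _).smul _) hy
  refine norm_coeff_le_of_hasSum doubledEntry_injective
    (fun t => (realMat t.1 * y).trace / M) (fun θ => ?_)
    (fun θ => hB _ (h_mem θ) (map_im_complexMat_add_I_smul _ _)) t
  convert! hc _ (h_mem θ) using 4 with s
  rw [traceMul_eq, trace_complexMat_mul_add_I_smul, Matrix.mul_smul, Matrix.trace_smul,
    trace_mul_add_transpose]
  have hM' : (M : ℂ) ≠ 0 := Nat.cast_ne_zero.2 hM.ne'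
  simp only [dotProduct, smul_eq_mul]
  push_cast
  field_simp

theorem HasJacobiFourierExpansion.norm_coeff_le {m : ℕ}
    {c : Matrix (Fin n) (Fin n) ℚ → (Fin n → ℤ) → ℂ}
    {φ : Matrix (Fin n) (Fin n) ℂ → (Fin n → ℂ) → ℂ} (hc : HasJacobiFourierExpansion m φ c)
    {y : Matrix (Fin n) (Fin n) ℝ} (hy : y.PosDef) (v : Fin n → ℝ) {B : ℝ}
    (hB : ∀ τ ∈ siegelUpperHalfSpace n, τ.map Complex.im = y →
      ∀ z : Fin n → ℂ, (∀ i, (z i).im = v i) → ‖φ τ z‖ ≤ B)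
    (T : HalfInt n) (r : Fin n → ℤ) :
    ‖c T.1 r‖ ≤ B * Real.exp (2 * Real.pi * ((realMat T.1 * y).trace + castVec ℝ r ⬝ᵥ v)) := by
  set x : (Fin n × Fin n → ℝ) → Matrix (Fin n) (Fin n) ℝ := fun θ =>
    Matrix.of (Function.curry θ) + (Matrix.of (Function.curry θ))ᵀ
  have h_mem : ∀ θ, complexMat (x θ) + Complex.I • complexMat y ∈ siegelUpperHalfSpace n :=
    fun θ => complexMat_add_I_smul_mem (Matrix.isSymm_add_transpose_self _) hy
  have h_inj : Function.Injective fun p : HalfInt n × (Fin n → ℤ) =>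
      Sum.elim (doubledEntry p.1) p.2 := by
    rintro ⟨S, r⟩ ⟨T, s⟩ h
    obtain ⟨hST, hrs⟩ := Sum.elim_eq_iff.1 h
    exact Prod.ext (doubledEntry_injective hST) hrs
  refine norm_coeff_le_of_hasSum h_inj
    (a := fun p => c p.1.1 p.2) (fun p => (realMat p.1.1 * y).trace + castVec ℝ p.2 ⬝ᵥ v)
    (fun θ => ?_) (fun θ => hB _ (h_mem (θ ∘ Sum.inl)) (map_im_complexMat_add_I_smul _ _)
      (fun i => θ (Sum.inr i) + Complex.I * v i) fun i => by simp) (T, r)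
  convert! hc.2 _ (h_mem (θ ∘ Sum.inl)) _ using 4 with p
  rw [traceMul_eq, trace_complexMat_mul_add_I_smul, trace_mul_add_transpose]
  have h_im : ∑ i, (p.2 i : ℂ) * (Complex.I * v i) = Complex.I * ∑ i, (p.2 i : ℂ) * v i := by
    rw [Finset.mul_sum]
    exact Finset.sum_congr rfl fun i _ => mul_left_comm _ _ _
  simp only [dotProduct, Fintype.sum_sum_type, Sum.elim_inl, Sum.elim_inr, complexVec, castVec,
    Function.comp_apply, mul_add, Finset.sum_add_distrib, h_im]
  push_cast
  ring

end FourierCoefficients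

section HalfIntegralMatrices

variable {ι : Type} {t : Matrix ι ι ℚ}

theorem halfIntegral_iff_exists_two_smul_eq :
    HalfIntegral t ↔ ∃ A : Matrix ι ι ℤ, (2 : ℚ) • t = castMat ℚ A + (castMat ℚ A)ᵀ := by
  constructor
  · rintro ⟨h_symm, h_diag, h_entry⟩
    choose d hd using h_diag
    choose o ho using h_entry
    classical
    let : LinearOrder ι := linearOrderOfSTO WellOrderingRel
    refine ⟨Matrix.of fun i j => if i = j then d i else if i < j then o i j else 0, ?_⟩
    ext i j
    rcases lt_trichotomy i j with h | rfl | h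
    · simp [h.ne, h.ne', h, h.not_gt, ho]
    · simp [hd, two_mul]
    · simp [h.ne, h.ne', h, h.not_gt, ← ho, h_symm.apply]
  · rintro ⟨A, hA⟩
    have h_entry : ∀ i j, 2 * t i j = A i j + A j i := fun i j => by
      simpa using congrFun (congrFun hA i) j
    refine ⟨Matrix.IsSymm.ext fun i j => ?_, fun i => ⟨A i i, ?_⟩, fun i j => ⟨A i j + A j i, ?_⟩⟩
    · linarith [h_entry i j, h_entry j i]
    · linarith [h_entry i i]
    · exact_mod_cast h_entry i j

theorem realMat_baseChange [Fintype ι] [DecidableEq ι] (u : GL ι ℤ) (t : Matrix ι ι ℚ) :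
    realMat (baseChange u t) = baseChange u (realMat t) := by
  ext i j
  simp [Matrix.mul_apply]

theorem halfIntegral_baseChange [Fintype ι] [DecidableEq ι] (ht : HalfIntegral t) (u : GL ι ℤ) :
    HalfIntegral (baseChange u t) := by
  obtain ⟨A, hA⟩ := halfIntegral_iff_exists_two_smul_eq.1 ht
  refine halfIntegral_iff_exists_two_smul_eq.2 ⟨u.valᵀ * A * u.val, ?_⟩
  have h_transpose : castMat ℚ u.valᵀ = (castMat ℚ u.val)ᵀ := rfl
  rw [← Matrix.smul_mul, ← Matrix.mul_smul, hA, castMat_mul, castMat_mul, Matrix.transpose_mul,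
    Matrix.transpose_mul, Matrix.mul_add, Matrix.add_mul, h_transpose,
    Matrix.transpose_transpose, Matrix.mul_assoc _ (castMat ℚ A)ᵀ]

theorem HalfIntegral.exists_quadForm_eq_zero [Fintype ι] (ht : HalfIntegral t)
    (h_psd : (realMat t).PosSemidef) (h_pd : ¬ (realMat t).PosDef) :
    ∃ v : ι → ℤ, v ≠ 0 ∧ quadForm (realMat t) (castVec ℝ v) = 0 := by
  classical
  obtain ⟨A, hA⟩ := halfIntegral_iff_exists_two_smul_eq.1 ht
  have h_two_smul : (2 : ℝ) • realMat t = castMat ℝ (A + Aᵀ) := by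
    ext i j
    have h_entry : 2 * t i j = A i j + A j i := by simpa using congrFun (congrFun hA i) j
    simpa using congrArg (Rat.cast : ℚ → ℝ) h_entry
  have h_det : (realMat t).det = 0 := by
    by_contra h
    exact h_pd (h_psd.posDef_iff_isUnit.2
      ((Matrix.isUnit_iff_isUnit_det _).2 (isUnit_iff_ne_zero.2 h)))
  have h_det_int : (A + Aᵀ).det = 0 := by
    have h_cast : (((A + Aᵀ).det : ℤ) : ℝ) = (castMat ℝ (A + Aᵀ)).det :=
      (Int.castRingHom ℝ).map_det _
    rw [← h_two_smul, Matrix.det_smul, h_det, mul_zero] at h_cast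
    exact_mod_cast h_cast
  obtain ⟨v, hv, hv_ker⟩ := Matrix.exists_mulVec_eq_zero_iff.2 h_det_int
  have h_ker : (2 : ℝ) • (realMat t *ᵥ castVec ℝ v) = 0 := by
    rw [← Matrix.smul_mulVec, h_two_smul, castMat_mulVec_castVec, hv_ker]
    simp [funext_iff, castVec]
  refine ⟨v, hv, ?_⟩
  rw [quadForm, (smul_eq_zero.1 h_ker).resolve_left two_ne_zero, dotProduct_zero]

end HalfIntegralMatrices

section BlockMatrices

variable {n : ℕ}

theorem halfIntegral_blockMatrix (T : HalfInt n) (r : Fin n → ℤ) (m : ℕ) :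
    HalfIntegral (blockMatrix T.1 r m) := by
  obtain ⟨h_symm, h_diag, h_entry⟩ := T.2
  refine ⟨Matrix.IsSymm.fromBlocks h_symm rfl rfl, ?_, ?_⟩
  · rintro (i | i)
    · exact h_diag i
    · exact ⟨m, (Int.cast_natCast m).symm⟩
  · rintro (i | i) (j | j)
    · exact h_entry i j
    · exact ⟨r i, mul_div_cancel₀ _ two_ne_zero⟩
    · exact ⟨r j, mul_div_cancel₀ _ two_ne_zero⟩
    · exact ⟨2 * m, by simp [blockMatrix]⟩

theorem HalfIntegral.exists_eq_blockMatrix {t : Matrix (Fin n ⊕ Unit) (Fin n ⊕ Unit) ℚ}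
    (ht : HalfIntegral t) (h_nonneg : 0 ≤ t (.inr ()) (.inr ())) :
    ∃ (T : HalfInt n) (r : Fin n → ℤ) (m : ℕ), t = blockMatrix T.1 r m := by
  obtain ⟨h_symm, h_diag, h_entry⟩ := ht
  choose r hr using fun i : Fin n => h_entry (.inl i) (.inr ())
  obtain ⟨a, ha⟩ := h_diag (.inr ())
  lift a to ℕ using by exact_mod_cast ha ▸ h_nonneg
  refine ⟨⟨t.toBlocks₁₁, Matrix.IsSymm.ext fun _ _ => h_symm.apply _ _,
    fun i => h_diag (.inl i), fun i j => h_entry (.inl i) (.inl j)⟩, r, a, ?_⟩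
  have h_col : ∀ i, t (.inl i) (.inr ()) = r i / 2 := fun i => by linarith [hr i]
  ext (i | _) (j | _)
  · rfl
  · exact h_col i
  · exact (h_symm.apply _ _).symm.trans (h_col j)
  · exact ha

theorem quadForm_blockMatrix (T : Matrix (Fin n) (Fin n) ℚ) (r : Fin n → ℤ) (m : ℕ)
    (x : Fin n → ℝ) (s : ℝ) :
    quadForm (realMat (blockMatrix T r m)) (Sum.elim x fun _ => s) =
      quadForm (realMat T) x + s * (castVec ℝ r ⬝ᵥ x) + m * s ^ 2 := by
  have h_blocks : realMat (blockMatrix T r m) = Matrix.fromBlocks (realMat T)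
      (Matrix.of fun i _ => (r i : ℝ) / 2) (Matrix.of fun _ j => (r j : ℝ) / 2)
      (Matrix.of fun _ _ => (m : ℝ)) := by
    ext (i | i) (j | j) <;> simp [blockMatrix]
  have h_col : x ⬝ᵥ ((Matrix.of fun i (_ : Unit) => (r i : ℝ) / 2) *ᵥ fun _ => s) =
      s * (castVec ℝ r ⬝ᵥ x) / 2 := by
    simp only [dotProduct, Matrix.mulVec, Matrix.of_apply, Finset.univ_unique,
      Finset.sum_singleton, Finset.mul_sum, Finset.sum_div]
    exact Finset.sum_congr rfl fun i _ => by ring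
  have h_row : (Matrix.of fun (_ : Unit) j => (r j : ℝ) / 2) *ᵥ x =
      fun _ => (castVec ℝ r ⬝ᵥ x) / 2 := by
    ext
    simp only [dotProduct, Matrix.mulVec, Matrix.of_apply, Finset.sum_div]
    exact Finset.sum_congr rfl fun i _ => by ring
  rw [quadForm, h_blocks, Matrix.fromBlocks_mulVec, sumElim_dotProduct_sumElim, dotProduct_add,
    Sum.elim_comp_inl, Sum.elim_comp_inr, h_col, h_row, quadForm]
  simp only [dotProduct, Matrix.mulVec, Matrix.of_apply, Pi.add_apply, Finset.univ_unique,
    Finset.sum_singleton]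
  ring

theorem HalfIntegral.exists_baseChange_eq_blockMatrix
    {t : Matrix (Fin n ⊕ Unit) (Fin n ⊕ Unit) ℚ} (ht : HalfIntegral t)
    (h_psd : (realMat t).PosSemidef) {v : Fin n ⊕ Unit → ℤ} (hv : v ≠ 0) :
    ∃ (u : GL (Fin n ⊕ Unit) ℤ) (T : HalfInt n) (r : Fin n → ℤ) (m : ℕ),
      baseChange u t = blockMatrix T.1 r m ∧
      (m : ℝ) ≤ quadForm (realMat t) (castVec ℝ v) := by
  obtain ⟨u, d, rfl⟩ := exists_GL_col_smul_eq v (Sum.inr ())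
  have hd : d ≠ 0 := fun h => hv (by rw [h, zero_smul])
  have h_corner : ((baseChange u t (.inr ()) (.inr ()) : ℚ) : ℝ) =
      quadForm (realMat t) (castVec ℝ (u.val.col (.inr ()))) := by
    rw [← Matrix.mulVec_single_one, ← quadForm_baseChange_castVec, castVec_single,
      quadForm_single, ← realMat_baseChange]
    rfl
  have h_corner_nonneg : 0 ≤ ((baseChange u t (.inr ()) (.inr ()) : ℚ) : ℝ) :=
    h_corner ▸ quadForm_nonneg h_psd _
  obtain ⟨T, r, m, h_block⟩ := (halfIntegral_baseChange ht u).exists_eq_blockMatrix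
    (Rat.cast_nonneg.1 h_corner_nonneg)
  refine ⟨u, T, r, m, h_block, ?_⟩
  have h_smul : castVec ℝ (d • u.val.col (.inr ())) =
      (d : ℝ) • castVec ℝ (u.val.col (.inr ())) := by
    ext j
    simp [castVec]
  have h_index : (m : ℝ) = quadForm (realMat t) (castVec ℝ (u.val.col (.inr ()))) := by
    rw [← h_corner, h_block]
    simp [blockMatrix]
  rw [h_smul, quadForm_smul, ← h_index]
  exact le_mul_of_one_le_left (Nat.cast_nonneg m) (one_le_intCast_sq hd)

end BlockMatrices

section SymmetricCoefficients

variable {n : ℕ} {κ : ℤ} {φ : ℕ → Matrix (Fin n) (Fin n) ℂ → (Fin n → ℂ) → ℂ}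
  {c : Matrix (Fin n ⊕ Unit) (Fin n ⊕ Unit) ℚ → ℂ}

/-- `t ↦ c(f; t)` is the coefficient function of the formal Fourier-Jacobi series
`f = ∑ φ_m q₂^m`, and it has the symmetry of weight `κ / 2` required in `IsSymmetricFormalFJ`. -/
structure HasSymmetricCoefficients (n : ℕ) (κ : ℤ)
    (φ : ℕ → Matrix (Fin n) (Fin n) ℂ → (Fin n → ℂ) → ℂ)
    (c : Matrix (Fin n ⊕ Unit) (Fin n ⊕ Unit) ℚ → ℂ) : Prop where
  expansion : ∀ m, HasJacobiFourierExpansion m (φ m) fun T r => c (blockMatrix T r m)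
  symmetric : ∀ (u : GL (Fin n ⊕ Unit) ℤ) (t : Matrix (Fin n ⊕ Unit) (Fin n ⊕ Unit) ℚ),
    HalfIntegral t → (realMat t).PosSemidef →
      ∀ s : ℂ, s ^ 2 = (u.val.det : ℂ) → c (baseChange u t) = s ^ κ * c t

variable {t : Matrix (Fin n ⊕ Unit) (Fin n ⊕ Unit) ℚ}

theorem HasSymmetricCoefficients.norm_baseChange (hc : HasSymmetricCoefficients n κ φ c)
    (u : GL (Fin n ⊕ Unit) ℤ) (ht : HalfIntegral t) (h_psd : (realMat t).PosSemidef) :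
    ‖c (baseChange u t)‖ = ‖c t‖ := by
  obtain ⟨s, hs⟩ := IsAlgClosed.exists_pow_nat_eq ((u.val.det : ℤ) : ℂ) two_pos
  have h_norm : ‖s‖ = 1 := by
    refine (pow_eq_one_iff_of_nonneg (norm_nonneg s) two_ne_zero).1 ?_
    rw [← norm_pow, hs, Complex.norm_intCast]
    exact_mod_cast Int.isUnit_iff_abs_eq.1 ((Matrix.isUnit_iff_isUnit_det _).1 u.isUnit)
  rw [hc.symmetric u t ht h_psd s hs, norm_mul, norm_zpow, h_norm, one_zpow, one_mul]

theorem HasSymmetricCoefficients.eq_zero_of_not_posDef (hc : HasSymmetricCoefficients n κ φ c)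
    (h_cusp : IsCuspidal φ) (ht : HalfIntegral t) (h_psd : (realMat t).PosSemidef)
    (h_pd : ¬ (realMat t).PosDef) : c t = 0 := by
  obtain ⟨v, hv, hv_zero⟩ := ht.exists_quadForm_eq_zero h_psd h_pd
  obtain ⟨u, T, r, m, h_block, hm⟩ := ht.exists_baseChange_eq_blockMatrix h_psd hv
  obtain rfl : m = 0 := by
    rw [hv_zero] at hm
    exact_mod_cast hm.antisymm (Nat.cast_nonneg m)
  have h_coeff := (hc.expansion 0).norm_coeff_le (y := 1) Matrix.PosDef.one 0 (B := 0)
    (fun τ hτ _ z _ => by rw [h_cusp τ hτ z, norm_zero]) T r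
  rwa [zero_mul, ← h_block, hc.norm_baseChange u ht h_psd, norm_le_zero_iff] at h_coeff

theorem HasSymmetricCoefficients.posDef_of_coeff_ne_zero (hc : HasSymmetricCoefficients n κ φ c)
    (h_cusp : IsCuspidal φ) {m : ℕ} {p : HalfInt n × (Fin n → ℤ)}
    (h_ne : c (blockMatrix p.1.1 p.2 m) ≠ 0) : (realMat (blockMatrix p.1.1 p.2 m)).PosDef := by
  by_contra h_pd
  exact h_ne (hc.eq_zero_of_not_posDef h_cusp (halfIntegral_blockMatrix p.1 p.2 m)
    ((hc.expansion m).1 p.1 p.2 h_ne) h_pd)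

end SymmetricCoefficients

section SpecializedMatrix

variable {n : ℕ} {K L : Type*} [Field K] [Field L]

/-- The matrix of the quadratic form `x ↦ Q (x, l · x)`, where `Q` is the form with matrix
`(T, r/2; rᵀ/2, m)`. It is the exponent of the term of index `(T, r)` of a Jacobi form of index `m`
after the specialization at `z = τ l + u`. -/
def specializedMatrix (T : Matrix (Fin n) (Fin n) K) (r l : Fin n → K) (m : K) :
    Matrix (Fin n) (Fin n) K :=
  T + (2 : K)⁻¹ • (Matrix.vecMulVec r l + Matrix.vecMulVec l r) + m • Matrix.vecMulVec l l

theorem specializedMatrix_zero (T : Matrix (Fin n) (Fin n) K) (r : Fin n → K) (m : K) :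
    specializedMatrix T r 0 m = T := by
  simp [specializedMatrix]

theorem specializedMatrix_isSymm {T : Matrix (Fin n) (Fin n) K} (hT : T.IsSymm) (r l : Fin n → K)
    (m : K) : (specializedMatrix T r l m).IsSymm := by
  rw [Matrix.IsSymm, specializedMatrix, Matrix.transpose_add, Matrix.transpose_add,
    Matrix.transpose_smul, Matrix.transpose_smul, Matrix.transpose_add, hT.eq,
    Matrix.transpose_vecMulVec, Matrix.transpose_vecMulVec, Matrix.transpose_vecMulVec,
    add_comm (Matrix.vecMulVec l r)]

theorem map_specializedMatrix (f : K →+* L) (T : Matrix (Fin n) (Fin n) K) (r l : Fin n → K)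
    (m : K) :
    (specializedMatrix T r l m).map f = specializedMatrix (T.map f) (f ∘ r) (f ∘ l) (f m) := by
  ext i j
  simp [specializedMatrix, Matrix.vecMulVec_apply, map_ofNat f 2]

theorem smul_specializedMatrix {a : K} (ha : a ≠ 0) (T : Matrix (Fin n) (Fin n) K)
    (r l : Fin n → K) (m : K) :
    a ^ 2 • specializedMatrix T r (a⁻¹ • l) m = specializedMatrix (a ^ 2 • T) (a • r) l m := by
  ext i j
  simp only [specializedMatrix, Matrix.vecMulVec_apply, Matrix.add_apply, Matrix.smul_apply,
    Pi.smul_apply, smul_eq_mul]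
  field_simp

theorem specializedMatrix_apply_self [NeZero (2 : K)] (T : Matrix (Fin n) (Fin n) K)
    (r l : Fin n → K) (m : K) (i : Fin n) :
    specializedMatrix T r l m i i = T i i + r i * l i + m * l i ^ 2 := by
  have h_two : (2 : K) ≠ 0 := NeZero.ne 2
  simp only [specializedMatrix, Matrix.vecMulVec_apply, Matrix.add_apply, Matrix.smul_apply,
    smul_eq_mul]
  field_simp
  ring

theorem trace_specializedMatrix_mul [NeZero (2 : K)] (T : Matrix (Fin n) (Fin n) K)
    (r l : Fin n → K) (m : K) {y : Matrix (Fin n) (Fin n) K} (hy : y.IsSymm) :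
    (specializedMatrix T r l m * y).trace =
      (T * y).trace + r ⬝ᵥ (y *ᵥ l) + m * (l ⬝ᵥ (y *ᵥ l)) := by
  have h_two : (2 : K) ≠ 0 := NeZero.ne 2
  have h_vecMul : ∀ v, v ᵥ* y = y *ᵥ v := fun v => by rw [← Matrix.mulVec_transpose, hy.eq]
  have h_comm : l ⬝ᵥ (y *ᵥ r) = r ⬝ᵥ (y *ᵥ l) := dotProduct_mulVec_comm_of_isSymm hy l r
  simp only [specializedMatrix, Matrix.add_mul, Matrix.smul_mul, Matrix.vecMulVec_mul,
    Matrix.trace_add, Matrix.trace_smul, Matrix.trace_vecMulVec, smul_eq_mul, h_vecMul, h_comm]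
  field_simp
  ring

end SpecializedMatrix

section Expansion

variable {n m : ℕ}

/-- The exponent, as a real matrix, of the term of index `p = (T, r)` of a Jacobi form of index `m`
after the specialization at `z = τ l + u`. -/
noncomputable def realExponent (l : Fin n → ℝ) (m : ℕ) (p : HalfInt n × (Fin n → ℤ)) :
    Matrix (Fin n) (Fin n) ℝ :=
  specializedMatrix (realMat p.1.1) (castVec ℝ p.2) l m

theorem quadForm_realExponent (l : Fin n → ℝ) (m : ℕ) (p : HalfInt n × (Fin n → ℤ))
    (x : Fin n → ℝ) :
    quadForm (realExponent l m p) x =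
      quadForm (realMat (blockMatrix p.1.1 p.2 m)) (Sum.elim x fun _ => l ⬝ᵥ x) := by
  rw [quadForm_blockMatrix]
  simp only [quadForm, realExponent, specializedMatrix, Matrix.add_mulVec, Matrix.smul_mulVec,
    Matrix.vecMulVec_mulVec, dotProduct_add, dotProduct_smul, smul_eq_mul, op_smul_eq_smul,
    dotProduct_comm x (castVec ℝ p.2), dotProduct_comm x l]
  ring

theorem posDef_realExponent (l : Fin n → ℝ) {p : HalfInt n × (Fin n → ℤ)}
    (h_pd : (realMat (blockMatrix p.1.1 p.2 m)).PosDef) : (realExponent l m p).PosDef := by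
  refine Matrix.PosDef.of_dotProduct_mulVec_pos ?_ fun x hx => ?_
  · rw [Matrix.IsHermitian, Matrix.conjTranspose_eq_transpose_of_trivial]
    exact specializedMatrix_isSymm (by rw [Matrix.IsSymm, ← Matrix.transpose_map, p.1.2.1.eq]) _ _ _
  · have h_ne : (Sum.elim x fun _ => l ⬝ᵥ x : Fin n ⊕ Unit → ℝ) ≠ 0 := fun h =>
      hx (funext fun i => congrFun h (Sum.inl i))
    exact (quadForm_pos h_pd h_ne).trans_eq (quadForm_realExponent l m p x).symm

theorem complexMat_realExponent (l : Fin n → ℝ) (m : ℕ) (p : HalfInt n × (Fin n → ℤ)) :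
    complexMat (realExponent l m p) =
      specializedMatrix (complexMat (realMat p.1.1)) (castVec ℂ p.2) (complexVec l) m := by
  refine (map_specializedMatrix Complex.ofRealHom (realMat p.1.1) (castVec ℝ p.2) l m).trans ?_
  rw [map_natCast]
  rfl

theorem HasJacobiFourierExpansion.hasSum_specialization
    {φ : Matrix (Fin n) (Fin n) ℂ → (Fin n → ℂ) → ℂ}
    {c : Matrix (Fin n) (Fin n) ℚ → (Fin n → ℤ) → ℂ} (hc : HasJacobiFourierExpansion m φ c)
    {τ : Matrix (Fin n) (Fin n) ℂ} (hτ : τ ∈ siegelUpperHalfSpace n) (l u : Fin n → ℝ) :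
    HasSum (fun p : HalfInt n × (Fin n → ℤ) =>
      c p.1.1 p.2 * e (castVec ℂ p.2 ⬝ᵥ complexVec u) *
        e (complexMat (realExponent l m p) * τ).trace)
      (specialization m φ (complexVec l) (complexVec u) τ) := by
  refine ((hc.2 τ hτ (τ *ᵥ complexVec l + complexVec u)).mul_left
    (e (m * (complexVec l ⬝ᵥ (τ *ᵥ complexVec l))))).congr_fun fun p => ?_
  rw [complexMat_realExponent, trace_specializedMatrix_mul _ _ _ _ hτ.1, ← traceMul_eq]
  simp only [dotProduct_add, e_add]
  ring

end Expansion

section TorsionExpansion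

variable {n : ℕ}

/-- The point `A / N` of the lattice `(1/N) ℤⁿ`. -/
noncomputable def torsionVec (N : ℕ) (A : Fin n → ℤ) : Fin n → ℝ := (N : ℝ)⁻¹ • castVec ℝ A

theorem InTorsionLattice.exists_eq_torsionVec {N : ℕ} (hN : 0 < N) {v : Fin n → ℚ}
    (hv : InTorsionLattice N v) :
    ∃ A : Fin n → ℤ, (fun i => (v i : ℂ)) = complexVec (torsionVec N A) := by
  choose A hA using hv
  have hN' : (N : ℂ) ≠ 0 := Nat.cast_ne_zero.2 hN.ne'
  refine ⟨A, funext fun i => ?_⟩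
  have h_cast : (N : ℂ) * v i = A i := by exact_mod_cast congrArg (Rat.cast : ℚ → ℂ) (hA i)
  change (v i : ℂ) = (((N : ℝ)⁻¹ * (A i : ℝ) : ℝ) : ℂ)
  push_cast
  rw [← h_cast, inv_mul_cancel_left₀ hN']

theorem halfIntegral_specializedMatrix (N : ℕ) (A : Fin n → ℤ) (m : ℕ)
    (p : HalfInt n × (Fin n → ℤ)) :
    HalfIntegral (specializedMatrix ((N : ℚ) ^ 2 • p.1.1) ((N : ℚ) • castVec ℚ p.2) (castVec ℚ A)
      m) := by
  obtain ⟨h_symm, h_diag, h_entry⟩ := p.1.2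
  refine ⟨specializedMatrix_isSymm (h_symm.smul _) _ _ _, fun i => ?_, fun i j => ?_⟩
  · obtain ⟨a, ha⟩ := h_diag i
    refine ⟨N ^ 2 * a + N * p.2 i * A i + m * A i ^ 2, ?_⟩
    rw [specializedMatrix_apply_self, Matrix.smul_apply, ha]
    simp
  · obtain ⟨a, ha⟩ := h_entry i j
    refine ⟨N ^ 2 * a + N * (p.2 i * A j + A i * p.2 j) + 2 * (m * (A i * A j)), ?_⟩
    simp only [specializedMatrix, Matrix.add_apply, Matrix.smul_apply, Matrix.vecMulVec_apply,
      Pi.smul_apply, smul_eq_mul]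
    push_cast
    linear_combination (N : ℚ) ^ 2 * ha

/-- `N²` times the exponent of the term of index `p = (T, r)` of a Jacobi form of index `m` after
the specialization at `z = τ (A / N) + u`. -/
def torsionExponent (N : ℕ) (A : Fin n → ℤ) (m : ℕ) (p : HalfInt n × (Fin n → ℤ)) : HalfInt n :=
  ⟨_, halfIntegral_specializedMatrix N A m p⟩

theorem realMat_torsionExponent {N : ℕ} (hN : 0 < N) (A : Fin n → ℤ) (m : ℕ)
    (p : HalfInt n × (Fin n → ℤ)) :
    realMat (torsionExponent N A m p).1 = (N : ℝ) ^ 2 • realExponent (torsionVec N A) m p := by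
  rw [realExponent, torsionVec, smul_specializedMatrix (Nat.cast_ne_zero.2 hN.ne')]
  refine (map_specializedMatrix (Rat.castHom ℝ) ((N : ℚ) ^ 2 • p.1.1) ((N : ℚ) • castVec ℚ p.2)
    (castVec ℚ A) m).trans ?_
  rw [map_natCast]
  congr 1 <;> ext <;> simp

/-- The Fourier coefficients of the specialization at `z = τ (A / N) + U / N` of the Jacobi form of
index `m` with coefficients `c`, as a function with period lattice `N²` times the standard one. -/
noncomputable def torsionCoeff (N : ℕ) (c : Matrix (Fin n) (Fin n) ℚ → (Fin n → ℤ) → ℂ)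
    (A U : Fin n → ℤ) (m : ℕ) (t : HalfInt n) : ℂ :=
  ∑' p : torsionExponent N A m ⁻¹' {t},
    c p.1.1.1 p.1.2 * e (castVec ℂ p.1.2 ⬝ᵥ complexVec (torsionVec N U))

theorem HasJacobiFourierExpansion.hasSum_torsionCoeff {N : ℕ} (hN : 0 < N) {m : ℕ}
    {φ : Matrix (Fin n) (Fin n) ℂ → (Fin n → ℂ) → ℂ}
    {c : Matrix (Fin n) (Fin n) ℚ → (Fin n → ℤ) → ℂ} (hc : HasJacobiFourierExpansion m φ c)
    {τ : Matrix (Fin n) (Fin n) ℂ} (hτ : τ ∈ siegelUpperHalfSpace n) (A U : Fin n → ℤ) :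
    HasSum (fun t : HalfInt n => torsionCoeff N c A U m t * e (traceMul t.1 τ / (N ^ 2 : ℕ)))
      (specialization m φ (complexVec (torsionVec N A)) (complexVec (torsionVec N U)) τ) := by
  have hN' : (N : ℂ) ≠ 0 := Nat.cast_ne_zero.2 hN.ne'
  have h_exp : ∀ p, (complexMat (realExponent (torsionVec N A) m p) * τ).trace =
      traceMul (torsionExponent N A m p).1 τ / (N ^ 2 : ℕ) := fun p => by
    have h_smul : complexMat ((N : ℝ) ^ 2 • realExponent (torsionVec N A) m p) =
        (N : ℂ) ^ 2 • complexMat (realExponent (torsionVec N A) m p) := by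
      ext
      simp
    rw [traceMul_eq, realMat_torsionExponent hN, h_smul, Matrix.smul_mul, Matrix.trace_smul,
      smul_eq_mul, Nat.cast_pow, mul_div_cancel_left₀ _ (pow_ne_zero 2 hN')]
  refine ((hc.hasSum_specialization hτ (torsionVec N A) (torsionVec N U)).tsum_fiberwise
    (torsionExponent N A m)).congr_fun fun t => ?_
  rw [torsionCoeff, ← tsum_mul_right]
  refine tsum_congr fun p => ?_
  rw [h_exp, p.2]

theorem HasSymmetricCoefficients.posDef_of_torsionCoeff_ne_zero {κ : ℤ}
    {φ : ℕ → Matrix (Fin n) (Fin n) ℂ → (Fin n → ℂ) → ℂ}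
    {c : Matrix (Fin n ⊕ Unit) (Fin n ⊕ Unit) ℚ → ℂ} (hc : HasSymmetricCoefficients n κ φ c)
    (h_cusp : IsCuspidal φ) {N : ℕ} (hN : 0 < N) {A U : Fin n → ℤ} {m : ℕ} {t : HalfInt n}
    (h_ne : torsionCoeff N (fun T r => c (blockMatrix T r m)) A U m t ≠ 0) :
    (realMat t.1).PosDef := by
  obtain ⟨⟨p, rfl⟩, hp⟩ : ∃ p : torsionExponent N A m ⁻¹' {t},
      c (blockMatrix p.1.1.1 p.1.2 m) ≠ 0 := by
    by_contra! h
    exact h_ne (by simp [torsionCoeff, h])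
  rw [realMat_torsionExponent hN]
  exact (posDef_realExponent _ (hc.posDef_of_coeff_ne_zero h_cusp hp)).smul (by positivity)

end TorsionExpansion

section TorsionSlash

variable {n m N : ℕ} {κ : ℤ} {φ : Matrix (Fin n) (Fin n) ℂ → (Fin n → ℂ) → ℂ}
  {τ : Matrix (Fin n) (Fin n) ℂ}

theorem slash_specialization (hφ : IsJacobiForm n κ m φ) (g : Mp n)
    (hτ : τ ∈ siegelUpperHalfSpace n) (l u : Fin n → ℂ) :
    slash κ (specialization m φ l u) g τ =
      e (m * (actFst g.γ l u ⬝ᵥ actSnd g.γ l u - l ⬝ᵥ u)) *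
        specialization m φ (actFst g.γ l u) (actSnd g.γ l u) τ := by
  rw [slash, specialization_moebius hφ g hτ, mul_assoc (g.ω τ ^ κ), ← mul_assoc,
    ← zpow_add₀ (omega_ne_zero g hτ), neg_add_cancel, zpow_zero, one_mul]

theorem complexVec_torsionVec (N : ℕ) (A : Fin n → ℤ) :
    complexVec (torsionVec N A) = (N : ℂ)⁻¹ • castVec ℂ A := by
  ext i
  change (((N : ℝ)⁻¹ * (A i : ℝ) : ℝ) : ℂ) = (N : ℂ)⁻¹ * A i
  push_cast
  rfl

theorem complexVec_torsionVec_actFst (γ : Matrix (Fin n ⊕ Fin n) (Fin n ⊕ Fin n) ℤ)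
    (A U : Fin n → ℤ) :
    complexVec (torsionVec N (actFst γ A U)) =
      actFst γ (complexVec (torsionVec N A)) (complexVec (torsionVec N U)) := by
  have h_cast : castVec ℂ (actFst γ A U) = actFst γ (castVec ℂ A) (castVec ℂ U) :=
    map_actFst (Int.castRingHom ℂ) γ A U
  rw [complexVec_torsionVec, h_cast, actFst_eq, actFst_eq, complexVec_torsionVec,
    complexVec_torsionVec, Matrix.mulVec_smul, Matrix.mulVec_smul, smul_add]

theorem complexVec_torsionVec_actSnd (γ : Matrix (Fin n ⊕ Fin n) (Fin n ⊕ Fin n) ℤ)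
    (A U : Fin n → ℤ) :
    complexVec (torsionVec N (actSnd γ A U)) =
      actSnd γ (complexVec (torsionVec N A)) (complexVec (torsionVec N U)) := by
  have h_cast : castVec ℂ (actSnd γ A U) = actSnd γ (castVec ℂ A) (castVec ℂ U) :=
    map_actSnd (Int.castRingHom ℂ) γ A U
  rw [complexVec_torsionVec, h_cast, actSnd_eq, actSnd_eq, complexVec_torsionVec,
    complexVec_torsionVec, Matrix.mulVec_smul, Matrix.mulVec_smul, smul_add]

theorem complexVec_torsionVec_add_sq_smul (hN : 0 < N) (A B : Fin n → ℤ) :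
    complexVec (torsionVec N (A + ((N ^ 2 : ℕ) : ℤ) • B)) =
      complexVec (torsionVec N A) + castVec ℂ ((N : ℤ) • B) := by
  have hN' : (N : ℂ) ≠ 0 := Nat.cast_ne_zero.2 hN.ne'
  simp only [complexVec_torsionVec]
  ext i
  simp only [Pi.smul_apply, Pi.add_apply, smul_eq_mul, castVec]
  push_cast
  field_simp

theorem castVec_smul_dotProduct_torsionVec (hN : 0 < N) (B A : Fin n → ℤ) :
    castVec ℂ ((N : ℤ) • B) ⬝ᵥ complexVec (torsionVec N A) = ((B ⬝ᵥ A : ℤ) : ℂ) := by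
  have hN' : (N : ℂ) ≠ 0 := Nat.cast_ne_zero.2 hN.ne'
  have h_smul : castVec ℂ ((N : ℤ) • B) = (N : ℂ) • castVec ℂ B := by
    ext
    simp only [castVec, Pi.smul_apply, smul_eq_mul, Int.cast_mul, Int.cast_natCast]
  rw [complexVec_torsionVec, h_smul, smul_dotProduct, dotProduct_smul,
    smul_inv_smul₀ hN']
  simp [dotProduct]

theorem exists_eq_add_smul_of_intCast_eq {M : ℕ} {V W : Fin n → ℤ}
    (h : castVec (ZMod M) V = castVec (ZMod M) W) : ∃ B : Fin n → ℤ, V = W + (M : ℤ) • B := by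
  choose B hB using fun i => (ZMod.intCast_eq_intCast_iff_dvd_sub _ _ _).1 (congrFun h i).symm
  refine ⟨B, funext fun i => ?_⟩
  simp only [Pi.add_apply, Pi.smul_apply, smul_eq_mul]
  linarith [hB i]

theorem exists_act_eq_add_smul_of_mem_principalCongruence {M : ℕ} {g : Mp n}
    (hg : g ∈ principalCongruence n M) (A U : Fin n → ℤ) :
    ∃ B V : Fin n → ℤ, actFst g.γ A U = A + (M : ℤ) • B ∧ actSnd g.γ A U = U + (M : ℤ) • V := by
  have h_one : castMat (ZMod M) g.γ = 1 := hg
  have h_fst : castVec (ZMod M) (actFst g.γ A U) = castVec (ZMod M) A :=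
    (map_actFst (Int.castRingHom (ZMod M)) g.γ A U).trans (by ext i; simp [actFst, h_one])
  have h_snd : castVec (ZMod M) (actSnd g.γ A U) = castVec (ZMod M) U :=
    (map_actSnd (Int.castRingHom (ZMod M)) g.γ A U).trans (by ext i; simp [actSnd, h_one])
  obtain ⟨B, hB⟩ := exists_eq_add_smul_of_intCast_eq h_fst
  obtain ⟨V, hV⟩ := exists_eq_add_smul_of_intCast_eq h_snd
  exact ⟨B, V, hB, hV⟩

theorem slash_specialization_torsionVec_of_mem_principalCongruence (hφ : IsJacobiForm n κ m φ)
    (hN : 0 < N) (A U : Fin n → ℤ) {g : Mp n} (hg : g ∈ principalCongruence n (N ^ 2))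
    (hτ : τ ∈ siegelUpperHalfSpace n) :
    slash κ (specialization m φ (complexVec (torsionVec N A)) (complexVec (torsionVec N U))) g τ =
      specialization m φ (complexVec (torsionVec N A)) (complexVec (torsionVec N U)) τ := by
  obtain ⟨B, V, hB, hV⟩ := exists_act_eq_add_smul_of_mem_principalCongruence hg A U
  rw [slash_specialization hφ g hτ, ← complexVec_torsionVec_actFst, ← complexVec_torsionVec_actSnd,
    hB, hV, complexVec_torsionVec_add_sq_smul hN, complexVec_torsionVec_add_sq_smul hN,
    specialization_add_intCast hφ hτ, ← mul_assoc, ← e_add]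
  have h_cross : castVec ℂ ((N : ℤ) • B) ⬝ᵥ castVec ℂ ((N : ℤ) • V) =
      ((N ^ 2 * (B ⬝ᵥ V) : ℤ) : ℂ) := by
    simp only [dotProduct, castVec, Pi.smul_apply, smul_eq_mul]
    push_cast
    rw [Finset.mul_sum]
    exact Finset.sum_congr rfl fun i _ => by ring
  have h_phase : (m : ℂ) * ((complexVec (torsionVec N A) + castVec ℂ ((N : ℤ) • B)) ⬝ᵥ
      (complexVec (torsionVec N U) + castVec ℂ ((N : ℤ) • V)) -
        complexVec (torsionVec N A) ⬝ᵥ complexVec (torsionVec N U)) +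
      -(2 * m * (castVec ℂ ((N : ℤ) • B) ⬝ᵥ complexVec (torsionVec N U))) =
      ((m * (B ⬝ᵥ U + V ⬝ᵥ A + N ^ 2 * (B ⬝ᵥ V)) - 2 * m * (B ⬝ᵥ U) : ℤ) : ℂ) := by
    rw [add_dotProduct, dotProduct_add, dotProduct_add, h_cross,
      dotProduct_comm (complexVec (torsionVec N A)) (castVec ℂ _),
      castVec_smul_dotProduct_torsionVec hN, castVec_smul_dotProduct_torsionVec hN]
    push_cast
    ring
  rw [h_phase, e_intCast, one_mul]

end TorsionSlash

section CuspForm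

variable {n m : ℕ} {κ : ℤ}

theorem differentiableOn_specialization {φ : Matrix (Fin n) (Fin n) ℂ → (Fin n → ℂ) → ℂ}
    (hφ : IsJacobiForm n κ m φ) (l u : Fin n → ℂ) :
    DifferentiableOn ℂ (specialization m φ l u) (siegelUpperHalfSpace n) := by
  -- `fun_prop` sees the coordinates only when matrices are written as functions of two indices.
  suffices h : ∀ (S : Set (Fin n → Fin n → ℂ)) (ψ : (Fin n → Fin n → ℂ) → (Fin n → ℂ) → ℂ),
      DifferentiableOn ℂ (fun p : (Fin n → Fin n → ℂ) × (Fin n → ℂ) => ψ p.1 p.2)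
        (S ×ˢ Set.univ) →
      DifferentiableOn ℂ (fun τ : Fin n → Fin n → ℂ =>
        e (m * ∑ i, l i * ∑ j, τ i j * l j) * ψ τ (fun i => (∑ j, τ i j * l j) + u i)) S from
    h _ φ hφ.holo
  intro S ψ hψ
  refine DifferentiableOn.mul (by unfold e; fun_prop) ?_
  have h_arg : DifferentiableOn ℂ (fun τ : Fin n → Fin n → ℂ =>
      (τ, fun i => (∑ j, τ i j * l j) + u i)) S := by
    fun_prop
  exact hψ.comp h_arg fun τ hτ => ⟨hτ, Set.mem_univ _⟩

theorem isSiegelCuspForm_specialization {φ : ℕ → Matrix (Fin n) (Fin n) ℂ → (Fin n → ℂ) → ℂ}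
    {c : Matrix (Fin n ⊕ Unit) (Fin n ⊕ Unit) ℚ → ℂ} (hφ : IsJacobiForm n κ m (φ m))
    (hc : HasSymmetricCoefficients n κ φ c) (h_cusp : IsCuspidal φ) {N : ℕ} (hN : 0 < N)
    (A U : Fin n → ℤ) :
    IsSiegelCuspForm n κ (N ^ 2)
      (specialization m (φ m) (complexVec (torsionVec N A)) (complexVec (torsionVec N U))) := by
  refine ⟨differentiableOn_specialization hφ _ _, fun g hg τ hτ =>
    slash_specialization_torsionVec_of_mem_principalCongruence hφ hN A U hg hτ, fun g => ?_⟩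
  set l := complexVec (torsionVec N A)
  set u := complexVec (torsionVec N U)
  refine ⟨fun t => e (m * (actFst g.γ l u ⬝ᵥ actSnd g.γ l u - l ⬝ᵥ u)) *
    torsionCoeff N (fun T r => c (blockMatrix T r m)) (actFst g.γ A U) (actSnd g.γ A U) m t,
    fun t ht => hc.posDef_of_torsionCoeff_ne_zero h_cusp hN (right_ne_zero_of_mul ht),
    fun τ hτ => ?_⟩
  rw [slash_specialization hφ g hτ, ← complexVec_torsionVec_actFst, ← complexVec_torsionVec_actSnd]
  exact (((hc.expansion m).hasSum_torsionCoeff hN hτ _ _).mul_left _).congr_fun fun t =>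
    mul_assoc _ _ _

end CuspForm

section Growth

variable {n : ℕ}

theorem trace_mul_nonneg_of_posSemidef {P Q : Matrix (Fin n) (Fin n) ℝ} (hP : P.PosSemidef)
    (hQ : ∀ x, 0 ≤ quadForm Q x) : 0 ≤ (P * Q).trace := by
  obtain ⟨k, a, rfl⟩ := Matrix.posSemidef_iff_eq_sum_vecMulVec.1 hP
  rw [Matrix.sum_mul, Matrix.trace_sum]
  refine Finset.sum_nonneg fun i _ => ?_
  rw [Matrix.trace_mul_comm, Matrix.mul_vecMulVec, Matrix.trace_vecMulVec, dotProduct_comm]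
  exact hQ (a i)

theorem quadForm_sub_diagonal (y : Matrix (Fin n) (Fin n) ℝ) (d x : Fin n → ℝ) :
    quadForm (y - Matrix.diagonal d) x = quadForm y x - ∑ i, d i * x i ^ 2 := by
  simp only [quadForm, Matrix.sub_mulVec, dotProduct_sub]
  congr 1
  simp only [dotProduct, Matrix.mulVec_diagonal]
  exact Finset.sum_congr rfl fun i _ => by ring

theorem DominatesDiag.mul_sum_le_trace_mul {P y : Matrix (Fin n) (Fin n) ℝ} (hP : P.PosSemidef)
    {c : ℝ} (hy : DominatesDiag c y) : c * ∑ i, P i i * y i i ≤ (P * y).trace := by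
  have h_nonneg : 0 ≤ (P * (y - Matrix.diagonal fun i => c * y i i)).trace := by
    refine trace_mul_nonneg_of_posSemidef hP fun x => ?_
    rw [quadForm_sub_diagonal, sub_nonneg]
    simpa only [mul_assoc, ← Finset.mul_sum] using hy x
  have h_diag : (P * Matrix.diagonal fun i => c * y i i).trace = c * ∑ i, P i i * y i i := by
    simp only [Matrix.trace, Matrix.diag_apply, Matrix.mul_diagonal, Finset.mul_sum]
    exact Finset.sum_congr rfl fun i _ => mul_left_comm _ _ _
  rwa [Matrix.mul_sub, Matrix.trace_sub, h_diag, sub_nonneg] at h_nonneg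

theorem det_le_factorial_mul_trace_pow {P : Matrix (Fin n) (Fin n) ℝ} (hP : P.PosSemidef) :
    P.det ≤ n.factorial * P.trace ^ n := by
  have h_diag : ∀ i, P i i ≤ P.trace := fun i =>
    Finset.single_le_sum (f := fun i => P i i) (fun _ _ => hP.diag_nonneg) (Finset.mem_univ i)
  have h_entry : ∀ i j, AbsoluteValue.abs (P i j) ≤ P.trace := fun i j =>
    (abs_apply_le_of_posSemidef hP i j).trans (by linarith [h_diag i, h_diag j])
  have h_det := Matrix.det_le h_entry
  rw [Fintype.card_fin, nsmul_eq_mul] at h_det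
  exact (le_abs_self _).trans h_det

theorem exists_det_rpow_le_exp_of_nonneg {s a : ℝ} (hs : 0 ≤ s) (ha : 0 < a) :
    ∃ K > 0, ∀ y : Matrix (Fin n) (Fin n) ℝ, y.PosSemidef →
      y.det ^ s ≤ K * Real.exp (a * y.trace) := by
  set b := a / (n * s + 1) with hb
  have hb_pos : 0 < b := by positivity
  refine ⟨(n.factorial * b⁻¹ ^ n : ℝ) ^ s, by positivity, fun y hy => ?_⟩
  have h_trace : 0 ≤ y.trace := hy.trace_nonneg
  have h_le_exp : y.trace ≤ b⁻¹ * Real.exp (b * y.trace) := by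
    rw [le_inv_mul_iff₀ hb_pos]
    linarith [Real.add_one_le_exp (b * y.trace)]
  have h_exponent : b * n * s ≤ a := by
    rw [hb, mul_assoc, div_mul_eq_mul_div, div_le_iff₀ (by positivity)]
    linarith
  calc y.det ^ s ≤ (n.factorial * (b⁻¹ * Real.exp (b * y.trace)) ^ n) ^ s := by
        refine Real.rpow_le_rpow hy.det_nonneg ?_ hs
        exact (det_le_factorial_mul_trace_pow hy).trans (by gcongr)
    _ = (n.factorial * b⁻¹ ^ n : ℝ) ^ s * Real.exp (b * n * s * y.trace) := by
        rw [mul_pow, ← mul_assoc, Real.mul_rpow (by positivity) (by positivity), ← Real.exp_nat_mul,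
          ← Real.exp_mul]
        congr 2
        ring
    _ ≤ _ := by gcongr

theorem exists_det_rpow_le_exp (s : ℝ) {a c : ℝ} (ha : 0 < a) (hc : 0 < c) :
    ∃ K > 0, ∀ τ ∈ siegelSet n c,
      (τ.map Complex.im).det ^ s ≤ K * Real.exp (a * (τ.map Complex.im).trace) := by
  rcases le_total 0 s with hs | hs
  · obtain ⟨K, hK, h⟩ := exists_det_rpow_le_exp_of_nonneg (n := n) hs ha
    exact ⟨K, hK, fun τ hτ => h _ hτ.1.2.posSemidef⟩
  · refine ⟨((c * (1 / 2)) ^ n / n.factorial) ^ s, by positivity, fun τ hτ => ?_⟩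
    obtain ⟨⟨-, hy⟩, h_dom, h_diag⟩ := hτ
    have h_det : (c * (1 / 2)) ^ n / n.factorial ≤ (τ.map Complex.im).det := by
      have h_det := det_ge_of_mul_norm_sq_le_quadForm hy (by positivity)
        (h_dom.mul_norm_sq_le hc.le one_half_pos.le h_diag)
      rwa [Fintype.card_fin] at h_det
    have h_trace : 0 ≤ (τ.map Complex.im).trace := hy.posSemidef.trace_nonneg
    exact (Real.rpow_le_rpow_of_nonpos (by positivity) h_det hs).trans
      (le_mul_of_one_le_right (by positivity) (Real.one_le_exp (by positivity)))

end Growth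

section ExponentBounds

variable {n m : ℕ}

theorem quadForm_blockMatrix_single (T : Matrix (Fin n) (Fin n) ℚ) (r : Fin n → ℤ) (m : ℕ)
    (i : Fin n) (a s : ℝ) :
    quadForm (realMat (blockMatrix T r m)) (Sum.elim (Pi.single i a) fun _ => s) =
      a ^ 2 * realMat T i i + a * s * r i + m * s ^ 2 := by
  rw [quadForm_blockMatrix, dotProduct_single]
  simp [quadForm]
  ring

theorem realExponent_apply_self (l : Fin n → ℝ) (m : ℕ) (p : HalfInt n × (Fin n → ℤ))
    (i : Fin n) :
    realExponent l m p i i = realMat p.1.1 i i + p.2 i * l i + m * l i ^ 2 :=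
  specializedMatrix_apply_self _ _ _ _ _

theorem inv_four_mul_le_realExponent_apply_self (hm : 0 < m) {p : HalfInt n × (Fin n → ℤ)}
    (h_pd : (realMat (blockMatrix p.1.1 p.2 m)).PosDef) (l : Fin n → ℝ) (i : Fin n) :
    1 / (4 * m) ≤ realExponent l m p i i := by
  have hm' : (0 : ℝ) < m := Nat.cast_pos.2 hm
  have h_ne : (Sum.elim (Pi.single i (2 * m : ℝ)) fun _ => -(p.2 i : ℝ) : Fin n ⊕ Unit → ℝ) ≠ 0 :=
    fun h => by simpa [hm.ne'] using congrFun h (Sum.inl i)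
  have h_pos := quadForm_pos h_pd h_ne
  obtain ⟨a, ha⟩ := p.1.2.2.1 i
  have ha' : realMat p.1.1 i i = a := (congrArg (Rat.cast : ℚ → ℝ) ha).trans (Rat.cast_intCast a)
  rw [quadForm_blockMatrix_single, ha'] at h_pos
  have h_disc : (0 : ℝ) < ((4 * m * a - p.2 i ^ 2 : ℤ) : ℝ) := by
    push_cast
    exact pos_of_mul_pos_right (a := (m : ℝ)) (by linarith) hm'.le
  have h_one_le : (1 : ℝ) ≤ ((4 * m * a - p.2 i ^ 2 : ℤ) : ℝ) :=
    mod_cast Int.cast_pos.1 h_disc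
  push_cast at h_one_le
  rw [realExponent_apply_self, ha', div_le_iff₀ (by positivity)]
  nlinarith [sq_nonneg ((p.2 i : ℝ) + 2 * m * l i)]

theorem half_sub_le_realExponent_apply_self {p : HalfInt n × (Fin n → ℤ)}
    (h_psd : (realMat (blockMatrix p.1.1 p.2 m)).PosSemidef) {l : Fin n → ℝ} {i : Fin n}
    (hl : |l i| ≤ 1) :
    realMat p.1.1 i i / 2 - 2 * m ≤ realExponent l m p i i := by
  have h_pos := quadForm_nonneg h_psd (Sum.elim (Pi.single i 1) fun _ => 2)
  have h_neg := quadForm_nonneg h_psd (Sum.elim (Pi.single i 1) fun _ => -2)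
  rw [quadForm_blockMatrix_single] at h_pos h_neg
  have hr : |(p.2 i : ℝ)| ≤ realMat p.1.1 i i / 2 + 2 * m := by
    rw [abs_le]
    constructor <;> linarith
  have h_cross : |(p.2 i : ℝ) * l i| ≤ realMat p.1.1 i i / 2 + 2 * m := by
    rw [abs_mul]
    exact (mul_le_of_le_one_right (abs_nonneg _) hl).trans hr
  have h_square : (0 : ℝ) ≤ m * l i ^ 2 := by positivity
  rw [realExponent_apply_self]
  linarith [(abs_le.1 h_cross).1]

end ExponentBounds

section FixedIndex

variable {n m : ℕ} {κ : ℤ}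

theorem norm_e_trace (s : Matrix (Fin n) (Fin n) ℝ) (τ : Matrix (Fin n) (Fin n) ℂ) :
    ‖e (complexMat s * τ).trace‖ =
      Real.exp (-(2 * Real.pi * (s * τ.map Complex.im).trace)) := by
  rw [norm_e, im_trace_complexMat_mul]

theorem norm_e_castVec_dotProduct (r : Fin n → ℤ) (u : Fin n → ℝ) :
    ‖e (castVec ℂ r ⬝ᵥ complexVec u)‖ = 1 := by
  have h_real : castVec ℂ r ⬝ᵥ complexVec u = ((castVec ℝ r ⬝ᵥ u : ℝ) : ℂ) := by
    simp [dotProduct]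
  rw [h_real, norm_e_ofReal]

theorem norm_specialization_fract {φ : Matrix (Fin n) (Fin n) ℂ → (Fin n → ℂ) → ℂ}
    (hφ : IsJacobiForm n κ m φ) {τ : Matrix (Fin n) (Fin n) ℂ} (hτ : τ ∈ siegelUpperHalfSpace n)
    (l u : Fin n → ℝ) :
    ‖specialization m φ (complexVec fun i => Int.fract (l i)) (complexVec u) τ‖ =
      ‖specialization m φ (complexVec l) (complexVec u) τ‖ := by
  set a : Fin n → ℤ := fun i => ⌊l i⌋
  have h_split : (complexVec fun i => Int.fract (l i)) + castVec ℂ a = complexVec l := by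
    ext i
    change ((Int.fract (l i) : ℝ) : ℂ) + (⌊l i⌋ : ℂ) = l i
    exact_mod_cast Int.fract_add_floor (l i)
  have h_zero : complexVec u + castVec ℂ (0 : Fin n → ℤ) = complexVec u := by
    ext
    simp
  have h_phase : -(2 * (m : ℂ) * (castVec ℂ a ⬝ᵥ complexVec u)) =
      ((-(2 * m * (castVec ℝ a ⬝ᵥ u)) : ℝ) : ℂ) := by
    simp [dotProduct]
  have h := specialization_add_intCast hφ hτ (complexVec fun i => Int.fract (l i)) (complexVec u)
    a 0
  rw [h_split, h_zero, h_phase] at h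
  rw [h, norm_mul, norm_e_ofReal, one_mul]

theorem HasJacobiFourierExpansion.summable_norm_coeff
    {φ : Matrix (Fin n) (Fin n) ℂ → (Fin n → ℂ) → ℂ}
    {c : Matrix (Fin n) (Fin n) ℚ → (Fin n → ℤ) → ℂ} (hc : HasJacobiFourierExpansion m φ c)
    {a : ℝ} (ha : 0 < a) :
    Summable fun p : HalfInt n × (Fin n → ℤ) =>
      ‖c p.1.1 p.2‖ * Real.exp (-(2 * Real.pi * (a * (realMat p.1.1).trace))) := by
  have hτ : complexMat 0 + Complex.I • complexMat (a • (1 : Matrix (Fin n) (Fin n) ℝ)) ∈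
      siegelUpperHalfSpace n :=
    complexMat_add_I_smul_mem Matrix.transpose_zero (Matrix.PosDef.one.smul ha)
  refine (hc.hasSum_specialization hτ 0 0).summable.norm.congr fun p => ?_
  rw [norm_mul, norm_e_trace, map_im_complexMat_add_I_smul, norm_mul, norm_e_castVec_dotProduct,
    mul_one, realExponent, specializedMatrix_zero, Matrix.mul_smul, mul_one, Matrix.trace_smul,
    smul_eq_mul]

theorem trace_add_trace_le_trace_realExponent_mul (hm : 0 < m) {c : ℝ} (hc : 0 < c)
    {y : Matrix (Fin n) (Fin n) ℝ} (h_dom : DominatesDiag c y) (h_diag : ∀ i, 1 / 2 ≤ y i i)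
    {p : HalfInt n × (Fin n → ℤ)} (h_pd : (realMat (blockMatrix p.1.1 p.2 m)).PosDef)
    {l : Fin n → ℝ} (hl : ∀ i, |l i| ≤ 1) :
    c / (8 * m) * y.trace + c / 8 * (realMat p.1.1).trace - c * m * n / 2 ≤
      (realExponent l m p * y).trace := by
  have h_term : ∀ i, y i i / (8 * m) + realMat p.1.1 i i / 8 - m / 2 ≤
      realExponent l m p i i * y i i := fun i => by
    have h_ge := inv_four_mul_le_realExponent_apply_self hm h_pd l i
    have h_ge_half := half_sub_le_realExponent_apply_self h_pd.posSemidef (hl i)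
    have h_nonneg : 0 ≤ realExponent l m p i i := le_trans (by positivity) h_ge
    have h_left := mul_le_mul_of_nonneg_right h_ge (one_half_pos.le.trans (h_diag i))
    have h_right := mul_le_mul_of_nonneg_left (h_diag i) h_nonneg
    have h_eighth : y i i / (8 * m) = 1 / (4 * m) * y i i / 2 := by
      field_simp
      ring
    linarith
  have h_sum := Finset.sum_le_sum fun i (_ : i ∈ Finset.univ) => h_term i
  rw [Finset.sum_sub_distrib, Finset.sum_add_distrib, ← Finset.sum_div, ← Finset.sum_div,
    Finset.sum_const, Finset.card_univ, Fintype.card_fin, nsmul_eq_mul] at h_sum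
  calc _ = c * (y.trace / (8 * m) + (realMat p.1.1).trace / 8 - n * (m / 2)) := by
        field_simp
    _ ≤ c * ∑ i, realExponent l m p i i * y i i := mul_le_mul_of_nonneg_left h_sum hc.le
    _ ≤ _ := h_dom.mul_sum_le_trace_mul (posDef_realExponent l h_pd).posSemidef

theorem HasSymmetricCoefficients.norm_specialization_le
    {φ : ℕ → Matrix (Fin n) (Fin n) ℂ → (Fin n → ℂ) → ℂ}
    {c : Matrix (Fin n ⊕ Unit) (Fin n ⊕ Unit) ℚ → ℂ} (hc : HasSymmetricCoefficients n κ φ c)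
    (h_cusp : IsCuspidal φ) (hm : 0 < m) {b : ℝ} (hb : 0 < b) {τ : Matrix (Fin n) (Fin n) ℂ}
    (hτ : τ ∈ siegelSet n b) {l : Fin n → ℝ} (hl : ∀ i, |l i| ≤ 1) (u : Fin n → ℝ) :
    ‖specialization m (φ m) (complexVec l) (complexVec u) τ‖ ≤
      (∑' p : HalfInt n × (Fin n → ℤ), ‖c (blockMatrix p.1.1 p.2 m)‖ *
        Real.exp (-(2 * Real.pi * (b / 8 * (realMat p.1.1).trace)))) *
      Real.exp (2 * Real.pi * (b * m * n / 2) -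
        2 * Real.pi * (b / (8 * m)) * (τ.map Complex.im).trace) := by
  obtain ⟨hτ, h_dom, h_diag⟩ := hτ
  have h_summable := (hc.expansion m).summable_norm_coeff (a := b / 8) (by positivity)
  refine ((hc.expansion m).hasSum_specialization hτ l u).norm_le_of_bounded
    (h_summable.hasSum.mul_right _) fun p => ?_
  rw [norm_mul, norm_mul, norm_e_castVec_dotProduct, norm_e_trace, mul_one,
    mul_assoc ‖_‖ (Real.exp _), ← Real.exp_add]
  rcases eq_or_ne (c (blockMatrix p.1.1 p.2 m)) 0 with h_zero | h_ne
  · rw [h_zero, norm_zero, zero_mul, zero_mul]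
  · have h_trace := mul_le_mul_of_nonneg_left (trace_add_trace_le_trace_realExponent_mul hm hb h_dom
      h_diag (hc.posDef_of_coeff_ne_zero h_cusp h_ne) hl) Real.two_pi_pos.le
    gcongr
    linarith

theorem HasSymmetricCoefficients.exists_boundedAt
    {φ : ℕ → Matrix (Fin n) (Fin n) ℂ → (Fin n → ℂ) → ℂ}
    {c : Matrix (Fin n ⊕ Unit) (Fin n ⊕ Unit) ℚ → ℂ} (hc : HasSymmetricCoefficients n κ φ c)
    (h_cusp : IsCuspidal φ) (hφ : IsJacobiForm n κ m (φ m)) (hm : 0 < m) (A : AddSubgroup ℝ) :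
    ∃ B ≥ 0, ∀ τ ∈ siegelUpperHalfSpace n, BoundedAt κ m (φ m) A B τ := by
  obtain ⟨b, hb, h_induction⟩ := exists_siegelSet_induction n
  obtain ⟨K, hK, h_det⟩ := exists_det_rpow_le_exp (n := n) ((κ : ℝ) / 4)
    (a := 2 * Real.pi * (b / (8 * m))) (by positivity) hb
  set S := ∑' p : HalfInt n × (Fin n → ℤ), ‖c (blockMatrix p.1.1 p.2 m)‖ *
    Real.exp (-(2 * Real.pi * (b / 8 * (realMat p.1.1).trace))) with hS
  have : 0 ≤ S := tsum_nonneg fun p => by positivity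
  refine ⟨S * Real.exp (2 * Real.pi * (b * m * n / 2)) * K, by positivity, h_induction _
    (fun g τ hτ h => h.of_moebius hφ g hτ) fun τ hτ l u _ _ => ?_⟩
  have h_fract : ∀ i, |Int.fract (l i)| ≤ 1 := fun i =>
    (Int.abs_fract (a := l i)).trans_le (Int.fract_lt_one _).le
  rw [← norm_specialization_fract hφ hτ.1]
  refine (mul_le_mul (hc.norm_specialization_le h_cusp hm hb hτ h_fract u) (h_det τ hτ)
    (Real.rpow_nonneg hτ.1.2.det_pos.le _) (by positivity)).trans_eq ?_
  rw [← hS, Real.exp_sub]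
  field_simp

end FixedIndex

section CoefficientBounds

variable {n m : ℕ} {κ : ℤ} {φ : Matrix (Fin n) (Fin n) ℂ → (Fin n → ℂ) → ℂ}
  {c : Matrix (Fin n) (Fin n) ℚ → (Fin n → ℤ) → ℂ} {B : ℝ}

theorem im_dotProduct_mulVec_complexVec (τ : Matrix (Fin n) (Fin n) ℂ) (l : Fin n → ℝ) :
    (complexVec l ⬝ᵥ (τ *ᵥ complexVec l)).im = quadForm (τ.map Complex.im) l := by
  simp [quadForm, dotProduct, Matrix.mulVec]

theorem BoundedAt.norm_apply_le {τ : Matrix (Fin n) (Fin n) ℂ} (h : BoundedAt κ m φ ⊤ B τ)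
    (hτ : τ ∈ siegelUpperHalfSpace n) {l : Fin n → ℝ} {z : Fin n → ℂ}
    (hz : ∀ i, (z i).im = (τ.map Complex.im *ᵥ l) i) :
    ‖φ τ z‖ ≤ B * (τ.map Complex.im).det ^ (-((κ : ℝ) / 4)) *
      Real.exp (2 * Real.pi * (m * quadForm (τ.map Complex.im) l)) := by
  set u : Fin n → ℝ := fun i => (z i).re - (τ.map Complex.re *ᵥ l) i
  have h_arg : τ *ᵥ complexVec l + complexVec u = z := by
    ext i
    apply Complex.ext
    · simp [u, Matrix.mulVec, dotProduct]
    · simp [hz, Matrix.mulVec, dotProduct]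
  have h_im : ((m : ℂ) * (complexVec l ⬝ᵥ (τ *ᵥ complexVec l))).im =
      m * quadForm (τ.map Complex.im) l := by
    rw [← Complex.ofReal_natCast, Complex.im_ofReal_mul, im_dotProduct_mulVec_complexVec]
  have h_det : 0 < (τ.map Complex.im).det ^ ((κ : ℝ) / 4) := Real.rpow_pos_of_pos hτ.2.det_pos _
  have h_bound := h l u (fun _ => trivial) (fun _ => trivial)
  rw [specialization, h_arg, norm_mul, norm_e, h_im, Real.exp_neg, mul_assoc,
    inv_mul_le_iff₀ (Real.exp_pos _), ← le_div_iff₀ h_det] at h_bound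
  rw [Real.rpow_neg hτ.2.det_pos.le]
  exact h_bound.trans_eq (by ring)

theorem HasJacobiFourierExpansion.norm_coeff_le_of_boundedAt
    (hc : HasJacobiFourierExpansion m φ c)
    (hB : ∀ τ ∈ siegelUpperHalfSpace n, BoundedAt κ m φ ⊤ B τ) {y : Matrix (Fin n) (Fin n) ℝ}
    (hy : y.PosDef) (l : Fin n → ℝ) (p : HalfInt n × (Fin n → ℤ)) :
    ‖c p.1.1 p.2‖ ≤ B * y.det ^ (-((κ : ℝ) / 4)) *
      Real.exp (2 * Real.pi * (realExponent l m p * y).trace) := by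
  refine (hc.norm_coeff_le hy (y *ᵥ l) (B := B * y.det ^ (-((κ : ℝ) / 4)) *
    Real.exp (2 * Real.pi * (m * quadForm y l))) (fun τ hτ h_im z hz => ?_) p.1 p.2).trans_eq ?_
  · subst h_im
    exact (hB τ hτ).norm_apply_le hτ hz
  · rw [realExponent, trace_specializedMatrix_mul _ _ _ _ (isSymm_of_posDef hy), mul_assoc,
      ← Real.exp_add, quadForm]
    congr 2
    ring

/-- The Schur complement `T - r rᵗ / (4 m)` of `m` in `(T, r/2; rᵗ/2, m)`, as the exponent of the
specialization at `l = -r / (2 m)`. -/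
noncomputable def schurComplement (m : ℕ) (p : HalfInt n × (Fin n → ℤ)) :
    Matrix (Fin n) (Fin n) ℝ :=
  realExponent (fun i => -(p.2 i : ℝ) / (2 * m)) m p

theorem det_blockMatrix (hm : 0 < m) (p : HalfInt n × (Fin n → ℤ)) :
    (realMat (blockMatrix p.1.1 p.2 m)).det = m * (schurComplement m p).det := by
  have hm' : (m : ℝ) ≠ 0 := Nat.cast_ne_zero.2 hm.ne'
  set M : Matrix Unit Unit ℝ := Matrix.of fun _ _ => (m : ℝ)
  have h_blocks : realMat (blockMatrix p.1.1 p.2 m) = Matrix.fromBlocks (realMat p.1.1)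
      (Matrix.of fun i _ => (p.2 i : ℝ) / 2) (Matrix.of fun _ j => (p.2 j : ℝ) / 2) M := by
    ext (i | i) (j | j) <;> simp [blockMatrix, M]
  have h_inv : M⁻¹ = Matrix.of fun _ _ : Unit => (m : ℝ)⁻¹ :=
    Matrix.inv_eq_left_inv (by ext; simp [Matrix.mul_apply, hm', M])
  have h_det : M.det = m := Matrix.det_unique M
  let _ := M.invertibleOfIsUnitDet (h_det ▸ hm'.isUnit)
  rw [h_blocks, Matrix.det_fromBlocks₂₂, Matrix.invOf_eq_nonsing_inv, h_inv, h_det]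
  congr 2
  ext i j
  simp only [schurComplement, realExponent, specializedMatrix, Matrix.vecMulVec_apply,
    Matrix.mul_apply, Matrix.sub_apply, Matrix.add_apply, Matrix.smul_apply, Matrix.of_apply,
    Finset.univ_unique, Finset.sum_singleton, smul_eq_mul]
  field_simp
  ring

theorem HasJacobiFourierExpansion.norm_coeff_le_det_rpow (hc : HasJacobiFourierExpansion m φ c)
    (hB : ∀ τ ∈ siegelUpperHalfSpace n, BoundedAt κ m φ ⊤ B τ) {p : HalfInt n × (Fin n → ℤ)}
    (h_pd : (realMat (blockMatrix p.1.1 p.2 m)).PosDef) :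
    ‖c p.1.1 p.2‖ ≤
      B * (schurComplement m p).det ^ ((κ : ℝ) / 4) * Real.exp (2 * Real.pi * n) := by
  have h_schur : (schurComplement m p).PosDef := posDef_realExponent _ h_pd
  -- Evaluating at the inverse of the exponent makes the trace equal to `n`.
  have h := hc.norm_coeff_le_of_boundedAt hB h_schur.inv (fun i => -(p.2 i : ℝ) / (2 * m)) p
  rwa [← schurComplement, Matrix.mul_nonsing_inv _ ((Matrix.isUnit_iff_isUnit_det _).1
    h_schur.isUnit), Matrix.trace_one, Fintype.card_fin, Matrix.det_nonsing_inv,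
    Ring.inverse_eq_inv', Real.inv_rpow h_schur.det_pos.le, Real.rpow_neg h_schur.det_pos.le,
    inv_inv] at h

theorem HasJacobiFourierExpansion.coeff_eq_zero_of_neg (hc : HasJacobiFourierExpansion m φ c)
    (hn : 1 ≤ n) (hκ : κ < 0) (hB : ∀ τ ∈ siegelUpperHalfSpace n, BoundedAt κ m φ ⊤ B τ)
    (p : HalfInt n × (Fin n → ℤ)) : c p.1.1 p.2 = 0 := by
  have h_exponent : 0 < (n : ℝ) * -((κ : ℝ) / 4) :=
    mul_pos (Nat.cast_pos.2 hn) (by linarith [(Int.cast_lt_zero (R := ℝ)).2 hκ])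
  set f : ℝ → ℝ := fun a => B * a ^ ((n : ℝ) * -((κ : ℝ) / 4)) *
    Real.exp (2 * Real.pi * (a * (realMat p.1.1).trace))
  have h_le : ∀ a : ℝ, 0 < a → ‖c p.1.1 p.2‖ ≤ f a := fun a ha => by
    have h := hc.norm_coeff_le_of_boundedAt hB (Matrix.PosDef.one.smul ha) 0 p
    rwa [realExponent, specializedMatrix_zero, Matrix.mul_smul, mul_one, Matrix.trace_smul,
      smul_eq_mul, Matrix.det_smul, Matrix.det_one, mul_one, Fintype.card_fin,
      ← Real.rpow_natCast_mul ha.le] at h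
  have h_cont : ContinuousAt f 0 :=
    (continuousAt_const.mul (Real.continuousAt_rpow_const _ _ (Or.inr h_exponent.le))).mul
      (by fun_prop)
  have h_zero : f 0 = 0 := by simp only [f, Real.zero_rpow h_exponent.ne', mul_zero, zero_mul]
  have h_lim : ‖c p.1.1 p.2‖ ≤ f 0 := ge_of_tendsto (h_cont.mono_left nhdsWithin_le_nhds)
    (Filter.eventually_of_mem (self_mem_nhdsWithin (s := Set.Ioi 0)) h_le)
  rwa [h_zero, norm_le_zero_iff] at h_lim

end CoefficientBounds

section Summation

variable {X : Type*}

theorem summable_prod_pi {J : Type*} [Fintype J] {f : X → ℝ} (h_nonneg : ∀ x, 0 ≤ f x)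
    (hf : Summable f) : Summable fun k : J → X => ∏ j, f (k j) := by
  classical
  refine summable_of_sum_le (c := ∏ _j : J, ∑' x, f x)
    (fun k => Finset.prod_nonneg fun j _ => h_nonneg _) fun u => ?_
  have h_subset : u ⊆ Fintype.piFinset fun j => u.image fun k => k j := fun k hk =>
    Fintype.mem_piFinset.2 fun j => Finset.mem_image_of_mem _ hk
  calc ∑ k ∈ u, ∏ j, f (k j)
      ≤ ∑ k ∈ Fintype.piFinset fun j => u.image fun k => k j, ∏ j, f (k j) :=
        Finset.sum_le_sum_of_subset_of_nonneg h_subset fun k _ _ =>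
          Finset.prod_nonneg fun j _ => h_nonneg _
    _ = ∏ j, ∑ x ∈ u.image fun k => k j, f x := (Finset.prod_univ_sum _ _).symm
    _ ≤ ∏ _j : J, ∑' x, f x :=
        Finset.prod_le_prod (fun j _ => Finset.sum_nonneg fun x _ => h_nonneg x) fun j _ =>
          hf.sum_le_tsum _ fun x _ => h_nonneg x

theorem summable_exp_neg_mul_abs {a : ℝ} (ha : 0 < a) :
    Summable fun k : ℤ => Real.exp (-(a * |(k : ℝ)|)) := by
  have h_nat : Summable fun k : ℕ => Real.exp (-(a * k)) := by
    simpa only [mul_comm, mul_neg] using Real.summable_exp_nat_mul_iff.2 (neg_lt_zero.2 ha)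
  exact .of_nat_of_neg (by simpa using h_nat) (by simpa using h_nat)

theorem sum_abs_doubledEntry_le {n : ℕ} {t : HalfInt n} (ht : (realMat t.1).PosSemidef) :
    ∑ p, |(doubledEntry t p : ℝ)| ≤ 2 * n * (realMat t.1).trace := by
  have h_entry : ∀ p, |(doubledEntry t p : ℝ)| ≤ realMat t.1 p.1 p.1 + realMat t.1 p.2 p.2 :=
    fun p => by
      rw [doubledEntry_cast, abs_mul, abs_two]
      linarith [abs_apply_le_of_posSemidef ht p.1 p.2]
  refine (Finset.sum_le_sum fun p _ => h_entry p).trans_eq ?_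
  simp only [Fintype.sum_prod_type, Finset.sum_add_distrib, Finset.sum_const, Finset.card_univ,
    Fintype.card_fin, nsmul_eq_mul, ← Finset.mul_sum, Matrix.trace, Matrix.diag_apply]
  ring

theorem summable_indicator_exp_neg_trace {n : ℕ} {b : ℝ} (hb : 0 < b) :
    Summable ({t : HalfInt n | (realMat t.1).PosSemidef}.indicator fun t =>
      Real.exp (-(b * (realMat t.1).trace))) := by
  set a : ℝ := b / (2 * n + 1) with ha
  have h_summable := (summable_prod_pi (J := Fin n × Fin n) (fun k => (Real.exp_pos _).le)
    (summable_exp_neg_mul_abs (a := a) (by positivity))).comp_injective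
      (doubledEntry_injective (n := n))
  refine .of_nonneg_of_le (Set.indicator_nonneg fun t _ => (Real.exp_pos _).le)
    (Set.indicator_le' (fun t ht => ?_) fun t _ => ?_) h_summable
  · have h_trace : 0 ≤ (realMat t.1).trace := Matrix.PosSemidef.trace_nonneg ht
    have h_sum : a * ∑ p, |(doubledEntry t p : ℝ)| ≤ b * (realMat t.1).trace := calc
      a * ∑ p, |(doubledEntry t p : ℝ)| ≤ a * (2 * n * (realMat t.1).trace) := by
          gcongr
          exact sum_abs_doubledEntry_le ht
      _ ≤ a * ((2 * n + 1) * (realMat t.1).trace) := by gcongr; linarith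
      _ = b * (realMat t.1).trace := by rw [ha]; field_simp
    rw [Function.comp_apply, ← Real.exp_sum, Finset.sum_neg_distrib, ← Finset.mul_sum]
    exact Real.exp_le_exp.2 (neg_le_neg h_sum)
  · exact Finset.prod_nonneg fun j _ => (Real.exp_pos _).le

theorem exists_finset_norm_le_add {w : X → ℝ} (hw : Summable w) {ε : ℝ} (hε : 0 < ε) :
    ∃ S : Finset X, ∀ {E : Type*} [NormedAddCommGroup E] [CompleteSpace E] {f : X → E} {s : E}
      {b α : ℝ}, HasSum f s → 0 ≤ b → (∀ x, ‖f x‖ ≤ b * w x) → (∀ x ∈ S, ‖f x‖ ≤ α) →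
        ‖s‖ ≤ b * ε + S.card * α := by
  obtain ⟨S, hS⟩ := ((tendsto_tsum_compl_atTop_zero w).eventually (gt_mem_nhds hε)).exists
  refine ⟨S, fun {E _ _ f s b α} hf hb h_le hα => ?_⟩
  have h_tail : ‖∑' x : {x // x ∉ S}, f x‖ ≤ b * ∑' x : {x // x ∉ S}, w x :=
    tsum_of_norm_bounded ((hw.subtype _).hasSum.mul_left b) fun x => h_le x
  have h_finite : ‖∑ x ∈ S, f x‖ ≤ S.card * α :=
    (norm_sum_le_of_le S hα).trans_eq (by rw [Finset.sum_const, nsmul_eq_mul])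
  rw [← hf.tsum_eq, ← hf.summable.sum_add_tsum_subtype_compl S, add_comm]
  exact norm_add_le_of_le (h_tail.trans (by gcongr)) h_finite

end Summation

section SymmetryBounds

variable {n m : ℕ} {p : HalfInt n × (Fin n → ℤ)}

theorem pos_of_posDef_blockMatrix {T : Matrix (Fin n) (Fin n) ℚ} {r : Fin n → ℤ}
    (h_pd : (realMat (blockMatrix T r m)).PosDef) : 0 < m := by
  simpa [blockMatrix] using h_pd.diag_pos (i := Sum.inr ())

theorem schurComplement_apply_self_add (hm : 0 < m) (l : Fin n → ℝ)
    (p : HalfInt n × (Fin n → ℤ)) (i : Fin n) :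
    schurComplement m p i i + (p.2 i + 2 * m * l i) ^ 2 / (4 * m) = realExponent l m p i i := by
  have hm' : (m : ℝ) ≠ 0 := Nat.cast_ne_zero.2 hm.ne'
  rw [schurComplement, realExponent_apply_self, realExponent_apply_self]
  field_simp
  ring

variable {N : ℕ} {A : Fin n → ℤ}

theorem schurComplement_apply_self_add_le (hN : 0 < N)
    (h_pd : (realMat (blockMatrix p.1.1 p.2 m)).PosDef) (i : Fin n) :
    schurComplement m p i i + (p.2 i + 2 * m * torsionVec N A i) ^ 2 / (4 * m) ≤
      realMat (torsionExponent N A m p).1 i i := by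
  rw [schurComplement_apply_self_add (pos_of_posDef_blockMatrix h_pd), realMat_torsionExponent hN]
  exact le_mul_of_one_le_left (posDef_realExponent _ h_pd).posSemidef.diag_nonneg
    (one_le_pow₀ (Nat.one_le_cast.2 hN))

theorem det_schurComplement_le (hN : 0 < N)
    (h_pd : (realMat (blockMatrix p.1.1 p.2 m)).PosDef) :
    (schurComplement m p).det ≤
      n.factorial * (realMat (torsionExponent N A m p).1).trace ^ n := by
  have h_schur : (schurComplement m p).PosSemidef := (posDef_realExponent _ h_pd).posSemidef
  have h_trace : (schurComplement m p).trace ≤ (realMat (torsionExponent N A m p).1).trace :=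
    Finset.sum_le_sum fun i _ =>
      (le_add_of_nonneg_right (by positivity)).trans (schurComplement_apply_self_add_le hN h_pd i)
  have := h_schur.trace_nonneg
  exact (det_le_factorial_mul_trace_pow h_schur).trans (by gcongr)

/-- The vector `(N eᵢ, Aᵢ)` represents the `i`-th diagonal entry of the exponent of the
specialization at `A / N`, so symmetry moves that coefficient to one of bounded index. -/
theorem exists_baseChange_blockMatrix_le_torsionExponent (hN : 0 < N) (A : Fin n → ℤ)
    (h_psd : (realMat (blockMatrix p.1.1 p.2 m)).PosSemidef) (i : Fin n) :
    ∃ (u : GL (Fin n ⊕ Unit) ℤ) (q : HalfInt n × (Fin n → ℤ)) (m' : ℕ),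
      baseChange u (blockMatrix p.1.1 p.2 m) = blockMatrix q.1.1 q.2 m' ∧
      (m' : ℝ) ≤ realMat (torsionExponent N A m p).1 i i := by
  have hN' : (N : ℝ) ≠ 0 := Nat.cast_ne_zero.2 hN.ne'
  set v : Fin n ⊕ Unit → ℤ := Sum.elim (Pi.single i (N : ℤ)) fun _ => A i with hv
  have hv_ne : v ≠ 0 := fun h => by simpa [hv, hN.ne'] using congrFun h (Sum.inl i)
  have hv_real : castVec ℝ v = Sum.elim (Pi.single i (N : ℝ)) fun _ => (A i : ℝ) := by
    ext (j | j)
    · rcases eq_or_ne j i with rfl | hj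
      · simp [hv, castVec]
      · simp [hv, castVec, hj]
    · rfl
  have h_value : quadForm (realMat (blockMatrix p.1.1 p.2 m)) (castVec ℝ v) =
      realMat (torsionExponent N A m p).1 i i := by
    rw [hv_real, quadForm_blockMatrix_single, realMat_torsionExponent hN, Matrix.smul_apply,
      realExponent_apply_self, torsionVec]
    simp only [Pi.smul_apply, smul_eq_mul]
    field_simp
  obtain ⟨u, T, r, m', h_block, h_le⟩ :=
    (halfIntegral_blockMatrix p.1 p.2 m).exists_baseChange_eq_blockMatrix h_psd hv_ne
  exact ⟨u, (T, r), m', h_block, h_le.trans_eq h_value⟩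

variable {κ : ℤ} {φ : ℕ → Matrix (Fin n) (Fin n) ℂ → (Fin n → ℂ) → ℂ}
  {c : Matrix (Fin n ⊕ Unit) (Fin n ⊕ Unit) ℚ → ℂ}

theorem HasSymmetricCoefficients.exists_boundedAt_of_le (hc : HasSymmetricCoefficients n κ φ c)
    (h_cusp : IsCuspidal φ) (hφ : ∀ m, IsJacobiForm n κ m (φ m)) (A : AddSubgroup ℝ) (M : ℕ) :
    ∃ B ≥ 0, ∀ m, 0 < m → m ≤ M → ∀ τ ∈ siegelUpperHalfSpace n, BoundedAt κ m (φ m) A B τ := by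
  choose B hB_nonneg hB using fun m : ℕ => hc.exists_boundedAt h_cusp (hφ (m + 1)) m.succ_pos A
  refine ⟨∑ k ∈ Finset.range M, B k, Finset.sum_nonneg fun k _ => hB_nonneg k,
    fun m hm h_le τ hτ l u hl hu => ?_⟩
  obtain ⟨k, rfl⟩ := Nat.exists_eq_succ_of_ne_zero hm.ne'
  exact (hB k τ hτ l u hl hu).trans
    (Finset.single_le_sum (fun k _ => hB_nonneg k) (Finset.mem_range.2 h_le))

theorem HasSymmetricCoefficients.norm_coeff_le_of_boundedAt
    (hc : HasSymmetricCoefficients n κ φ c) (hκ : 0 ≤ κ) (hN : 0 < N) {B : ℝ} (hB : 0 ≤ B)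
    (i : Fin n)
    (h_bound : ∀ m' : ℕ, 0 < m' → (m' : ℝ) ≤ realMat (torsionExponent N A m p).1 i i →
      ∀ τ ∈ siegelUpperHalfSpace n, BoundedAt κ m' (φ m') ⊤ B τ)
    (h_pd : (realMat (blockMatrix p.1.1 p.2 m)).PosDef) :
    ‖c (blockMatrix p.1.1 p.2 m)‖ ≤
      B * (m * (n.factorial * (realMat (torsionExponent N A m p).1).trace ^ n)) ^ ((κ : ℝ) / 4) *
        Real.exp (2 * Real.pi * n) := by
  have : (0 : ℝ) ≤ κ / 4 := div_nonneg (Int.cast_nonneg hκ) zero_le_four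
  obtain ⟨u, q, m', h_block, h_le⟩ :=
    exists_baseChange_blockMatrix_le_torsionExponent hN A h_pd.posSemidef i
  have hq_pd : (realMat (blockMatrix q.1.1 q.2 m')).PosDef := by
    rw [← h_block, realMat_baseChange]
    exact posDef_baseChange h_pd u
  have hm' : 0 < m' := pos_of_posDef_blockMatrix hq_pd
  have hq_det : 0 < (schurComplement m' q).det := (posDef_realExponent _ hq_pd).det_pos
  have h_det : m' * (schurComplement m' q).det = m * (schurComplement m p).det := by
    rw [← det_blockMatrix hm', ← det_blockMatrix (pos_of_posDef_blockMatrix h_pd), ← h_block,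
      realMat_baseChange, det_baseChange]
  have h_det_le : (schurComplement m' q).det ≤
      m * (n.factorial * (realMat (torsionExponent N A m p).1).trace ^ n) := calc
    (schurComplement m' q).det ≤ m' * (schurComplement m' q).det :=
      le_mul_of_one_le_left hq_det.le (Nat.one_le_cast.2 hm')
    _ = m * (schurComplement m p).det := h_det
    _ ≤ _ := by
      gcongr
      exact det_schurComplement_le hN h_pd
  rw [← hc.norm_baseChange u (halfIntegral_blockMatrix p.1 p.2 m) h_pd.posSemidef, h_block]
  exact ((hc.expansion m').norm_coeff_le_det_rpow (h_bound m' hm' h_le) hq_pd).trans (by gcongr)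

theorem HasSymmetricCoefficients.exists_norm_coeff_le_rpow
    (hc : HasSymmetricCoefficients n κ φ c) (h_cusp : IsCuspidal φ)
    (hφ : ∀ m, IsJacobiForm n κ m (φ m)) (hn : 1 ≤ n) (hκ : 0 ≤ κ) (hN : 0 < N)
    (t : HalfInt n) :
    ∃ K ≥ 0, ∀ (m : ℕ) (A : Fin n → ℤ) (p : HalfInt n × (Fin n → ℤ)),
      torsionExponent N A m p = t → (realMat (blockMatrix p.1.1 p.2 m)).PosDef →
        ‖c (blockMatrix p.1.1 p.2 m)‖ ≤ K * (m : ℝ) ^ ((κ : ℝ) / 4) := by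
  let i : Fin n := ⟨0, hn⟩
  obtain ⟨B, hB_nonneg, hB⟩ := hc.exists_boundedAt_of_le h_cusp hφ ⊤ ⌊realMat t.1 i i⌋₊
  refine ⟨B * |n.factorial * (realMat t.1).trace ^ n| ^ ((κ : ℝ) / 4) *
    Real.exp (2 * Real.pi * n), by positivity, ?_⟩
  rintro m A p rfl h_pd
  have h_trace : 0 ≤ (n.factorial * (realMat (torsionExponent N A m p).1).trace ^ n : ℝ) :=
    (posDef_realExponent _ h_pd).det_pos.le.trans (det_schurComplement_le hN h_pd)
  refine (hc.norm_coeff_le_of_boundedAt hκ hN hB_nonneg i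
    (fun m' hm' h_le => hB m' hm' (Nat.le_floor h_le)) h_pd).trans_eq ?_
  rw [abs_of_nonneg h_trace, Real.mul_rpow (Nat.cast_nonneg m) h_trace]
  ring

end SymmetryBounds

section TorsionCoefficientBounds

variable {n m N : ℕ} {A : Fin n → ℤ}

theorem injective_snd_torsionExponent_fiber (hN : 0 < N) (A : Fin n → ℤ) (m : ℕ)
    (t : HalfInt n) :
    Function.Injective fun p : torsionExponent N A m ⁻¹' {t} => p.1.2 := by
  rintro ⟨⟨T, r⟩, hT⟩ ⟨⟨T', r'⟩, hT'⟩ (rfl : r = r')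
  have h_eq := congrArg Subtype.val (hT.trans hT'.symm)
  simp only [torsionExponent, specializedMatrix, add_left_inj] at h_eq
  have hN' : (N : ℚ) ^ 2 ≠ 0 := pow_ne_zero 2 (Nat.cast_ne_zero.2 hN.ne')
  obtain rfl : T = T' := Subtype.ext (smul_right_injective _ hN' h_eq)
  rfl

theorem card_Icc_ceil_floor_le (x : ℝ) {ρ : ℝ} (hρ : 0 ≤ ρ) :
    ((Finset.Icc ⌈x - ρ⌉ ⌊x + ρ⌋).card : ℝ) ≤ 2 * ρ + 1 := by
  have h_card : ((Finset.Icc ⌈x - ρ⌉ ⌊x + ρ⌋).card : ℝ) =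
      (max (⌊x + ρ⌋ + 1 - ⌈x - ρ⌉) 0 : ℤ) := by
    rw [Int.card_Icc, ← Int.cast_natCast, Int.ofNat_toNat]
  rw [h_card, Int.cast_max]
  refine max_le ?_ (by push_cast; positivity)
  push_cast
  linarith [Int.le_ceil (x - ρ), Int.floor_le (x + ρ)]

theorem sq_add_le_mul_trace (hN : 0 < N) {p : HalfInt n × (Fin n → ℤ)}
    (h_pd : (realMat (blockMatrix p.1.1 p.2 m)).PosDef) (i : Fin n) :
    (p.2 i + 2 * m * torsionVec N A i) ^ 2 ≤
      4 * m * (realMat (torsionExponent N A m p).1).trace := by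
  have hm : (0 : ℝ) < m := Nat.cast_pos.2 (pos_of_posDef_blockMatrix h_pd)
  have h_schur : 0 ≤ schurComplement m p i i :=
    (posDef_realExponent _ h_pd).posSemidef.diag_nonneg
  have h_diag := schurComplement_apply_self_add_le (A := A) hN h_pd
  have h_trace : realMat (torsionExponent N A m p).1 i i ≤
      (realMat (torsionExponent N A m p).1).trace :=
    Finset.single_le_sum (f := fun j => realMat (torsionExponent N A m p).1 j j)
      (fun j _ => le_trans (add_nonneg (posDef_realExponent _ h_pd).posSemidef.diag_nonneg
        (by positivity)) (h_diag j)) (Finset.mem_univ i)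
  rw [← div_le_iff₀' (by positivity)]
  linarith [h_diag i]

variable {κ : ℤ} {φ : ℕ → Matrix (Fin n) (Fin n) ℂ → (Fin n → ℂ) → ℂ}
  {c : Matrix (Fin n ⊕ Unit) (Fin n ⊕ Unit) ℚ → ℂ}

theorem HasSymmetricCoefficients.exists_finset_torsionExponent_fiber
    (hc : HasSymmetricCoefficients n κ φ c) (h_cusp : IsCuspidal φ) (hN : 0 < N) (hm : 0 < m)
    (A : Fin n → ℤ) (t : HalfInt n) :
    ∃ S : Finset (torsionExponent N A m ⁻¹' {t}),
      (∀ p ∉ S, c (blockMatrix p.1.1.1 p.1.2 m) = 0) ∧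
      (S.card : ℝ) ≤ ((4 * √|(realMat t.1).trace| + 1) * √m) ^ n := by
  set ρ : ℝ := 2 * (√|(realMat t.1).trace| * √m) with hρ
  have h_inj := injective_snd_torsionExponent_fiber hN A m t
  let R : Finset (Fin n → ℤ) := Fintype.piFinset fun i =>
    Finset.Icc ⌈-(2 * m * torsionVec N A i) - ρ⌉ ⌊-(2 * m * torsionVec N A i) + ρ⌋
  refine ⟨R.preimage _ h_inj.injOn, fun p hp => ?_, ?_⟩
  · by_contra h_ne
    refine hp (Finset.mem_preimage.2 (Fintype.mem_piFinset.2 fun i => ?_))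
    have h_sq := sq_add_le_mul_trace (A := A) hN (hc.posDef_of_coeff_ne_zero h_cusp h_ne) i
    rw [p.2] at h_sq
    have h_abs := abs_le_of_sq_le_sq' (b := ρ) (h_sq.trans (by
      rw [hρ, mul_pow, mul_pow, Real.sq_sqrt (abs_nonneg _), Real.sq_sqrt (Nat.cast_nonneg m)]
      nlinarith [le_abs_self (realMat t.1).trace])) (by positivity)
    rw [Finset.mem_Icc, Int.ceil_le, Int.le_floor]
    constructor <;> linarith [h_abs.1, h_abs.2]
  · have h_sqrt : 1 ≤ √(m : ℝ) := Real.one_le_sqrt.2 (Nat.one_le_cast.2 hm)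
    calc ((R.preimage _ h_inj.injOn).card : ℝ)
        ≤ R.card := Nat.cast_le.2 (Finset.card_le_card_of_injOn _
          (fun p hp => Finset.mem_preimage.1 hp) h_inj.injOn)
      _ = ∏ i, ((Finset.Icc ⌈-(2 * m * torsionVec N A i) - ρ⌉
          ⌊-(2 * m * torsionVec N A i) + ρ⌋).card : ℝ) := by
        rw [Fintype.card_piFinset, Nat.cast_prod]
      _ ≤ ∏ _i : Fin n, ((4 * √|(realMat t.1).trace| + 1) * √m) := by
        refine Finset.prod_le_prod (fun i _ => by positivity) fun i _ =>
          (card_Icc_ceil_floor_le _ (by positivity)).trans ?_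
        linarith
      _ = _ := by rw [Finset.prod_const, Finset.card_univ, Fintype.card_fin]

theorem HasSymmetricCoefficients.exists_norm_torsionCoeff_le
    (hc : HasSymmetricCoefficients n κ φ c) (h_cusp : IsCuspidal φ)
    (hφ : ∀ m, IsJacobiForm n κ m (φ m)) (hn : 1 ≤ n) (hκ : 0 ≤ κ) (hN : 0 < N)
    (t : HalfInt n) :
    ∃ K ≥ 0, ∀ m : ℕ, 0 < m → ∀ A U : Fin n → ℤ,
      ‖torsionCoeff N (fun T r => c (blockMatrix T r m)) A U m t‖ ≤
        K * (m : ℝ) ^ ((κ : ℝ) / 4 + (n : ℝ) / 2) := by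
  obtain ⟨K, hK_nonneg, hK⟩ := hc.exists_norm_coeff_le_rpow h_cusp hφ hn hκ hN t
  refine ⟨(4 * √|(realMat t.1).trace| + 1) ^ n * K, by positivity, fun m hm A U => ?_⟩
  obtain ⟨S, hS, h_card⟩ := hc.exists_finset_torsionExponent_fiber h_cusp hN hm A t
  have h_term : ∀ p : torsionExponent N A m ⁻¹' {t},
      ‖c (blockMatrix p.1.1.1 p.1.2 m) * e (castVec ℂ p.1.2 ⬝ᵥ complexVec (torsionVec N U))‖ ≤
        K * (m : ℝ) ^ ((κ : ℝ) / 4) := fun p => by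
    rw [norm_mul, norm_e_castVec_dotProduct, mul_one]
    rcases eq_or_ne (c (blockMatrix p.1.1.1 p.1.2 m)) 0 with h_zero | h_ne
    · rw [h_zero, norm_zero]
      positivity
    · exact hK m A p.1 p.2 (hc.posDef_of_coeff_ne_zero h_cusp h_ne)
  have h_rpow : √(m : ℝ) ^ n * (m : ℝ) ^ ((κ : ℝ) / 4) =
      (m : ℝ) ^ ((κ : ℝ) / 4 + (n : ℝ) / 2) := by
    rw [Real.rpow_add (Nat.cast_pos.2 hm), Real.rpow_div_two_eq_sqrt _ (Nat.cast_nonneg m),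
      Real.rpow_natCast, mul_comm]
  rw [torsionCoeff, tsum_eq_sum fun p hp => by rw [hS p hp, zero_mul]]
  calc _ ≤ S.card * (K * (m : ℝ) ^ ((κ : ℝ) / 4)) :=
        (norm_sum_le_of_le S fun p _ => h_term p).trans_eq
          (by rw [Finset.sum_const, nsmul_eq_mul])
    _ ≤ ((4 * √|(realMat t.1).trace| + 1) * √m) ^ n * (K * (m : ℝ) ^ ((κ : ℝ) / 4)) := by
        gcongr
    _ = _ := by rw [← h_rpow, mul_pow]; ring

end TorsionCoefficientBounds

section TorsionGroup

variable {n : ℕ}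

/-- The group `(1/N) ℤ`. -/
noncomputable def torsionGroup (N : ℕ) : AddSubgroup ℝ := AddSubgroup.zmultiples (N : ℝ)⁻¹

theorem torsionVec_apply_mem_torsionGroup (N : ℕ) (A : Fin n → ℤ) (i : Fin n) :
    torsionVec N A i ∈ torsionGroup N :=
  AddSubgroup.mem_zmultiples_iff.2 ⟨A i, (zsmul_eq_mul _ _).trans (mul_comm _ _)⟩

theorem exists_eq_torsionVec_of_mem_torsionGroup {N : ℕ} {l : Fin n → ℝ}
    (hl : ∀ i, l i ∈ torsionGroup N) : ∃ A : Fin n → ℤ, l = torsionVec N A := by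
  choose A hA using fun i => AddSubgroup.mem_zmultiples_iff.1 (hl i)
  exact ⟨A, funext fun i => (hA i).symm.trans ((zsmul_eq_mul _ _).trans (mul_comm _ _))⟩

end TorsionGroup

section Decay

variable {n : ℕ} {t : HalfInt n}

theorem one_le_apply_self_of_posDef (ht : (realMat t.1).PosDef) (i : Fin n) :
    1 ≤ realMat t.1 i i := by
  obtain ⟨a, ha⟩ := t.2.2.1 i
  have h_cast : realMat t.1 i i = a := (congrArg (Rat.cast : ℚ → ℝ) ha).trans (Rat.cast_intCast a)
  have h_pos : 0 < realMat t.1 i i := ht.diag_pos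
  rw [h_cast] at h_pos ⊢
  exact_mod_cast h_pos

theorem trace_add_trace_le_trace_mul (ht : (realMat t.1).PosDef) {c : ℝ} (hc : 0 ≤ c)
    {y : Matrix (Fin n) (Fin n) ℝ} (h_dom : DominatesDiag c y) (h_diag : ∀ i, 1 / 2 ≤ y i i) :
    c / 2 * y.trace + c / 4 * (realMat t.1).trace ≤ (realMat t.1 * y).trace := by
  have h_sum := Finset.sum_le_sum fun i (_ : i ∈ Finset.univ) =>
    show y i i / 2 + realMat t.1 i i / 4 ≤ realMat t.1 i i * y i i by
      nlinarith [h_diag i, one_le_apply_self_of_posDef ht i]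
  rw [Finset.sum_add_distrib, ← Finset.sum_div, ← Finset.sum_div] at h_sum
  calc _ = c * (y.trace / 2 + (realMat t.1).trace / 4) := by ring
    _ ≤ c * ∑ i, realMat t.1 i i * y i i := mul_le_mul_of_nonneg_left h_sum hc
    _ ≤ _ := h_dom.mul_sum_le_trace_mul ht.posSemidef

theorem exists_norm_e_traceMul_mul_det_rpow_le (s : ℝ) {c : ℝ} (hc : 0 < c) {M : ℕ}
    (hM : 0 < M) :
    ∃ K > 0, ∀ τ ∈ siegelSet n c, ∀ t : HalfInt n, (realMat t.1).PosDef →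
      ‖e (traceMul t.1 τ / M)‖ * (τ.map Complex.im).det ^ s ≤
        K * Real.exp (-(2 * Real.pi * (c / (4 * M)) * (realMat t.1).trace)) := by
  have hM' : (0 : ℝ) < M := Nat.cast_pos.2 hM
  obtain ⟨K, hK, h_det⟩ := exists_det_rpow_le_exp (n := n) s
    (a := 2 * Real.pi * (c / (2 * M))) (by positivity) hc
  refine ⟨K, hK, fun τ hτ t ht => ?_⟩
  have h_trace : c / (2 * M) * (τ.map Complex.im).trace + c / (4 * M) * (realMat t.1).trace ≤
      (realMat t.1 * τ.map Complex.im).trace / M := by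
    rw [le_div_iff₀ hM']
    refine le_trans (le_of_eq ?_) (trace_add_trace_le_trace_mul ht hc.le hτ.2.1 hτ.2.2)
    field_simp
  have h_exp := mul_le_mul_of_nonneg_left h_trace Real.two_pi_pos.le
  rw [norm_e, Complex.div_natCast_im, traceMul_eq, im_trace_complexMat_mul]
  refine (mul_le_mul_of_nonneg_left (h_det τ hτ) (Real.exp_pos _).le).trans ?_
  rw [mul_left_comm, ← Real.exp_add]
  gcongr
  linarith

end Decay

section UniformBounds

variable {n m N : ℕ} {κ : ℤ} {φ : ℕ → Matrix (Fin n) (Fin n) ℂ → (Fin n → ℂ) → ℂ}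
  {c : Matrix (Fin n ⊕ Unit) (Fin n ⊕ Unit) ℚ → ℂ}

theorem HasSymmetricCoefficients.norm_torsionCoeff_le_of_boundedAt
    (hc : HasSymmetricCoefficients n κ φ c) (hN : 0 < N) {B : ℝ}
    (hB : ∀ τ ∈ siegelUpperHalfSpace n, BoundedAt κ m (φ m) (torsionGroup N) B τ) {a : ℝ}
    (ha : 0 < a) (A U : Fin n → ℤ) (t : HalfInt n) :
    ‖torsionCoeff N (fun T r => c (blockMatrix T r m)) A U m t‖ ≤
      B * (a ^ n) ^ (-((κ : ℝ) / 4)) *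
        Real.exp (2 * Real.pi * (a * (realMat t.1).trace / (N ^ 2 : ℕ))) := by
  have h_det : (a • (1 : Matrix (Fin n) (Fin n) ℝ)).det = a ^ n := by simp
  have h := norm_coeff_le_of_hasSum_traceMul (pow_pos hN 2)
    (fun τ hτ => (hc.expansion m).hasSum_torsionCoeff hN hτ A U) (Matrix.PosDef.one.smul ha)
    (B := B * (a ^ n) ^ (-((κ : ℝ) / 4))) (fun τ hτ h_im => ?_) t
  · rwa [Matrix.mul_smul, mul_one, Matrix.trace_smul, smul_eq_mul] at h
  · have h_bound := hB τ hτ _ _ (torsionVec_apply_mem_torsionGroup N A)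
      (torsionVec_apply_mem_torsionGroup N U)
    rw [h_im, h_det] at h_bound
    rwa [Real.rpow_neg (by positivity), ← div_eq_mul_inv, le_div_iff₀ (by positivity)]

theorem HasSymmetricCoefficients.norm_torsionCoeff_mul_exp_le
    (hc : HasSymmetricCoefficients n κ φ c) (h_cusp : IsCuspidal φ) (hN : 0 < N) {B : ℝ}
    (hB : ∀ τ ∈ siegelUpperHalfSpace n, BoundedAt κ m (φ m) (torsionGroup N) B τ) {b : ℝ}
    (hb : 0 < b) (A U : Fin n → ℤ) (t : HalfInt n) :
    ‖torsionCoeff N (fun T r => c (blockMatrix T r m)) A U m t‖ *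
        Real.exp (-(2 * Real.pi * (b / (4 * (N ^ 2 : ℕ))) * (realMat t.1).trace)) ≤
      B * ((b / 8) ^ n) ^ (-((κ : ℝ) / 4)) *
        {t : HalfInt n | (realMat t.1).PosSemidef}.indicator (fun t =>
          Real.exp (-(2 * Real.pi * (b / (8 * (N ^ 2 : ℕ))) * (realMat t.1).trace))) t := by
  have h_le := hc.norm_torsionCoeff_le_of_boundedAt hN hB (a := b / 8) (by positivity) A U t
  rcases eq_or_ne (torsionCoeff N (fun T r => c (blockMatrix T r m)) A U m t) 0 with h_zero | h_ne
  · rw [h_zero, norm_zero] at h_le ⊢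
    rw [zero_mul]
    exact mul_nonneg (nonneg_of_mul_nonneg_left h_le (Real.exp_pos _))
      (Set.indicator_nonneg (fun t _ => (Real.exp_pos _).le) t)
  · have h_mem : t ∈ {t : HalfInt n | (realMat t.1).PosSemidef} :=
      (hc.posDef_of_torsionCoeff_ne_zero h_cusp hN h_ne).posSemidef
    refine (mul_le_mul_of_nonneg_right h_le (Real.exp_pos _).le).trans_eq ?_
    rw [Set.indicator_of_mem h_mem, mul_assoc _ (Real.exp _), ← Real.exp_add]
    congr 2
    ring

theorem HasSymmetricCoefficients.norm_torsionCoeff_mul_exp_le_self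
    (hc : HasSymmetricCoefficients n κ φ c) (h_cusp : IsCuspidal φ) (hN : 0 < N) {b : ℝ}
    (hb : 0 ≤ b) (A U : Fin n → ℤ) (t : HalfInt n) :
    ‖torsionCoeff N (fun T r => c (blockMatrix T r m)) A U m t‖ *
        Real.exp (-(b * (realMat t.1).trace)) ≤
      ‖torsionCoeff N (fun T r => c (blockMatrix T r m)) A U m t‖ := by
  rcases eq_or_ne (torsionCoeff N (fun T r => c (blockMatrix T r m)) A U m t) 0 with h_zero | h_ne
  · rw [h_zero, norm_zero, zero_mul]
  · have h_trace : 0 ≤ (realMat t.1).trace :=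
      (hc.posDef_of_torsionCoeff_ne_zero h_cusp hN h_ne).posSemidef.trace_nonneg
    exact mul_le_of_le_one_right (norm_nonneg _)
      (Real.exp_le_one_iff.2 (neg_nonpos.2 (mul_nonneg hb h_trace)))

theorem HasSymmetricCoefficients.exists_norm_torsionCoeff_mul_e_mul_det_rpow_le
    (hc : HasSymmetricCoefficients n κ φ c) (h_cusp : IsCuspidal φ) (hN : 0 < N) {b : ℝ}
    (hb : 0 < b) (s : ℝ) :
    ∃ K > 0, ∀ τ ∈ siegelSet n b, ∀ (m : ℕ) (A U : Fin n → ℤ) (t : HalfInt n),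
      ‖torsionCoeff N (fun T r => c (blockMatrix T r m)) A U m t *
          e (traceMul t.1 τ / (N ^ 2 : ℕ)) * ((τ.map Complex.im).det ^ s : ℝ)‖ ≤
        ‖torsionCoeff N (fun T r => c (blockMatrix T r m)) A U m t‖ *
          Real.exp (-(2 * Real.pi * (b / (4 * (N ^ 2 : ℕ))) * (realMat t.1).trace)) * K := by
  obtain ⟨K, hK, h_decay⟩ := exists_norm_e_traceMul_mul_det_rpow_le (n := n) s hb (pow_pos hN 2)
  refine ⟨K, hK, fun τ hτ m A U t => ?_⟩
  rw [norm_mul, norm_mul, Complex.norm_of_nonneg (Real.rpow_nonneg hτ.1.2.det_pos.le _),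
    mul_assoc, mul_assoc, mul_comm (Real.exp _)]
  rcases eq_or_ne (torsionCoeff N (fun T r => c (blockMatrix T r m)) A U m t) 0 with h_zero | h_ne
  · rw [h_zero, norm_zero, zero_mul, zero_mul]
  · exact mul_le_mul_of_nonneg_left
      (h_decay τ hτ t (hc.posDef_of_torsionCoeff_ne_zero h_cusp hN h_ne)) (norm_nonneg _)

/-- All but finitely many exponents, independently of `m`, contribute at most `B / 2`; the
remaining ones are controlled by the coefficient bounds coming from the symmetry. -/
theorem HasSymmetricCoefficients.exists_boundedAt_half_add
    (hc : HasSymmetricCoefficients n κ φ c) (h_cusp : IsCuspidal φ)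
    (hφ : ∀ m, IsJacobiForm n κ m (φ m)) (hn : 1 ≤ n) (hκ : 0 ≤ κ) (hN : 0 < N) :
    ∃ C ≥ 0, ∀ m : ℕ, 0 < m → ∀ B : ℝ,
      (∀ τ ∈ siegelUpperHalfSpace n, BoundedAt κ m (φ m) (torsionGroup N) B τ) →
      ∀ τ ∈ siegelUpperHalfSpace n, BoundedAt κ m (φ m) (torsionGroup N)
        (B / 2 + C * (m : ℝ) ^ ((κ : ℝ) / 4 + (n : ℝ) / 2)) τ := by
  obtain ⟨b, hb, h_induction⟩ := exists_siegelSet_induction n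
  obtain ⟨K₁, hK₁, h_term⟩ :=
    hc.exists_norm_torsionCoeff_mul_e_mul_det_rpow_le h_cusp hN hb ((κ : ℝ) / 4)
  have : (0 : ℝ) < (N ^ 2 : ℕ) := Nat.cast_pos.2 (pow_pos hN 2)
  set K₀ : ℝ := ((b / 8) ^ n) ^ (-((κ : ℝ) / 4)) with hK₀
  have : 0 < K₀ := by positivity
  obtain ⟨S, hS⟩ := exists_finset_norm_le_add (summable_indicator_exp_neg_trace (n := n)
    (b := 2 * Real.pi * (b / (8 * (N ^ 2 : ℕ)))) (by positivity)) (ε := 1 / (2 * (K₀ * K₁)))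
    (by positivity)
  choose K hK_nonneg hK using fun t => hc.exists_norm_torsionCoeff_le h_cusp hφ hn hκ hN t
  have : 0 ≤ ∑ t ∈ S, K t := Finset.sum_nonneg fun t _ => hK_nonneg t
  refine ⟨S.card * ((∑ t ∈ S, K t) * K₁), by positivity, fun m hm B hB => h_induction _
    (fun g τ hτ h => h.of_moebius (hφ m) g hτ) fun τ hτ l u hl hu => ?_⟩
  obtain ⟨A, rfl⟩ := exists_eq_torsionVec_of_mem_torsionGroup hl
  obtain ⟨U, rfl⟩ := exists_eq_torsionVec_of_mem_torsionGroup hu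
  have h_det : 0 ≤ (τ.map Complex.im).det ^ ((κ : ℝ) / 4) := Real.rpow_nonneg hτ.1.2.det_pos.le _
  have : 0 ≤ B := (mul_nonneg (norm_nonneg _) h_det).trans (hB τ hτ.1 _ _ hl hu)
  have h := hS (((hc.expansion m).hasSum_torsionCoeff hN hτ.1 A U).mul_right
      (((τ.map Complex.im).det ^ ((κ : ℝ) / 4) : ℝ) : ℂ))
    (b := B * (K₀ * K₁)) (α := (∑ t ∈ S, K t) * (m : ℝ) ^ ((κ : ℝ) / 4 + (n : ℝ) / 2) * K₁)
    (by positivity) (fun t => (h_term τ hτ m A U t).trans ?_)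
    fun t ht => (h_term τ hτ m A U t).trans ?_
  · rw [norm_mul, Complex.norm_of_nonneg h_det] at h
    refine h.trans_eq ?_
    field_simp
  · refine (mul_le_mul_of_nonneg_right
      (hc.norm_torsionCoeff_mul_exp_le h_cusp hN hB hb A U t) hK₁.le).trans_eq ?_
    rw [← hK₀]
    ring
  · refine mul_le_mul_of_nonneg_right ((hc.norm_torsionCoeff_mul_exp_le_self h_cusp hN
      (by positivity) A U t).trans ((hK t m hm A U).trans ?_)) hK₁.le
    gcongr
    exact Finset.single_le_sum (fun t _ => hK_nonneg t) ht

theorem HasSymmetricCoefficients.exists_boundedAt_rpow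
    (hc : HasSymmetricCoefficients n κ φ c) (h_cusp : IsCuspidal φ)
    (hφ : ∀ m, IsJacobiForm n κ m (φ m)) (hn : 1 ≤ n) (hκ : 0 ≤ κ) (hN : 0 < N) :
    ∃ C ≥ 0, ∀ m : ℕ, 0 < m → ∀ τ ∈ siegelUpperHalfSpace n,
      BoundedAt κ m (φ m) (torsionGroup N) (C * (m : ℝ) ^ ((κ : ℝ) / 4 + (n : ℝ) / 2)) τ := by
  obtain ⟨C, hC, h_half⟩ := hc.exists_boundedAt_half_add h_cusp hφ hn hκ hN
  refine ⟨2 * C, by positivity, fun m hm τ hτ l u hl hu => ?_⟩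
  set E : ℝ := (m : ℝ) ^ ((κ : ℝ) / 4 + (n : ℝ) / 2)
  have hE : 0 ≤ 2 * C * E := by positivity
  obtain ⟨B, -, hB⟩ := hc.exists_boundedAt h_cusp (hφ m) hm (torsionGroup N)
  have h_iterate : ∀ k : ℕ, ∀ τ ∈ siegelUpperHalfSpace n,
      BoundedAt κ m (φ m) (torsionGroup N) (B * (1 / 2) ^ k + 2 * C * E) τ := fun k => by
    induction k with
    | zero =>
      intro τ hτ l u hl hu
      linarith [hB τ hτ l u hl hu]
    | succ k ih =>
      intro τ hτ
      convert h_half m hm _ ih τ hτ using 1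
      ring
  have h_lim : Filter.Tendsto (fun k : ℕ => B * (1 / 2 : ℝ) ^ k + 2 * C * E) Filter.atTop
      (nhds (B * 0 + 2 * C * E)) :=
    ((tendsto_pow_atTop_nhds_zero_of_lt_one (by norm_num) (by norm_num)).const_mul B).add_const _
  rw [mul_zero, zero_add] at h_lim
  exact ge_of_tendsto' h_lim fun k => h_iterate k τ hτ l u hl hu

theorem HasSymmetricCoefficients.specialization_eq_zero_of_neg
    (hc : HasSymmetricCoefficients n κ φ c) (h_cusp : IsCuspidal φ)
    (hφ : IsJacobiForm n κ m (φ m)) (hn : 1 ≤ n) (hκ : κ < 0) (hm : 0 < m)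
    {τ : Matrix (Fin n) (Fin n) ℂ} (hτ : τ ∈ siegelUpperHalfSpace n) (l u : Fin n → ℝ) :
    specialization m (φ m) (complexVec l) (complexVec u) τ = 0 := by
  obtain ⟨B, -, hB⟩ := hc.exists_boundedAt h_cusp hφ hm ⊤
  refine ((hc.expansion m).hasSum_specialization hτ l u).unique (hasSum_zero.congr_fun fun p => ?_)
  rw [(hc.expansion m).coeff_eq_zero_of_neg hn hκ hB p, zero_mul, zero_mul]

theorem HasSymmetricCoefficients.exists_heckeNorm_specialization_le
    (hc : HasSymmetricCoefficients n κ φ c) (h_cusp : IsCuspidal φ)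
    (hφ : ∀ m, IsJacobiForm n κ m (φ m)) (hn : 1 ≤ n) (hN : 0 < N) :
    ∃ C > 0, ∀ m : ℕ, 0 < m → ∀ A U : Fin n → ℤ,
      heckeNorm κ (specialization m (φ m) (complexVec (torsionVec N A))
        (complexVec (torsionVec N U))) ≤
          ENNReal.ofReal (C * (m : ℝ) ^ ((κ : ℝ) / 2 + (n : ℝ) / 2)) := by
  rcases lt_or_ge κ 0 with hκ | hκ
  · refine ⟨1, one_pos, fun m hm A U => iSup₂_le fun τ hτ => ?_⟩
    rw [hc.specialization_eq_zero_of_neg h_cusp (hφ m) hn hκ hm hτ, norm_zero, zero_mul,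
      ENNReal.ofReal_zero]
    exact zero_le
  · have : (0 : ℝ) ≤ κ := Int.cast_nonneg hκ
    obtain ⟨C, hC, h_bound⟩ := hc.exists_boundedAt_rpow h_cusp hφ hn hκ hN
    refine ⟨C + 1, by positivity, fun m hm A U => iSup₂_le fun τ hτ =>
      ENNReal.ofReal_le_ofReal ((h_bound m hm τ hτ _ _ (torsionVec_apply_mem_torsionGroup N A)
        (torsionVec_apply_mem_torsionGroup N U)).trans ?_)⟩
    gcongr
    · exact le_add_of_nonneg_right zero_le_one
    · exact Nat.one_le_cast.2 hm
    · linarith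

end UniformBounds

section TorsionSpecialization

variable {n N : ℕ}

theorem InTorsionLattice.exists_torsionSpecialization_eq (hN : 0 < N) {lam mu : Fin n → ℚ}
    (h_lam : InTorsionLattice N lam) (h_mu : InTorsionLattice N mu)
    (φ : ℕ → Matrix (Fin n) (Fin n) ℂ → (Fin n → ℂ) → ℂ) :
    ∃ A U : Fin n → ℤ, ∀ m, torsionSpecialization φ lam mu m =
      specialization m (φ m) (complexVec (torsionVec N A)) (complexVec (torsionVec N U)) := by
  obtain ⟨A, hA⟩ := h_lam.exists_eq_torsionVec hN
  obtain ⟨U, hU⟩ := h_mu.exists_eq_torsionVec hN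
  refine ⟨A, U, fun m => ?_⟩
  rw [← hA, ← hU]
  rfl

end TorsionSpecialization

end FormalFJ

/-- Genus `g = n + 1 ≥ 2`, weight `k = κ / 2`. -/
theorem mainTheorem2 (n : ℕ) (hn : 1 ≤ n) (κ : ℤ)
    (φ : ℕ → Matrix (Fin n) (Fin n) ℂ → (Fin n → ℂ) → ℂ)
    (hφ : FormalFJ.IsSymmetricFormalFJ n κ φ) (hcusp : FormalFJ.IsCuspidal φ)
    (N : ℕ) (hN : 0 < N) :
    (∀ lam mu : Fin n → ℚ, FormalFJ.InTorsionLattice N lam → FormalFJ.InTorsionLattice N mu →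
      ∀ m : ℕ, FormalFJ.IsSiegelCuspForm n κ (N ^ 2)
        (FormalFJ.torsionSpecialization φ lam mu m)) ∧
    ∃ C : ℝ, 0 < C ∧
      ∀ lam mu : Fin n → ℚ, FormalFJ.InTorsionLattice N lam → FormalFJ.InTorsionLattice N mu →
        ∀ m : ℕ, 0 < m →
          FormalFJ.heckeNorm κ (FormalFJ.torsionSpecialization φ lam mu m) ≤
            ENNReal.ofReal (C * (m : ℝ) ^ ((κ : ℝ) / 2 + (n : ℝ) / 2)) := by
  obtain ⟨c, h_expansion, h_symmetric⟩ := hφ.symmetric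
  have hc : FormalFJ.HasSymmetricCoefficients n κ φ c := ⟨h_expansion, h_symmetric⟩
  refine ⟨fun lam mu h_lam h_mu m => ?_, ?_⟩
  · obtain ⟨A, U, h_eq⟩ := h_lam.exists_torsionSpecialization_eq hN h_mu φ
    rw [h_eq]
    exact FormalFJ.isSiegelCuspForm_specialization (hφ.jacobi m) hc hcusp hN A U
  · obtain ⟨C, hC, h_le⟩ := hc.exists_heckeNorm_specialization_le hcusp hφ.jacobi hn hN
    refine ⟨C, hC, fun lam mu h_lam h_mu m hm => ?_⟩
    obtain ⟨A, U, h_eq⟩ := h_lam.exists_torsionSpecialization_eq hN h_mu φ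
    rw [h_eq]
    exact h_le m hm A U
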